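/- **Setting.** Let $\mathcal C$ be an admissible ribbon category: a $\mathbb C$-linear ribbon category (braiding $\psi$, twist $\nu$, duals $V^*$ with $\mathrm{ev}_V\colon V^*\otimes V\to\mathbf 1$ and $\mathrm{coev}_V\colon\mathbf 1\to V\otimes V^*$; finite direct sums; $\mathrm{Hom}(\mathbf 1,\mathbf 1)=\mathbb C$; associators are suppressed) with finite-dimensional Hom spaces in which, for all objects $V,W$, the pairing $$\mathrm{Hom}(V^*,W^*)\otimes\mathrm{Hom}(V,W)\to\mathbb C,\qquad f\otimes g\mapsto \mathrm{ev}_W\circ(f\otimes g)\circ\widetilde{\mathrm{coev}}_V,\qquad \widetilde{\mathrm{coev}}_V=(\nu_{V^*}\otimes\mathrm{id}_V)\circ\psi_{V,V^*}\circ\mathrm{coev}_V,$$ is non-degenerate. The quantum trace of $f\colon V\to V$ is $\mathrm{qtr}(f)=\mathrm{ev}_V\circ\psi_{V,V^*}\circ(\nu_V\otimes\mathrm{id}_{V^*})\circ(f\otimes\mathrm{id}_{V^*})\circ\mathrm{coev}_V$. Let $\mathcal C_0$ be a set of colours: a countable set of pairwise non-isomorphic objects which contains, for each $V\in\mathcal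 C_0$, an object isomorphic to $V^*$. Let $\Lambda^{(*)}$ be a finite combinatorial $4$-complex with vertex set $\Lambda$ (a non-empty set of subsets of $\Lambda$, containing all singletons, closed under passing to non-empty subsets; $\Lambda^{(k)}$ is the set of its elements of cardinality $k+1$, and $\Lambda^{(k)}=\emptyset$ for $k>4$) which triangulates a closed oriented piecewise-linear $4$-manifold $M$. For each triangle $t\in\Lambda^{(2)}$ let $\hat w(t)$ be a real-valued function on objects with $\hat w(t)(V^*)=\hat w(t)(V)$, and $\hat w(t)(V)=\hat w(t)(V')$ whenever $V\cong V'$. **Partition function.** Choose a linear order of $\Lambda$. A colouring is a map $V\colon\Lambda^{(2)}\to\mathcal C_0$. For vertices $v_i,v_j,v_k$ of a triangle, $V_{ijk}$ denotes the colour of the triangle if $(v_i,v_j,v_k)$ is an even permutation of its increasing order, and the dual of the colour if it is an odd one. A tetrahedron $(v_0,v_1,v_2,v_3)$ has the state space and dual state space $$H_{0123}=\mathrm{Hom}(V_{123}\otimes V_{013},\,V_{012}\otimes V_{023}),\qquad H_{0123}^*=\mathrm{Hom}(V_{013}^*\otimes V_{123}^*,\,V_{023}^*\otimes V_{012}^*),$$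 paired as above using $(A\otimes B)^*\cong B^*\otimes A^*$. For $\bar\phi_{0123}\in H_{0123}^*$ let $\bar\phi_{0123}^{\,\vee}\colon V_{012}\otimes V_{023}\to V_{123}\otimes V_{013}$ be the morphism whose dual is $\bar\phi_{0123}$. For a $4$-simplex $(v_0,\dots,v_4)$, $v_0<\dots<v_4$, of relative orientation $+1$ in $M$ put $$Z'^{(+)}=\mathrm{qtr}\bigl[(\bar\phi_{1234}^{\,\vee}\otimes\mathrm{id})(\mathrm{id}\otimes\bar\phi_{0134}^{\,\vee})(\bar\phi_{0123}^{\,\vee}\otimes\mathrm{id})(\mathrm{id}\otimes\phi_{0234})(\psi_{V_{012},V_{234}}^{-1}\otimes\mathrm{id})(\mathrm{id}\otimes\phi_{0124})\bigr],$$ and for relative orientation $-1$ $$Z'^{(-)}=\mathrm{qtr}\bigl[(\mathrm{id}\otimes\bar\phi_{0124}^{\,\vee})(\psi_{V_{012},V_{234}}\otimes\mathrm{id})(\mathrm{id}\otimes\bar\phi_{0234}^{\,\vee})(\phi_{0123}\otimes\mathrm{id})(\mathrm{id}\otimes\phi_{0134})(\phi_{1234}\otimes\mathrm{id})\bigr],$$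 both being traces of endomorphisms of $V_{234}\otimes V_{124}\otimes V_{014}$. The pairings turn $Z'^{(\pm)}$ into the $4$-simplex maps $$Z^{(+)}_{01234}\colon H_{0234}\otimes H_{0124}\to H_{1234}\otimes H_{0134}\otimes H_{0123},\qquad Z^{(-)}_{01234}\colon H_{1234}\otimes H_{0134}\otimes H_{0123}\to H_{0234}\otimes H_{0124}.$$ Every tetrahedron occurs exactly once in the domain and once in the codomain of $\bigotimes_{s\in\Lambda^{(4)}}Z_s^{(\epsilon_s)}$, where $\epsilon_s$ is the relative orientation of $s$ in $M$. With $\mathcal H=\bigotimes_{\Lambda^{(3)}}H$ and $P$ the permutation of tensor factors from the order of the codomain to that of the domain, put $$Z^{(V)}=\mathrm{tr}_{\mathcal H}\Bigl[P\circ\bigotimes_{s\in\Lambda^{(4)}}Z_s^{(\epsilon_s)}\Bigr],\qquad Z=\sum_{V\colon\Lambda^{(2)}\to\mathcal C_0}\Bigl(\prod_{t\in\Lambda^{(2)}}\hat w(t)(V(t))\Bigr)Z^{(V)} .$$ **Theorem.** The partition function $Z$ does not depend on the choice of the linear order of the vertices: for any two linear orders of $\Lambda$, the series for $Z$ is (unconditionally)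 summable for one order if and only if it is for the other, and the two values of $Z$ agree. Thus $Z$ is well-defined for the combinatorial complex $\Lambda^{(*)}$. -/

import Mathlib

set_option linter.unusedSectionVars false

open CategoryTheory MonoidalCategory
open scoped TensorProduct Topology

universe u v w

noncomputable section

namespace SpinFoam

/-! ### Ribbon categories -/

/-- A ribbon category: a braided monoidal category in which every object `X` has a dual `Xᘁ` (with
evaluation `ε_ X Xᘁ : Xᘁ ⊗ X ⟶ 𝟙_` and coevaluation `η_ X Xᘁ : 𝟙_ ⟶ X ⊗ Xᘁ`), together with a
twist. Strictness is not required; associators and unitors are written out below. -/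
class RibbonCategory (C : Type u) [Category.{v} C] [MonoidalCategory C] [BraidedCategory C]
    [RightRigidCategory C] where
  /-- the twist -/
  twist : ∀ X : C, X ≅ X
  twist_naturality : ∀ {X Y : C} (f : X ⟶ Y), f ≫ (twist Y).hom = (twist X).hom ≫ f
  twist_tensor : ∀ X Y : C, (twist (X ⊗ Y)).hom =
    (β_ X Y).hom ≫ (β_ Y X).hom ≫ ((twist X).hom ⊗ₘ (twist Y).hom)
  twist_dual : ∀ X : C, rightAdjointMate (twist X).hom = (twist (Xᘁ)).hom
  twist_unit : (twist (𝟙_ C)).hom = 𝟙 (𝟙_ C)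

section Ribbon

variable {C : Type u} [Category.{v} C] [MonoidalCategory C] [BraidedCategory C]
  [RightRigidCategory C] [RibbonCategory C]

open RibbonCategory

/-- The right evaluation `X ⊗ Xᘁ ⟶ 𝟙_`. -/
def evR (X : C) : X ⊗ Xᘁ ⟶ 𝟙_ C :=
  (twist X).hom ▷ Xᘁ ≫ (β_ X (Xᘁ)).hom ≫ ε_ X (Xᘁ)

/-- The right coevaluation `𝟙_ ⟶ Xᘁ ⊗ X`. -/
def coevR (X : C) : 𝟙_ C ⟶ Xᘁ ⊗ X :=
  η_ X (Xᘁ) ≫ (β_ X (Xᘁ)).hom ≫ (twist (Xᘁ)).hom ▷ X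

/-- The quantum trace of an endomorphism, as an endomorphism of the unit object. -/
def qtr {X : C} (f : X ⟶ X) : 𝟙_ C ⟶ 𝟙_ C :=
  η_ X (Xᘁ) ≫ f ▷ Xᘁ ≫ evR X

/-- The pairing of `f : Xᘁ ⟶ Yᘁ` and `g : X ⟶ Y`, as an endomorphism of the unit object. -/
def pairHom {X Y : C} (f : Xᘁ ⟶ Yᘁ) (g : X ⟶ Y) : 𝟙_ C ⟶ 𝟙_ C :=
  coevR X ≫ (f ⊗ₘ g) ≫ ε_ Y (Yᘁ)

/-- For `f : Xᘁ ⟶ Yᘁ`, the morphism `Y ⟶ X` represented by the coupon of `f` rotated by a half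
turn. It is the unique `g` with `gᘁ = f`. -/
def coupon {X Y : C} (f : Xᘁ ⟶ Yᘁ) : Y ⟶ X :=
  (λ_ Y).inv ≫ η_ X (Xᘁ) ▷ Y ≫ (X ◁ f) ▷ Y ≫ (α_ X (Yᘁ) Y).hom ≫ X ◁ ε_ Y (Yᘁ) ≫ (ρ_ X).hom

/-- A morphism `Bᘁ ⊗ Aᘁ ⟶ Eᘁ ⊗ Dᘁ` regarded as a morphism `(A ⊗ B)ᘁ ⟶ (D ⊗ E)ᘁ` through the
canonical isomorphism `(X ⊗ Y)ᘁ ≅ Yᘁ ⊗ Xᘁ`. -/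
def onDuals {A B D E : C} (f : Bᘁ ⊗ Aᘁ ⟶ Eᘁ ⊗ Dᘁ) : (A ⊗ B)ᘁ ⟶ (D ⊗ E)ᘁ :=
  (rightDualTensorIso A B).hom ≫ f ≫ (rightDualTensorIso D E).inv

/-- The diagram, with its bottom and top ends to be closed up by a quantum trace, of a `4`-simplex
of positive orientation. The five coupons are composed in the plane; the only crossing is between
the ribbons `V₀₁₂` and `V₂₃₄`, with `V₀₁₂` crossing over. -/
def diagramPos {V₀₁₂ V₀₁₃ V₀₁₄ V₀₂₃ V₀₂₄ V₀₃₄ V₁₂₃ V₁₂₄ V₁₃₄ V₂₃₄ : C}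
    (b₁₂₃₄ : V₁₂₄ᘁ ⊗ V₂₃₄ᘁ ⟶ V₁₃₄ᘁ ⊗ V₁₂₃ᘁ) (f₀₂₃₄ : V₂₃₄ ⊗ V₀₂₄ ⟶ V₀₂₃ ⊗ V₀₃₄)
    (b₀₁₃₄ : V₀₁₄ᘁ ⊗ V₁₃₄ᘁ ⟶ V₀₃₄ᘁ ⊗ V₀₁₃ᘁ) (f₀₁₂₄ : V₁₂₄ ⊗ V₀₁₄ ⟶ V₀₁₂ ⊗ V₀₂₄)
    (b₀₁₂₃ : V₀₁₃ᘁ ⊗ V₁₂₃ᘁ ⟶ V₀₂₃ᘁ ⊗ V₀₁₂ᘁ) :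
    V₂₃₄ ⊗ (V₁₂₄ ⊗ V₀₁₄) ⟶ V₂₃₄ ⊗ (V₁₂₄ ⊗ V₀₁₄) :=
  V₂₃₄ ◁ f₀₁₂₄ ≫ (α_ _ _ _).inv ≫
    (β_ V₀₁₂ V₂₃₄).inv ▷ V₀₂₄ ≫ (α_ _ _ _).hom ≫
    V₀₁₂ ◁ f₀₂₃₄ ≫ (α_ _ _ _).inv ≫
    coupon (onDuals b₀₁₂₃) ▷ V₀₃₄ ≫ (α_ _ _ _).hom ≫
    V₁₂₃ ◁ coupon (onDuals b₀₁₃₄) ≫ (α_ _ _ _).inv ≫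
    coupon (onDuals b₁₂₃₄) ▷ V₀₁₄ ≫ (α_ _ _ _).hom

/-- The diagram for a `4`-simplex of negative orientation: the mirror image of `diagramPos` with
all arrows reversed. Again the only crossing is `V₀₁₂` over `V₂₃₄`. -/
def diagramNeg {V₀₁₂ V₀₁₃ V₀₁₄ V₀₂₃ V₀₂₄ V₀₃₄ V₁₂₃ V₁₂₄ V₁₃₄ V₂₃₄ : C}
    (f₁₂₃₄ : V₂₃₄ ⊗ V₁₂₄ ⟶ V₁₂₃ ⊗ V₁₃₄) (b₀₂₃₄ : V₀₂₄ᘁ ⊗ V₂₃₄ᘁ ⟶ V₀₃₄ᘁ ⊗ V₀₂₃ᘁ)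
    (f₀₁₃₄ : V₁₃₄ ⊗ V₀₁₄ ⟶ V₀₁₃ ⊗ V₀₃₄) (b₀₁₂₄ : V₀₁₄ᘁ ⊗ V₁₂₄ᘁ ⟶ V₀₂₄ᘁ ⊗ V₀₁₂ᘁ)
    (f₀₁₂₃ : V₁₂₃ ⊗ V₀₁₃ ⟶ V₀₁₂ ⊗ V₀₂₃) :
    V₂₃₄ ⊗ (V₁₂₄ ⊗ V₀₁₄) ⟶ V₂₃₄ ⊗ (V₁₂₄ ⊗ V₀₁₄) :=
  (α_ _ _ _).inv ≫ f₁₂₃₄ ▷ V₀₁₄ ≫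
    (α_ _ _ _).hom ≫ V₁₂₃ ◁ f₀₁₃₄ ≫
    (α_ _ _ _).inv ≫ f₀₁₂₃ ▷ V₀₃₄ ≫
    (α_ _ _ _).hom ≫ V₀₁₂ ◁ coupon (onDuals b₀₂₃₄) ≫
    (α_ _ _ _).inv ≫ (β_ V₀₁₂ V₂₃₄).hom ▷ V₀₂₄ ≫
    (α_ _ _ _).hom ≫ V₂₃₄ ◁ coupon (onDuals b₀₁₂₄)

end Ribbon

section Linear

variable (C : Type u) [Category.{v} C] [MonoidalCategory C] [BraidedCategory C]
  [RightRigidCategory C] [RibbonCategory C] [Preadditive C] [Linear ℂ C]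

/-- The unit object of a `ℂ`-linear monoidal category satisfies `Hom(𝟙_, 𝟙_) = ℂ`. -/
class ScalarUnit : Prop where
  bijective : Function.Bijective (LinearMap.toSpanSingleton ℂ (𝟙_ C ⟶ 𝟙_ C) (𝟙 (𝟙_ C)))

/-- The identification `Hom(𝟙_, 𝟙_) = ℂ`. -/
def scalar [ScalarUnit C] : (𝟙_ C ⟶ 𝟙_ C) ≃ₗ[ℂ] ℂ :=
  (LinearEquiv.ofBijective _ (ScalarUnit.bijective (C := C))).symm

variable {C}
variable [MonoidalPreadditive C] [MonoidalLinear ℂ C]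

theorem coupon_add {X Y : C} (f g : Xᘁ ⟶ Yᘁ) : coupon (f + g) = coupon f + coupon g := by
  simp [coupon]

theorem coupon_smul {X Y : C} (c : ℂ) (f : Xᘁ ⟶ Yᘁ) : coupon (c • f) = c • coupon f := by
  simp [coupon]

theorem onDuals_add {A B D E : C} (f g : Bᘁ ⊗ Aᘁ ⟶ Eᘁ ⊗ Dᘁ) :
    onDuals (f + g) = onDuals f + onDuals g := by
  simp [onDuals]

theorem onDuals_smul {A B D E : C} (c : ℂ) (f : Bᘁ ⊗ Aᘁ ⟶ Eᘁ ⊗ Dᘁ) :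
    onDuals (c • f) = c • onDuals f := by
  simp [onDuals]

/-- The bilinear pairing `Hom(Xᘁ, Yᘁ) × Hom(X, Y) → ℂ`. -/
def pairing [ScalarUnit C] (X Y : C) : (Xᘁ ⟶ Yᘁ) →ₗ[ℂ] (X ⟶ Y) →ₗ[ℂ] ℂ :=
  LinearMap.mk₂ ℂ (fun f g => scalar C (pairHom f g))
    (fun f f' g => by simp [pairHom, MonoidalCategory.tensorHom_def])
    (fun c f g => by simp [pairHom, MonoidalCategory.tensorHom_def])
    (fun f g g' => by simp [pairHom, MonoidalCategory.tensorHom_def])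
    (fun c f g => by simp [pairHom, MonoidalCategory.tensorHom_def])

/-- A `ℂ`-linear ribbon category is admissible if its `Hom` spaces are finite-dimensional and all
pairings are non-degenerate. (`ℂ`-linearity comprises finite direct sums and
`Hom(𝟙_, 𝟙_) = ℂ`.) -/
class AdmissibleRibbonCategory (C : Type u) [Category.{v} C] [MonoidalCategory C]
    [BraidedCategory C] [RightRigidCategory C] [RibbonCategory C] [Preadditive C] [Linear ℂ C]
    [MonoidalPreadditive C] [MonoidalLinear ℂ C] : Prop extends ScalarUnit C where
  hasFiniteBiproducts : Limits.HasFiniteBiproducts C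
  finite_hom : ∀ X Y : C, Module.Finite ℂ (X ⟶ Y)
  nondegenerate : ∀ X Y : C, (pairing X Y).Nondegenerate

/-- A set of colours: a countable set of pairwise non-isomorphic objects which contains, up to
isomorphism, the dual of each of its elements. -/
structure ColourSet (C : Type u) [Category.{v} C] [MonoidalCategory C] [RightRigidCategory C] where
  /-- the set of objects -/
  carrier : Set C
  countable : carrier.Countable
  eq_of_iso : ∀ X ∈ carrier, ∀ Y ∈ carrier, Nonempty (X ≅ Y) → X = Y
  exists_dual : ∀ X ∈ carrier, ∃ Y ∈ carrier, Nonempty (Y ≅ Xᘁ)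


variable {C : Type u} [Category.{v} C] [MonoidalCategory C] [BraidedCategory C]
  [RightRigidCategory C] [RibbonCategory C] [Preadditive C] [Linear ℂ C]
  [MonoidalPreadditive C] [MonoidalLinear ℂ C]

/-- `onDuals` as a linear equivalence. -/
def onDualsEquiv (A B D E : C) :
    (Bᘁ ⊗ Aᘁ ⟶ Eᘁ ⊗ Dᘁ) ≃ₗ[ℂ] ((A ⊗ B)ᘁ ⟶ (D ⊗ E)ᘁ) where
  toFun := onDuals
  map_add' := onDuals_add
  map_smul' := onDuals_smul
  invFun g := (rightDualTensorIso A B).inv ≫ g ≫ (rightDualTensorIso D E).hom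
  left_inv f := by simp [onDuals]
  right_inv g := by simp [onDuals]

end Linear
/-! ### Linear algebra of tensor products -/

section Tensor

variable {D E : Type w} {M : D → Type v} {N N' : E → Type v}
  [∀ d, AddCommGroup (M d)] [∀ d, Module ℂ (M d)]
  [∀ e, AddCommGroup (N e)] [∀ e, Module ℂ (N e)]
  [∀ e, AddCommGroup (N' e)] [∀ e, Module ℂ (N' e)]

/-- The linear form `⨂ₑ yₑ ↦ ∏ₑ ⟨nₑ, yₑ⟩` on a tensor product. -/
def pairingProd [Fintype E] (B : ∀ e, N' e →ₗ[ℂ] N e →ₗ[ℂ] ℂ) (n : ∀ e, N' e) :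
    (⨂[ℂ] e, N e) →ₗ[ℂ] ℂ :=
  PiTensorProduct.lift
    ((MultilinearMap.mkPiAlgebra ℂ E ℂ).compLinearMap (fun e => B e (n e)))

theorem pairingProd_tprod [Fintype E] (B : ∀ e, N' e →ₗ[ℂ] N e →ₗ[ℂ] ℂ) (n : ∀ e, N' e)
    (y : ∀ e, N e) :
    pairingProd B n (PiTensorProduct.tprod ℂ y) = ∏ e, B e (n e) (y e) := by
  simp [pairingProd]

theorem exists_dualFamily {P Q : Type v} [AddCommGroup P] [Module ℂ P] [AddCommGroup Q]
    [Module ℂ Q] [Module.Finite ℂ P] [Module.Finite ℂ Q] (B : Q →ₗ[ℂ] P →ₗ[ℂ] ℂ)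
    (hB : B.Nondegenerate) :
    ∃ b' : Fin (Module.finrank ℂ P) → Q,
      (∀ k l, B (b' k) (Module.finBasis ℂ P l) = if l = k then 1 else 0) ∧
      ∀ q, q = ∑ k, B q (Module.finBasis ℂ P k) • b' k := by
  have h1 : Function.Injective B := by
    rw [← LinearMap.ker_eq_bot]
    exact LinearMap.separatingLeft_iff_ker_eq_bot.mp hB.1
  have h2 : Function.Injective B.flip := by
    rw [← LinearMap.ker_eq_bot]
    exact LinearMap.separatingRight_iff_flip_ker_eq_bot.mp hB.2
  have e1 := LinearMap.finrank_le_finrank_of_injective h1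
  have e2 := LinearMap.finrank_le_finrank_of_injective h2
  have e3 : Module.finrank ℂ (P →ₗ[ℂ] ℂ) = Module.finrank ℂ P := Subspace.dual_finrank_eq
  have e4 : Module.finrank ℂ (Q →ₗ[ℂ] ℂ) = Module.finrank ℂ Q := Subspace.dual_finrank_eq
  have h3 : Function.Surjective B :=
    (LinearMap.injective_iff_surjective_of_finrank_eq_finrank (by omega)).mp h1
  choose b' hb' using fun k => h3 ((Module.finBasis ℂ P).coord k)
  refine ⟨b', fun k l => ?_, fun q => ?_⟩
  · rw [hb', Module.Basis.coord_apply, Module.Basis.repr_self, Finsupp.single_apply]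
  · apply h1
    refine (Module.finBasis ℂ P).ext fun l => ?_
    simp [map_sum, hb']

/-- Given non-degenerate pairings, each multilinear form on `∏ M d × ∏ N' e` is related by the
pairings to exactly one linear map `⨂ M d → ⨂ N e`. -/
theorem existsUnique_tensorMap [Fintype E] [∀ e, Module.Finite ℂ (N e)]
    [∀ e, Module.Finite ℂ (N' e)] (B : ∀ e, N' e →ₗ[ℂ] N e →ₗ[ℂ] ℂ)
    (hB : ∀ e, (B e).Nondegenerate)
    (Φ : MultilinearMap ℂ M (MultilinearMap ℂ N' ℂ)) :
    ∃! L : (⨂[ℂ] d, M d) →ₗ[ℂ] (⨂[ℂ] e, N e),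
      ∀ m n, pairingProd B n (L (PiTensorProduct.tprod ℂ m)) = Φ m n := by
  classical
  choose b' hb1 hb2 using fun e => exists_dualFamily (B e) (hB e)
  let b := fun e => Module.finBasis ℂ (N e)
  let T : MultilinearMap ℂ N' ℂ →ₗ[ℂ] (⨂[ℂ] e, N e) :=
    { toFun := fun Ψ => ∑ k : (∀ e, Fin (Module.finrank ℂ (N e))),
        Ψ (fun e => b' e (k e)) • PiTensorProduct.tprod ℂ (fun e => b e (k e))
      map_add' := fun Ψ Ψ' => by simp [add_smul, Finset.sum_add_distrib]
      map_smul' := fun c Ψ => by simp [mul_smul, Finset.smul_sum] }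
  refine ⟨PiTensorProduct.lift (T.compMultilinearMap Φ), fun m n => ?_, fun L hL => ?_⟩
  · have h : Φ m n = Φ m (fun e => ∑ k, B e (n e) (b e k) • b' e k) := by
      congr 1; funext e; exact hb2 e (n e)
    rw [h, MultilinearMap.map_sum]
    simp [T, pairingProd_tprod, MultilinearMap.map_smul_univ, mul_comm]
  · ext m
    have key : ∀ (k : ∀ e, Fin (Module.finrank ℂ (N e))) (y : ⨂[ℂ] e, N e), pairingProd B (fun e => b' e (k e)) y =
        (Basis.piTensorProduct b).repr y k := by
      intro k y
      have : pairingProd B (fun e => b' e (k e)) =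
          (Basis.piTensorProduct b).coord k := by
        refine (Basis.piTensorProduct b).ext fun l => ?_
        rw [Module.Basis.coord_apply, Module.Basis.repr_self, Basis.piTensorProduct_apply,
          pairingProd_tprod]
        simp only [b, hb1, Finsupp.single_apply]
        rw [Finset.prod_ite_zero]
        simp [funext_iff]
      rw [this, Module.Basis.coord_apply]
    simp only [LinearMap.compMultilinearMap_apply, PiTensorProduct.lift.tprod]
    apply (Basis.piTensorProduct b).repr.injective
    ext k
    rw [← key, ← key, hL]
    have h : Φ m (fun e => b' e (k e)) =
        Φ m (fun e => ∑ l, B e (b' e (k e)) (b e l) • b' e l) := by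
      congr 1; funext e; exact hb2 e _
    rw [h, MultilinearMap.map_sum]
    simp [T, pairingProd_tprod, MultilinearMap.map_smul_univ, mul_comm]

variable {S : Type w} {J : S → Type} {H : (s : S) → J s → Type v}
  [∀ s j, AddCommGroup (H s j)] [∀ s j, Module ℂ (H s j)]

theorem curry_update [DecidableEq (Σ s, J s)] [DecidableEq S] [∀ s, DecidableEq (J s)]
    (m : ∀ x : (Σ s, J s), H x.1 x.2) (s : S) (j : J s) (y : H s j) :
    (fun s' => PiTensorProduct.tprod ℂ fun j' => Function.update m ⟨s, j⟩ y ⟨s', j'⟩) =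
      Function.update (fun s' => PiTensorProduct.tprod ℂ fun j' => m ⟨s', j'⟩) s
        (PiTensorProduct.tprod ℂ (Function.update (fun j' => m ⟨s, j'⟩) j y)) := by
  funext s'
  by_cases hs : s' = s
  · subst hs
    rw [Function.update_self]
    congr 1
    funext j'
    by_cases hj : j' = j
    · subst hj; simp
    · rw [Function.update_of_ne hj, Function.update_of_ne (by simpa using hj)]
  · rw [Function.update_of_ne hs]
    congr 1
    funext j'
    rw [Function.update_of_ne (by intro h; exact hs (congrArg Sigma.fst h))]

/-- The canonical map from a tensor product over pairs `(s, j)` to the iterated tensor product,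
`⨂ₓ mₓ ↦ ⨂ₛ ⨂ⱼ m₍ₛ,ⱼ₎`. -/
def sigmaTensorHom :
    (⨂[ℂ] x : (Σ s, J s), H x.1 x.2) →ₗ[ℂ] ⨂[ℂ] s, ⨂[ℂ] j : J s, H s j :=
  PiTensorProduct.lift
    { toFun := fun m => PiTensorProduct.tprod ℂ fun s => PiTensorProduct.tprod ℂ fun j => m ⟨s, j⟩
      map_update_add' := by
        classical
        intro _ m x y z
        simp only [curry_update, MultilinearMap.map_update_add]
      map_update_smul' := by
        classical
        intro _ m x c y
        simp only [curry_update, MultilinearMap.map_update_smul] }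

theorem sigmaTensorHom_bijective [Finite S] [∀ s, Finite (J s)]
    [∀ s j, Module.Finite ℂ (H s j)] :
    Function.Bijective (sigmaTensorHom (H := H)) := by
  let b := fun s j => Module.finBasis ℂ (H s j)
  let e := (Basis.piTensorProduct (fun x : (Σ s, J s) => b x.1 x.2)).equiv
    (Basis.piTensorProduct fun s => Basis.piTensorProduct (b s))
    (Equiv.piCurry fun s (j : J s) => Fin (Module.finrank ℂ (H s j)))
  have h : sigmaTensorHom (H := H) = e.toLinearMap := by
    refine (Basis.piTensorProduct (fun x : (Σ s, J s) => b x.1 x.2)).ext fun k => ?_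
    rw [LinearEquiv.coe_coe, Module.Basis.equiv_apply, Basis.piTensorProduct_apply,
      Basis.piTensorProduct_apply]
    simp only [Basis.piTensorProduct_apply, sigmaTensorHom, PiTensorProduct.lift.tprod]
    rfl
  rw [h]
  exact e.bijective

/-- `sigmaTensorHom` as a linear equivalence. -/
def sigmaTensorEquiv [Finite S] [∀ s, Finite (J s)] [∀ s j, Module.Finite ℂ (H s j)] :
    (⨂[ℂ] x : (Σ s, J s), H x.1 x.2) ≃ₗ[ℂ] ⨂[ℂ] s, ⨂[ℂ] j : J s, H s j :=
  LinearEquiv.ofBijective sigmaTensorHom sigmaTensorHom_bijective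

end Tensor

/-! ### Combinatorial complexes -/

/-- A combinatorial complex with vertex set `Λ`. -/
structure CombinatorialComplex (Λ : Type w) where
  /-- the simplices -/
  simplices : Set (Set Λ)
  nonempty : simplices.Nonempty
  singleton_mem : ∀ a, {a} ∈ simplices
  mem_of_subset : ∀ X ∈ simplices, ∀ Y ⊆ X, Y.Nonempty → Y ∈ simplices

namespace CombinatorialComplex

variable {Λ : Type w} (K : CombinatorialComplex Λ)

/-- The set of `k`-simplices. -/
def kSimplices (k : ℕ) : Set (Set Λ) := {X ∈ K.simplices | X.encard = k + 1}

/-- `K` is a combinatorial `k`-complex: there are no simplices of dimension larger than `k`. -/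
def IsComplexOfDim (k : ℕ) : Prop := ∀ j, k < j → K.kSimplices j = ∅

/-- A tuple of vertices, in arbitrary order, which spans a simplex. -/
def IsOrderedSimplex {n : ℕ} (x : Fin n → Λ) : Prop :=
  Function.Injective x ∧ Set.range x ∈ K.simplices

/-- The polyhedron of a finite complex, in barycentric coordinates. -/
def realization [Fintype Λ] : Set (Λ → ℝ) :=
  {x | (∀ a, 0 ≤ x a) ∧ ∑ a, x a = 1 ∧ Function.support x ∈ K.simplices}

/-- An orientation of a `4`-dimensional triangulated closed manifold: `sign x` is the relative
orientation in the manifold of the `4`-simplex with ordered vertices `x` (`sign` is irrelevant on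
other tuples). It changes by the sign of a permutation of the vertices, and in the boundaries of the
`4`-simplices each tetrahedron occurs exactly once with each relative orientation; here the boundary
of the `4`-simplex `(a, y₀, y₁, y₂, y₃)` contains `(y₀, y₁, y₂, y₃)` with positive sign. -/
structure Orientation where
  /-- the relative orientation of ordered `4`-simplices -/
  sign : (Fin 5 → Λ) → ℤˣ
  alternating : ∀ x, K.IsOrderedSimplex x → ∀ σ : Equiv.Perm (Fin 5),
    sign (x ∘ σ) = Equiv.Perm.sign σ * sign x
  coherent : ∀ y : Fin 4 → Λ, K.IsOrderedSimplex y → ∀ e : ℤˣ,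
    ∃! a, K.IsOrderedSimplex (Fin.cons a y : Fin 5 → Λ) ∧ sign (Fin.cons a y) = e

/-- The `k`-simplices, represented by tuples of vertices in standard order. -/
abbrev SortedSimplex (k : ℕ) [LinearOrder Λ] : Type w :=
  {x : Fin (k + 1) → Λ // StrictMono x ∧ Set.range x ∈ K.simplices}

variable {K}

theorem SortedSimplex.isOrderedSimplex [LinearOrder Λ] {k : ℕ} (s : K.SortedSimplex k) :
    K.IsOrderedSimplex s.1 :=
  ⟨s.2.1.injective, s.2.2⟩

/-- The face `(v₀, …, v̂ⱼ, …, v₄)` of a `4`-simplex. -/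
def face [LinearOrder Λ] (s : K.SortedSimplex 4) (j : Fin 5) : K.SortedSimplex 3 :=
  ⟨fun i => s.1 (j.succAbove i), s.2.1.comp (Fin.strictMono_succAbove j),
    K.mem_of_subset _ s.2.2 _ (by rintro _ ⟨i, rfl⟩; exact ⟨_, rfl⟩) ⟨_, ⟨0, rfl⟩⟩⟩

end CombinatorialComplex

/-- The positions `j` for which the `j`-th face of a `4`-simplex of relative orientation `e` has
relative orientation `(-1)ʲ e = d`. -/
abbrev FacePos (e d : ℤˣ) : Type := {j : Fin 5 // (-1 : ℤˣ) ^ (j : ℕ) * e = d}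

namespace CombinatorialComplex

variable {Λ : Type w} {K : CombinatorialComplex Λ} [LinearOrder Λ]

/-- Each tetrahedron is a face of exactly one `4`-simplex with given relative orientation `d`. -/
theorem face_bijective (ω : K.Orientation) (d : ℤˣ) : Function.Bijective
    (fun x : (Σ s : K.SortedSimplex 4, FacePos (ω.sign s.1) d) => face x.1 x.2.1) := by
  have hcons : ∀ (s : K.SortedSimplex 4) (j : Fin 5),
      (Fin.cons (s.1 j) (face s j).1 : Fin 5 → Λ) = s.1 ∘ (j.cycleRange.symm) := by
    intro s j
    have h := Fin.cons_comp_cycleRange (s.1 j) (face s j).1 j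
    have h' : j.insertNth (s.1 j) (face s j).1 = s.1 := by
      rw [Fin.insertNth_eq_iff]
      exact ⟨rfl, rfl⟩
    rw [h'] at h
    rw [← h]
    funext i
    simp
  have hsign : ∀ (s : K.SortedSimplex 4) (j : Fin 5),
      ω.sign (Fin.cons (s.1 j) (face s j).1) = (-1) ^ (j : ℕ) * ω.sign s.1 := by
    intro s j
    rw [hcons, ω.alternating _ s.isOrderedSimplex, Equiv.Perm.sign_symm, Fin.sign_cycleRange]
  have hord : ∀ (s : K.SortedSimplex 4) (j : Fin 5),
      K.IsOrderedSimplex (Fin.cons (s.1 j) (face s j).1 : Fin 5 → Λ) := by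
    intro s j
    rw [hcons]
    refine ⟨s.2.1.injective.comp (Equiv.injective _), ?_⟩
    rw [(Equiv.surjective _).range_comp]
    exact s.2.2
  constructor
  · rintro ⟨s, j, hj⟩ ⟨s', j', hj'⟩ h
    dsimp only at h
    have ha : s.1 j = s'.1 j' := by
      refine (ω.coherent _ (face s j).isOrderedSimplex d).unique
        ⟨hord s j, (hsign s j).trans hj⟩ ?_
      rw [h]
      exact ⟨hord s' j', (hsign s' j').trans hj'⟩
    have hr : Set.range s.1 = Set.range s'.1 := by
      have e1 := hcons s j
      have e2 := hcons s' j'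
      rw [ha, h, e2] at e1
      have := congrArg Set.range e1
      rwa [(Equiv.surjective _).range_comp, (Equiv.surjective _).range_comp, eq_comm] at this
    have hs : s = s' := Subtype.ext ((StrictMono.range_inj s.2.1 s'.2.1).mp hr)
    subst hs
    have hjj : j = j' := s.2.1.injective ha
    subst hjj
    rfl
  · intro t
    obtain ⟨a, ⟨ha, hd⟩, -⟩ := ω.coherent t.1 t.isOrderedSimplex d
    obtain ⟨σ, hσ⟩ : ∃ σ : Equiv.Perm (Fin 5),
        StrictMono ((Fin.cons a t.1 : Fin 5 → Λ) ∘ σ) :=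
      ⟨Tuple.sort _, (Tuple.monotone_sort _).strictMono_of_injective
        (ha.1.comp (Equiv.injective _))⟩
    let s : K.SortedSimplex 4 := ⟨(Fin.cons a t.1 : Fin 5 → Λ) ∘ σ, hσ, by
      rw [(Equiv.surjective _).range_comp]; exact ha.2⟩
    let j : Fin 5 := σ.symm 0
    have hsj : s.1 j = a := by simp [s, j]
    have hface : face s j = t := by
      apply Subtype.ext
      refine (StrictMono.range_inj (face s j).2.1 t.2.1).mp ?_
      have e1 : insert a (Set.range (face s j).1) = insert a (Set.range t.1) := by
        have := congrArg Set.range (hcons s j)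
        rw [(Equiv.surjective _).range_comp, hsj, Fin.range_cons,
          (Equiv.surjective σ).range_comp, Fin.range_cons] at this
        exact this
      have n1 : a ∉ Set.range (face s j).1 := by
        have := (hord s j).1
        rw [hsj] at this
        exact (Fin.cons_injective_iff.mp this).1
      have n2 : a ∉ Set.range t.1 := (Fin.cons_injective_iff.mp ha.1).1
      rw [← Set.insert_sdiff_self_of_notMem n1, e1, Set.insert_sdiff_self_of_notMem n2]
    refine ⟨⟨s, j, ?_⟩, hface⟩
    rw [← hsign, hsj, hface]
    exact hd

/-- The pairs of a `4`-simplex and a face of relative orientation `d` correspond to the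
tetrahedra. -/
def faceEquiv (ω : K.Orientation) (d : ℤˣ) :
    (Σ s : K.SortedSimplex 4, FacePos (ω.sign s.1) d) ≃ K.SortedSimplex 3 :=
  Equiv.ofBijective _ (face_bijective ω d)

end CombinatorialComplex

/-! ### Piecewise-linear manifolds -/

section PL

/-- A compact polyhedron: a finite union of convex hulls of finite sets. -/
def IsPolyhedron {E : Type*} [AddCommGroup E] [Module ℝ E] (P : Set E) : Prop :=
  ∃ F : Set (Set E), F.Finite ∧ (∀ Q ∈ F, ∃ A : Set E, A.Finite ∧ Q = convexHull ℝ A) ∧ P = ⋃₀ F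

/-- A homeomorphism between compact polyhedra is piecewise-linear if its graph is a polyhedron. -/
def IsPLHomeomorph {E F : Type*} [AddCommGroup E] [Module ℝ E] [TopologicalSpace E]
    [AddCommGroup F] [Module ℝ F] [TopologicalSpace F] {P : Set E} {Q : Set F} (f : P ≃ₜ Q) : Prop :=
  IsPolyhedron {z : E × F | ∃ p : P, z = (↑p, ↑(f p))}

/-- A compact polyhedron is a closed piecewise-linear `n`-manifold if each of its points has a
neighbourhood which is piecewise-linearly homeomorphic to an `n`-cube, with the point at the
centre. -/
def IsClosedPLManifold {E : Type*} [AddCommGroup E] [Module ℝ E] [TopologicalSpace E] (n : ℕ)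
    (P : Set E) : Prop :=
  IsPolyhedron P ∧ ∀ p ∈ P, ∃ N ⊆ P, N ∈ 𝓝[P] p ∧
    ∃ f : N ≃ₜ (Set.Icc (-1) 1 : Set (Fin n → ℝ)), IsPLHomeomorph f ∧
      ∃ q : N, (q : E) = p ∧ (f q : Fin n → ℝ) = 0

end PL

/-! ### State spaces and `4`-simplex maps -/

section StateSum

variable {C : Type u} [Category.{v} C] [MonoidalCategory C] [BraidedCategory C]
  [RightRigidCategory C] [RibbonCategory C] [Preadditive C] [Linear ℂ C]
  [MonoidalPreadditive C] [MonoidalLinear ℂ C]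
variable {Λ : Type w}

/-- The state space `Hom(V₁₂₃ ⊗ V₀₁₃, V₀₁₂ ⊗ V₀₂₃)` of the tetrahedron with ordered vertices `y`,
where `V a b c` is the object attached to the ordered triangle `(a, b, c)`. -/
abbrev StateSpace (V : Λ → Λ → Λ → C) (y : Fin 4 → Λ) : Type v :=
  V (y 1) (y 2) (y 3) ⊗ V (y 0) (y 1) (y 3) ⟶ V (y 0) (y 1) (y 2) ⊗ V (y 0) (y 2) (y 3)

/-- The dual state space `Hom(V₀₁₃ᘁ ⊗ V₁₂₃ᘁ, V₀₂₃ᘁ ⊗ V₀₁₂ᘁ)`. -/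
abbrev DualStateSpace (V : Λ → Λ → Λ → C) (y : Fin 4 → Λ) : Type v :=
  (V (y 0) (y 1) (y 3))ᘁ ⊗ (V (y 1) (y 2) (y 3))ᘁ ⟶
    (V (y 0) (y 2) (y 3))ᘁ ⊗ (V (y 0) (y 1) (y 2))ᘁ

/-- The pairing of the dual state space with the state space. -/
def statePairing [ScalarUnit C] (V : Λ → Λ → Λ → C) (y : Fin 4 → Λ) :
    DualStateSpace V y →ₗ[ℂ] StateSpace V y →ₗ[ℂ] ℂ :=
  (pairing (V (y 1) (y 2) (y 3) ⊗ V (y 0) (y 1) (y 3))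
    (V (y 0) (y 1) (y 2) ⊗ V (y 0) (y 2) (y 3))).comp (onDualsEquiv _ _ _ _).toLinearMap

theorem statePairing_nondegenerate [AdmissibleRibbonCategory C] (V : Λ → Λ → Λ → C)
    (y : Fin 4 → Λ) : (statePairing V y).Nondegenerate := by
  obtain ⟨h1, h2⟩ := AdmissibleRibbonCategory.nondegenerate
    (V (y 1) (y 2) (y 3) ⊗ V (y 0) (y 1) (y 3)) (V (y 0) (y 1) (y 2) ⊗ V (y 0) (y 2) (y 3))
  refine ⟨fun f hf => ?_, fun g hg => ?_⟩
  · exact (onDualsEquiv _ _ _ _).map_eq_zero_iff.mp (h1 _ hf)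
  · refine h2 g fun f => ?_
    obtain ⟨f', rfl⟩ := (onDualsEquiv _ _ _ _).surjective f
    exact hg f'

/-- The quantum trace attached to the `4`-simplex with ordered vertices `x` and relative orientation
`e`. For `e = 1` it depends on `b 0, f 1, b 2, f 3, b 4`, for `e = -1` on `f 0, b 1, f 2, b 3, f 4`,
where the index `j` stands for the face without the `j`-th vertex. -/
def quantumTrace [ScalarUnit C] (V : Λ → Λ → Λ → C) (x : Fin 5 → Λ) (e : ℤˣ)
    (f : ∀ j : Fin 5, StateSpace V fun i => x (j.succAbove i))
    (b : ∀ j : Fin 5, DualStateSpace V fun i => x (j.succAbove i)) : ℂ :=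
  scalar C <|
    if e = 1 then
      qtr (diagramPos (V₀₁₂ := V (x 0) (x 1) (x 2)) (V₀₁₃ := V (x 0) (x 1) (x 3))
        (V₀₁₄ := V (x 0) (x 1) (x 4)) (V₀₂₃ := V (x 0) (x 2) (x 3))
        (V₀₂₄ := V (x 0) (x 2) (x 4)) (V₀₃₄ := V (x 0) (x 3) (x 4))
        (V₁₂₃ := V (x 1) (x 2) (x 3)) (V₁₂₄ := V (x 1) (x 2) (x 4))
        (V₁₃₄ := V (x 1) (x 3) (x 4)) (V₂₃₄ := V (x 2) (x 3) (x 4))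
        (b 0) (f 1) (b 2) (f 3) (b 4))
    else
      qtr (diagramNeg (V₀₁₂ := V (x 0) (x 1) (x 2)) (V₀₁₃ := V (x 0) (x 1) (x 3))
        (V₀₁₄ := V (x 0) (x 1) (x 4)) (V₀₂₃ := V (x 0) (x 2) (x 3))
        (V₀₂₄ := V (x 0) (x 2) (x 4)) (V₀₃₄ := V (x 0) (x 3) (x 4))
        (V₁₂₃ := V (x 1) (x 2) (x 3)) (V₁₂₄ := V (x 1) (x 2) (x 4))
        (V₁₃₄ := V (x 1) (x 3) (x 4)) (V₂₃₄ := V (x 2) (x 3) (x 4))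
        (f 0) (b 1) (f 2) (b 3) (f 4))

/-- Extension of a family on part of the positions to all positions, by zero. -/
def extendZero {e d : ℤˣ} {M : Fin 5 → Type v} [∀ j, AddCommGroup (M j)]
    (m : ∀ j : FacePos e d, M j.1) (j : Fin 5) : M j :=
  if h : (-1 : ℤˣ) ^ (j : ℕ) * e = d then m ⟨j, h⟩ else 0

theorem extendZero_update {e d : ℤˣ} {M : Fin 5 → Type v} [∀ j, AddCommGroup (M j)]
    [DecidableEq (FacePos e d)] (m : ∀ j : FacePos e d, M j.1) (j : FacePos e d) (y : M j.1) :
    extendZero (Function.update m j y) = Function.update (extendZero m) j.1 y := by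
  funext k
  by_cases hk : k = j.1
  · subst hk
    simp [extendZero, j.2]
  · rw [Function.update_of_ne hk]
    unfold extendZero
    split_ifs with h
    · rw [Function.update_of_ne (fun h' => hk (congrArg Subtype.val h'))]
    · rfl

theorem diagramPos_isLinearMap [ScalarUnit C] {V₀₁₂ V₀₁₃ V₀₁₄ V₀₂₃ V₀₂₄ V₀₃₄ V₁₂₃ V₁₂₄ V₁₃₄ V₂₃₄ : C}
    (b₁₂₃₄ : V₁₂₄ᘁ ⊗ V₂₃₄ᘁ ⟶ V₁₃₄ᘁ ⊗ V₁₂₃ᘁ)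
    (f₀₂₃₄ : V₂₃₄ ⊗ V₀₂₄ ⟶ V₀₂₃ ⊗ V₀₃₄)
    (b₀₁₃₄ : V₀₁₄ᘁ ⊗ V₁₃₄ᘁ ⟶ V₀₃₄ᘁ ⊗ V₀₁₃ᘁ)
    (f₀₁₂₄ : V₁₂₄ ⊗ V₀₁₄ ⟶ V₀₁₂ ⊗ V₀₂₄)
    (b₀₁₂₃ : V₀₁₃ᘁ ⊗ V₁₂₃ᘁ ⟶ V₀₂₃ᘁ ⊗ V₀₁₂ᘁ) :
    IsLinearMap ℂ (fun y : V₁₂₄ᘁ ⊗ V₂₃₄ᘁ ⟶ V₁₃₄ᘁ ⊗ V₁₂₃ᘁ => scalar C (qtr (diagramPos y f₀₂₃₄ b₀₁₃₄ f₀₁₂₄ b₀₁₂₃))) ∧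
    IsLinearMap ℂ (fun y : V₂₃₄ ⊗ V₀₂₄ ⟶ V₀₂₃ ⊗ V₀₃₄ => scalar C (qtr (diagramPos b₁₂₃₄ y b₀₁₃₄ f₀₁₂₄ b₀₁₂₃))) ∧
    IsLinearMap ℂ (fun y : V₀₁₄ᘁ ⊗ V₁₃₄ᘁ ⟶ V₀₃₄ᘁ ⊗ V₀₁₃ᘁ => scalar C (qtr (diagramPos b₁₂₃₄ f₀₂₃₄ y f₀₁₂₄ b₀₁₂₃))) ∧
    IsLinearMap ℂ (fun y : V₁₂₄ ⊗ V₀₁₄ ⟶ V₀₁₂ ⊗ V₀₂₄ => scalar C (qtr (diagramPos b₁₂₃₄ f₀₂₃₄ b₀₁₃₄ y b₀₁₂₃))) ∧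
    IsLinearMap ℂ (fun y : V₀₁₃ᘁ ⊗ V₁₂₃ᘁ ⟶ V₀₂₃ᘁ ⊗ V₀₁₂ᘁ => scalar C (qtr (diagramPos b₁₂₃₄ f₀₂₃₄ b₀₁₃₄ f₀₁₂₄ y))) := by
  refine ⟨?_, ?_, ?_, ?_, ?_⟩ <;> constructor <;> intros <;>
    simp [diagramPos, qtr, onDuals_add, coupon_add, onDuals_smul, coupon_smul]

theorem diagramNeg_isLinearMap [ScalarUnit C] {V₀₁₂ V₀₁₃ V₀₁₄ V₀₂₃ V₀₂₄ V₀₃₄ V₁₂₃ V₁₂₄ V₁₃₄ V₂₃₄ : C}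
    (f₁₂₃₄ : V₂₃₄ ⊗ V₁₂₄ ⟶ V₁₂₃ ⊗ V₁₃₄)
    (b₀₂₃₄ : V₀₂₄ᘁ ⊗ V₂₃₄ᘁ ⟶ V₀₃₄ᘁ ⊗ V₀₂₃ᘁ)
    (f₀₁₃₄ : V₁₃₄ ⊗ V₀₁₄ ⟶ V₀₁₃ ⊗ V₀₃₄)
    (b₀₁₂₄ : V₀₁₄ᘁ ⊗ V₁₂₄ᘁ ⟶ V₀₂₄ᘁ ⊗ V₀₁₂ᘁ)
    (f₀₁₂₃ : V₁₂₃ ⊗ V₀₁₃ ⟶ V₀₁₂ ⊗ V₀₂₃) :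
    IsLinearMap ℂ (fun y : V₂₃₄ ⊗ V₁₂₄ ⟶ V₁₂₃ ⊗ V₁₃₄ => scalar C (qtr (diagramNeg y b₀₂₃₄ f₀₁₃₄ b₀₁₂₄ f₀₁₂₃))) ∧
    IsLinearMap ℂ (fun y : V₀₂₄ᘁ ⊗ V₂₃₄ᘁ ⟶ V₀₃₄ᘁ ⊗ V₀₂₃ᘁ => scalar C (qtr (diagramNeg f₁₂₃₄ y f₀₁₃₄ b₀₁₂₄ f₀₁₂₃))) ∧
    IsLinearMap ℂ (fun y : V₁₃₄ ⊗ V₀₁₄ ⟶ V₀₁₃ ⊗ V₀₃₄ => scalar C (qtr (diagramNeg f₁₂₃₄ b₀₂₃₄ y b₀₁₂₄ f₀₁₂₃))) ∧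
    IsLinearMap ℂ (fun y : V₀₁₄ᘁ ⊗ V₁₂₄ᘁ ⟶ V₀₂₄ᘁ ⊗ V₀₁₂ᘁ => scalar C (qtr (diagramNeg f₁₂₃₄ b₀₂₃₄ f₀₁₃₄ y f₀₁₂₃))) ∧
    IsLinearMap ℂ (fun y : V₁₂₃ ⊗ V₀₁₃ ⟶ V₀₁₂ ⊗ V₀₂₃ => scalar C (qtr (diagramNeg f₁₂₃₄ b₀₂₃₄ f₀₁₃₄ b₀₁₂₄ y))) := by
  refine ⟨?_, ?_, ?_, ?_, ?_⟩ <;> constructor <;> intros <;>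
    simp [diagramNeg, qtr, onDuals_add, coupon_add, onDuals_smul, coupon_smul]

theorem quantumTrace_isLinearMap_state [ScalarUnit C] (V : Λ → Λ → Λ → C) (x : Fin 5 → Λ)
    (e : ℤˣ) (f : ∀ j : Fin 5, StateSpace V fun i => x (j.succAbove i))
    (b : ∀ j : Fin 5, DualStateSpace V fun i => x (j.succAbove i)) (j : FacePos e (-1)) :
    IsLinearMap ℂ (fun y => quantumTrace V x e (Function.update f j.1 y) b) := by
  obtain ⟨j, hj⟩ := j
  rcases Int.units_eq_one_or e with rfl | rfl <;> fin_cases j <;>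
    first | (exfalso; revert hj; decide) | skip
  · exact (diagramPos_isLinearMap (b 0) (f 1) (b 2) (f 3) (b 4)).2.1
  · exact (diagramPos_isLinearMap (b 0) (f 1) (b 2) (f 3) (b 4)).2.2.2.1
  · exact (diagramNeg_isLinearMap (f 0) (b 1) (f 2) (b 3) (f 4)).1
  · exact (diagramNeg_isLinearMap (f 0) (b 1) (f 2) (b 3) (f 4)).2.2.1
  · exact (diagramNeg_isLinearMap (f 0) (b 1) (f 2) (b 3) (f 4)).2.2.2.2

theorem quantumTrace_isLinearMap_dual [ScalarUnit C] (V : Λ → Λ → Λ → C) (x : Fin 5 → Λ)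
    (e : ℤˣ) (f : ∀ j : Fin 5, StateSpace V fun i => x (j.succAbove i))
    (b : ∀ j : Fin 5, DualStateSpace V fun i => x (j.succAbove i)) (j : FacePos e 1) :
    IsLinearMap ℂ (fun y => quantumTrace V x e f (Function.update b j.1 y)) := by
  obtain ⟨j, hj⟩ := j
  rcases Int.units_eq_one_or e with rfl | rfl <;> fin_cases j <;>
    first | (exfalso; revert hj; decide) | skip
  · exact (diagramPos_isLinearMap (b 0) (f 1) (b 2) (f 3) (b 4)).1
  · exact (diagramPos_isLinearMap (b 0) (f 1) (b 2) (f 3) (b 4)).2.2.1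
  · exact (diagramPos_isLinearMap (b 0) (f 1) (b 2) (f 3) (b 4)).2.2.2.2
  · exact (diagramNeg_isLinearMap (f 0) (b 1) (f 2) (b 3) (f 4)).2.1
  · exact (diagramNeg_isLinearMap (f 0) (b 1) (f 2) (b 3) (f 4)).2.2.2.1

/-- `quantumTrace` as a multilinear form `Z'` in the states of the faces of relative orientation
`-1` and the dual states of the faces of relative orientation `1`. -/
def quantumTraceForm [ScalarUnit C] (V : Λ → Λ → Λ → C) (x : Fin 5 → Λ) (e : ℤˣ) :
    MultilinearMap ℂ
      (fun j : FacePos e (-1) => StateSpace V fun i => x (j.1.succAbove i))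
      (MultilinearMap ℂ
        (fun j : FacePos e 1 => DualStateSpace V fun i => x (j.1.succAbove i)) ℂ) where
  toFun f :=
    { toFun := fun b => quantumTrace V x e (extendZero f) (extendZero b)
      map_update_add' := fun b j y z => by
        simp only [extendZero_update]
        exact (quantumTrace_isLinearMap_dual V x e (extendZero f) (extendZero b) j).map_add y z
      map_update_smul' := fun b j c y => by
        simp only [extendZero_update]
        exact (quantumTrace_isLinearMap_dual V x e (extendZero f) (extendZero b) j).map_smul c y }
  map_update_add' f j y z := by
    ext b
    simp only [extendZero_update]
    exact (quantumTrace_isLinearMap_state V x e (extendZero f) (extendZero b) j).map_add y z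
  map_update_smul' f j c y := by
    ext b
    simp only [extendZero_update]
    exact (quantumTrace_isLinearMap_state V x e (extendZero f) (extendZero b) j).map_smul c y

/-- The `4`-simplex map of the `4`-simplex with ordered vertices `x` and relative orientation `e`:
the linear map from the tensor product of the state spaces of the faces of relative orientation `-1`
to that of the faces of relative orientation `1` which is related to the quantum trace by the
pairings of the state spaces. For `e = 1` it is a map `H₀₂₃₄ ⊗ H₀₁₂₄ → H₁₂₃₄ ⊗ H₀₁₃₄ ⊗ H₀₁₂₃`, for
`e = -1` a map `H₁₂₃₄ ⊗ H₀₁₃₄ ⊗ H₀₁₂₃ → H₀₂₃₄ ⊗ H₀₁₂₄`. -/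
def simplexMap [AdmissibleRibbonCategory C] (V : Λ → Λ → Λ → C) (x : Fin 5 → Λ) (e : ℤˣ) :
    (⨂[ℂ] j : FacePos e (-1), StateSpace V fun i => x (j.1.succAbove i)) →ₗ[ℂ]
      ⨂[ℂ] j : FacePos e 1, StateSpace V fun i => x (j.1.succAbove i) :=
  haveI := AdmissibleRibbonCategory.finite_hom (C := C)
  (existsUnique_tensorMap (fun j : FacePos e 1 => statePairing V fun i => x (j.1.succAbove i))
    (fun _ => statePairing_nondegenerate V _) (quantumTraceForm V x e)).choose

theorem simplexMap_spec [AdmissibleRibbonCategory C] (V : Λ → Λ → Λ → C) (x : Fin 5 → Λ) (e : ℤˣ)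
    (f : ∀ j : FacePos e (-1), StateSpace V fun i => x (j.1.succAbove i))
    (b : ∀ j : FacePos e 1, DualStateSpace V fun i => x (j.1.succAbove i)) :
    pairingProd (fun j : FacePos e 1 => statePairing V fun i => x (j.1.succAbove i)) b
      (simplexMap V x e (PiTensorProduct.tprod ℂ f)) = quantumTraceForm V x e f b :=
  haveI := AdmissibleRibbonCategory.finite_hom (C := C)
  (existsUnique_tensorMap (fun j : FacePos e 1 => statePairing V fun i => x (j.1.succAbove i))
    (fun _ => statePairing_nondegenerate V _) (quantumTraceForm V x e)).choose_spec.1 f b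

/-! ### The partition function -/

variable {K : CombinatorialComplex Λ}

open CombinatorialComplex

/-- A colouring of the triangles of a complex. -/
abbrev Colouring (K : CombinatorialComplex Λ) (C₀ : ColourSet C) : Type (max u w) :=
  K.kSimplices 2 → C₀.carrier

/-- The object `V(a, b, c)` attached by a colouring to an ordered triangle: the colour of the
triangle if `(a, b, c)` is an even permutation of the standard order of its vertices, and the dual of
the colour if it is an odd permutation (`𝟙_` is a default value if `a, b, c` do not span a
triangle). -/
def colourObj [LinearOrder Λ] {C₀ : ColourSet C} (V : Colouring K C₀) (a b c : Λ) : C :=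
  open scoped Classical in
  if h : ({a, b, c} : Set Λ) ∈ K.kSimplices 2 then
    if (a < b ∧ b < c) ∨ (b < c ∧ c < a) ∨ (c < a ∧ a < b) then (V ⟨_, h⟩ : C)
    else (V ⟨_, h⟩ : C)ᘁ
  else 𝟙_ C

variable [AdmissibleRibbonCategory C]

/-- The tensor product of the state spaces of all tetrahedra, with its factors grouped according to
the `4`-simplices which have the tetrahedron as a face of relative orientation `d`. -/
def regroup [Finite Λ] [LinearOrder Λ] (V : Λ → Λ → Λ → C) (ω : K.Orientation) (d : ℤˣ) :
    (⨂[ℂ] t : K.SortedSimplex 3, StateSpace V t.1) ≃ₗ[ℂ]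
      ⨂[ℂ] s : K.SortedSimplex 4, ⨂[ℂ] j : FacePos (ω.sign s.1) d,
        StateSpace V fun i => s.1 (j.1.succAbove i) :=
  haveI := AdmissibleRibbonCategory.finite_hom (C := C)
  (PiTensorProduct.reindex ℂ (fun t : K.SortedSimplex 3 => StateSpace V t.1)
    (faceEquiv ω d).symm).trans
    (sigmaTensorEquiv (S := K.SortedSimplex 4) (J := fun s => FacePos (ω.sign s.1) d)
      (H := fun s j => StateSpace V fun i => s.1 (j.1.succAbove i)))

/-- The partition function per colouring: the trace, over the tensor product of the state spaces of
all tetrahedra, of the tensor product of the `4`-simplex maps, followed by the permutation of tensor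
factors from the codomain to the domain. -/
def partitionPerColouring [Finite Λ] [LinearOrder Λ] {C₀ : ColourSet C} (ω : K.Orientation)
    (V : Colouring K C₀) : ℂ :=
  LinearMap.trace ℂ (⨂[ℂ] t : K.SortedSimplex 3, StateSpace (colourObj V) t.1)
    ((regroup (colourObj V) ω 1).symm.toLinearMap ∘ₗ
      PiTensorProduct.map (fun s : K.SortedSimplex 4 =>
        simplexMap (colourObj V) s.1 (ω.sign s.1)) ∘ₗ
      (regroup (colourObj V) ω (-1)).toLinearMap)

/-- Real weights of the triangles, as functions of the attached object: they agree on isomorphic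
objects and on dual objects. -/
structure TriangleWeights (K : CombinatorialComplex Λ) (C : Type u) [Category.{v} C]
    [MonoidalCategory C] [RightRigidCategory C] where
  /-- the weight of an object at a triangle -/
  weight : K.kSimplices 2 → C → ℝ
  weight_dual : ∀ t X, weight t (Xᘁ) = weight t X
  weight_iso : ∀ t X Y, Nonempty (X ≅ Y) → weight t X = weight t Y

/-- The summand of the partition function for the linear order `o` of the vertices. -/
def partitionSummand [Finite Λ] (C₀ : ColourSet C) (ω : K.Orientation) (W : TriangleWeights K C)
    (o : LinearOrder Λ) (V : Colouring K C₀) : ℂ :=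
  (∏ᶠ t : K.kSimplices 2, (W.weight t (V t) : ℂ)) * partitionPerColouring ω V

/-- The partition function defined with the linear order `o` of the vertices. -/
def partitionFunction [Finite Λ] (C₀ : ColourSet C) (ω : K.Orientation) (W : TriangleWeights K C)
    (o : LinearOrder Λ) : ℂ :=
  ∑' V : Colouring K C₀, partitionSummand C₀ ω W o V

end StateSum

end SpinFoam

end

/-! Any two linear orders of a finite set differ by a permutation, and the symmetric group is
generated by the full cycle and one adjacent transposition. So it suffices to treat two moves:
turning the maximal vertex into the minimal one (`IsRotation`), and exchanging the two smallest
vertices (`IsSwap`). For each move a permutation of the colourings is found under which the summands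
agree term by term (`SummandsAgree`). Summability and value of the series are then unaffected.

The trace defining a summand is first made explicit (`trace_stateSumOperator`). A dual state is the
same thing as a morphism opposite to a state, and the pairing becomes the trace form `qtr (f ≫ g)`.
Expanding in a basis of every state space and its dual basis turns the summand into a sum over
labellings of the tetrahedra of products of closed diagrams, one per `4`-simplex. This holds for
every choice of dual bases, so a move only has to carry dual bases to dual bases and preserve the
value of each closed diagram (`stateSum_eq_of_transport`).

Under a rotation no object on an ordered triangle changes, because the cyclic order is preserved.
States and costates of the tetrahedra at the moved vertex are exchanged, up to a braiding. The
`4`-simplex keeps its sign, since a `5`-cycle is even. Its diagram is invariant by naturality of the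
braiding and cyclicity of the trace (`qtr_posDiagram_rotate`, `qtr_negDiagram_rotate`).

Under a swap of `p` and `q`, each triangle containing both has its orientation reversed, and its
colour is replaced by the colour isomorphic to the dual. The corresponding strands are bent around.
This exchanges states with costates at the tetrahedra containing both vertices, and the positive
with the negative diagram (`qtr_negDiagram_bend`, `qtr_posDiagram_bend`). It is here that the ribbon
structure is essential: left and right traces agree, and the quantum trace does not depend on the
duality data used to close a strand. -/

noncomputable section

namespace SpinFoam

/-! ### Cyclicity of the quantum trace and the trace form -/

section RibbonTrace

variable {C : Type u} [Category.{v} C] [MonoidalCategory C] [BraidedCategory C]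
  [RightRigidCategory C] [RibbonCategory C]

open RibbonCategory ExactPairing

/-- The right evaluation attached to an arbitrary exact pairing. -/
def evPair (X Y : C) [ExactPairing X Y] : X ⊗ Y ⟶ 𝟙_ C :=
  (twist X).hom ▷ Y ≫ (β_ X Y).hom ≫ ε_ X Y

/-- The quantum trace computed with an arbitrary exact pairing. -/
def tracePair {X : C} (Y : C) [ExactPairing X Y] (f : X ⟶ X) : 𝟙_ C ⟶ 𝟙_ C :=
  η_ X Y ≫ f ▷ Y ≫ evPair X Y

theorem qtr_eq_tracePair {X : C} (f : X ⟶ X) : qtr f = tracePair Xᘁ f := rfl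

/-- The coupon `g` is slid around the closed strand: over the cap it becomes its mate `m` on the
dual strand, and at the cup it returns as `g`. Naturality of twist and braiding lets it pass the
kink hidden in the cap. -/
theorem tracePair_comp_of_mate {X X' Y Y' : C} [ExactPairing X Y] [ExactPairing X' Y']
    (f : X ⟶ X') (g : X' ⟶ X) (m : Y ⟶ Y')
    (hη : η_ X Y ≫ X ◁ m = η_ X' Y' ≫ g ▷ Y') (hε : m ▷ X' ≫ ε_ X' Y' = Y ◁ g ≫ ε_ X Y) :
    tracePair Y (f ≫ g) = tracePair Y' (g ≫ f) := by
  have h1 : g ▷ Y ≫ evPair X Y = X' ◁ m ≫ evPair X' Y' := by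
    simp only [evPair]
    rw [← comp_whiskerRight_assoc, twist_naturality, comp_whiskerRight_assoc,
      BraidedCategory.braiding_naturality_left_assoc, ← hε,
      ← BraidedCategory.braiding_naturality_right_assoc, whisker_exchange_assoc]
  simp only [tracePair, comp_whiskerRight, Category.assoc]
  rw [h1, ← whisker_exchange_assoc, reassoc_of% hη]

theorem tracePair_comp {X X' : C} (Y Y' : C) [i : ExactPairing X Y] [j : ExactPairing X' Y']
    (f : X ⟶ X') (g : X' ⟶ X) : tracePair Y (f ≫ g) = tracePair Y' (g ≫ f) :=
  tracePair_comp_of_mate f g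
    (@rightAdjointMate C _ _ X' X ⟨Y'⟩ ⟨Y⟩ g)
    (@coevaluation_comp_rightAdjointMate C _ _ X' X ⟨Y'⟩ ⟨Y⟩ g)
    (@rightAdjointMate_comp_evaluation C _ _ X' X ⟨Y'⟩ ⟨Y⟩ g)

theorem qtr_comp {X Y : C} (f : X ⟶ Y) (g : Y ⟶ X) : qtr (f ≫ g) = qtr (g ≫ f) :=
  tracePair_comp _ _ f g

/-- Cyclicity with an identity as second factor shows independence of the duality data. This freedom
is indispensable, as a dual colour is only isomorphic to the chosen dual object. -/
theorem tracePair_eq_qtr {X Y : C} [ExactPairing X Y] (f : X ⟶ X) : tracePair Y f = qtr f := by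
  have := tracePair_comp Y Xᘁ f (𝟙 X)
  simpa [qtr_eq_tracePair] using this

/-- The trace as a left trace. -/
theorem leftTrace_eq_qtr {X : C} (h : X ⟶ X) :
    coevR X ≫ Xᘁ ◁ h ≫ ε_ X Xᘁ = qtr h := by
  -- The twist of the dual is the mate of the twist, so it may change strands across the evaluation.
  have h1 : (twist Xᘁ).hom ▷ X ≫ ε_ X Xᘁ = Xᘁ ◁ (twist X).hom ≫ ε_ X Xᘁ := by
    rw [← twist_dual, rightAdjointMate_comp_evaluation]
  simp only [coevR, qtr, evR, Category.assoc]
  rw [← whisker_exchange_assoc, h1, ← whiskerLeft_comp_assoc,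
    ← BraidedCategory.braiding_naturality_left_assoc, comp_whiskerRight_assoc]

/-- A snake identity: `f` is the mate of its half-turned coupon. -/
theorem coupon_mate {X Y : C} (f : (Xᘁ : C) ⟶ (Yᘁ : C)) :
    f ▷ Y ≫ ε_ Y (Yᘁ : C) = (Xᘁ : C) ◁ coupon f ≫ ε_ X (Xᘁ : C) := by
  symm
  calc _ = 𝟙 _ ⊗≫ (Xᘁ : C) ◁ η_ X (Xᘁ : C) ▷ Y ⊗≫ (((Xᘁ : C) ⊗ X) ◁ (f ▷ Y ≫ ε_ Y (Yᘁ : C)) ≫ ε_ X (Xᘁ : C) ▷ 𝟙_ C) ⊗≫ 𝟙 _ := by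
        rw [coupon]; monoidal
    _ = 𝟙 _ ⊗≫ ((Xᘁ : C) ◁ η_ X (Xᘁ : C) ⊗≫ ε_ X (Xᘁ : C) ▷ (Xᘁ : C)) ▷ Y ⊗≫ f ▷ Y ≫ ε_ Y (Yᘁ : C) := by
        rw [whisker_exchange]; monoidal
    _ = _ := by rw [coevaluation_evaluation'']; monoidal

theorem coupon_rightAdjointMate {X Y : C} (g : Y ⟶ X) : coupon (rightAdjointMate g) = g := by
  have h := coevaluation_comp_rightAdjointMate g
  calc coupon (rightAdjointMate g) = 𝟙 _ ⊗≫ (η_ X (Xᘁ : C) ≫ X ◁ rightAdjointMate g) ▷ Y ⊗≫ X ◁ ε_ Y (Yᘁ : C) ⊗≫ 𝟙 _ := by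
        rw [coupon]; monoidal
    _ = 𝟙 _ ⊗≫ η_ Y (Yᘁ : C) ▷ Y ⊗≫ (g ▷ ((Yᘁ : C) ⊗ Y) ≫ X ◁ ε_ Y (Yᘁ : C)) ⊗≫ 𝟙 _ := by
        rw [h]; monoidal
    _ = 𝟙 _ ⊗≫ (η_ Y (Yᘁ : C) ▷ Y ⊗≫ Y ◁ ε_ Y (Yᘁ : C)) ⊗≫ g ⊗≫ 𝟙 _ := by
        rw [← whisker_exchange]; monoidal
    _ = g := by rw [evaluation_coevaluation'']; monoidal

/-- By `coupon_mate` the coupon determines `f ▷ Y` followed by the evaluation, and `f` is recovered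
from that by another snake. -/
theorem coupon_injective {X Y : C} : Function.Injective (coupon : ((Xᘁ : C) ⟶ (Yᘁ : C)) → (Y ⟶ X)) := by
  intro f g h
  have h' : f ▷ Y ≫ ε_ Y (Yᘁ : C) = g ▷ Y ≫ ε_ Y (Yᘁ : C) := by rw [coupon_mate, coupon_mate, h]
  have key : ∀ f : (Xᘁ : C) ⟶ (Yᘁ : C), f = 𝟙 _ ⊗≫ (Xᘁ : C) ◁ η_ Y (Yᘁ : C) ⊗≫ (f ▷ Y ≫ ε_ Y (Yᘁ : C)) ▷ (Yᘁ : C) ⊗≫ 𝟙 _ := by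
    intro f
    symm
    calc _ = 𝟙 _ ⊗≫ ((Xᘁ : C) ◁ η_ Y (Yᘁ : C) ≫ f ▷ (Y ⊗ (Yᘁ : C))) ⊗≫ ε_ Y (Yᘁ : C) ▷ (Yᘁ : C) ⊗≫ 𝟙 _ := by monoidal
      _ = f ⊗≫ ((Yᘁ : C) ◁ η_ Y (Yᘁ : C) ⊗≫ ε_ Y (Yᘁ : C) ▷ (Yᘁ : C)) ⊗≫ 𝟙 _ := by rw [whisker_exchange]; monoidal
      _ = f := by rw [coevaluation_evaluation'']; monoidal
  rw [key f, key g, h']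

/-- Moving `f` across the evaluation leaves a left trace, which equals the quantum trace. All later
duality arguments use this trace form. -/
theorem pairHom_eq_qtr {X Y : C} (f : Xᘁ ⟶ Yᘁ) (g : X ⟶ Y) :
    pairHom f g = qtr (g ≫ coupon f) := by
  rw [← leftTrace_eq_qtr, pairHom, tensorHom_def', Category.assoc, coupon_mate,
    whiskerLeft_comp_assoc]

end RibbonTrace


/-! ### Partial traces and reversed duality -/

section NestedTrace

variable {C : Type u} [Category.{v} C] [MonoidalCategory C] [BraidedCategory C]
  [RightRigidCategory C] [RibbonCategory C]

open RibbonCategory ExactPairing BraidedCategory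

/-- Naturality of the braiding: a strand is pulled off a cap that it crosses. -/
theorem braiding_comp_evaluation {A a B : C} (e : A ⊗ a ⟶ 𝟙_ C) :
    (β_ B A).hom ▷ a ⊗≫ A ◁ (β_ B a).hom ⊗≫ e ▷ B ⊗≫ 𝟙 B = 𝟙 _ ⊗≫ B ◁ e ⊗≫ 𝟙 B := by
  have h := braiding_naturality_right B e
  rw [braiding_tensorUnit_right, braiding_tensor_right_hom] at h
  calc _ = 𝟙 _ ⊗≫ (((α_ B A a).inv ≫ (β_ B A).hom ▷ a ≫ (α_ A B a).hom ≫
        A ◁ (β_ B a).hom ≫ (α_ A a B).inv) ≫ e ▷ B) ⊗≫ 𝟙 B := by monoidal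
    _ = _ := by rw [← h]; monoidal

/-- Two successive pulls, of `B` off the cap of `A` and then of `A` off the cap of `B`, remove all
crossings between the two pairs of strands. -/
theorem double_braiding_comp_evaluation {A B a b : C} (e : a ⊗ A ⟶ 𝟙_ C) (f : b ⊗ B ⟶ 𝟙_ C) :
    ((β_ A B).hom ≫ (β_ B A).hom) ▷ (b ⊗ a) ≫ (β_ (A ⊗ B) (b ⊗ a)).hom ⊗≫ b ◁ e ▷ B ⊗≫ f =
      𝟙 _ ⊗≫ A ◁ ((β_ B b).hom ≫ f) ▷ a ⊗≫ (β_ A a).hom ≫ e := by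
  rw [braiding_tensor_right_hom]
  calc _ = 𝟙 _ ⊗≫ (β_ A B).hom ▷ b ▷ a ⊗≫ ((β_ B A).hom ▷ b ≫ (β_ (A ⊗ B) b).hom) ▷ a ⊗≫
        b ◁ (β_ (A ⊗ B) a).hom ⊗≫ b ◁ e ▷ B ⊗≫ f := by monoidal
    _ = 𝟙 _ ⊗≫ (β_ A B).hom ▷ b ▷ a ⊗≫ B ◁ (β_ A b).hom ▷ a ⊗≫ (β_ B b).hom ▷ A ▷ a ⊗≫
        b ◁ ((β_ B A).hom ▷ a ⊗≫ A ◁ (β_ B a).hom ⊗≫ ((β_ A a).hom ≫ e) ▷ B ⊗≫ 𝟙 B) ⊗≫ f := by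
      rw [braiding_naturality_left, braiding_tensor_left_hom, braiding_tensor_left_hom]
      monoidal
    _ = 𝟙 _ ⊗≫ (β_ A B).hom ▷ b ▷ a ⊗≫ B ◁ (β_ A b).hom ▷ a ⊗≫ ((β_ B b).hom ▷ (A ⊗ a) ≫
        (b ⊗ B) ◁ ((β_ A a).hom ≫ e)) ⊗≫ f := by
      rw [braiding_comp_evaluation]; monoidal
    _ = 𝟙 _ ⊗≫ (β_ A B).hom ▷ b ▷ a ⊗≫ B ◁ (β_ A b).hom ▷ a ⊗≫
        (((B ⊗ b) ◁ ((β_ A a).hom ≫ e)) ≫ ((β_ B b).hom ≫ f) ▷ 𝟙_ C) ⊗≫ 𝟙 _ := by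
      rw [← whisker_exchange]; monoidal
    _ = 𝟙 _ ⊗≫ ((β_ A B).hom ▷ b ⊗≫ B ◁ (β_ A b).hom ⊗≫ ((β_ B b).hom ≫ f) ▷ A ⊗≫ 𝟙 A) ▷ a ⊗≫
        (β_ A a).hom ≫ e := by
      rw [whisker_exchange]; monoidal
    _ = _ := by rw [braiding_comp_evaluation]; monoidal

/-- The twist of a tensor product contains exactly the double braiding which
`double_braiding_comp_evaluation` absorbs. What remains is a pair of nested caps. -/
theorem evPair_tensor {A B a b : C} [ExactPairing A a] [ExactPairing B b] :
    evPair (A ⊗ B) (b ⊗ a) = 𝟙 _ ⊗≫ A ◁ evPair B b ▷ a ⊗≫ evPair A a := by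
  have h := double_braiding_comp_evaluation (ε_ A a) (ε_ B b)
  -- Naturality moves the individual twists in front of the double braiding.
  have hθ : (twist (A ⊗ B)).hom =
      ((twist A).hom ▷ B ≫ A ◁ (twist B).hom) ≫ (β_ A B).hom ≫ (β_ B A).hom := by
    rw [twist_tensor, ← braiding_naturality, ← braiding_naturality_assoc,
      MonoidalCategory.tensorHom_def]
  calc evPair (A ⊗ B) (b ⊗ a) = ((twist A).hom ▷ B ≫ A ◁ (twist B).hom) ▷ (b ⊗ a) ≫
        (((β_ A B).hom ≫ (β_ B A).hom) ▷ (b ⊗ a) ≫ (β_ (A ⊗ B) (b ⊗ a)).hom ⊗≫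
          b ◁ ε_ A a ▷ B ⊗≫ ε_ B b) := by
        rw [evPair, hθ, tensor_evaluation]; monoidal
    _ = 𝟙 _ ⊗≫ ((twist A).hom ▷ (B ⊗ b) ≫ A ◁ evPair B b) ▷ a ⊗≫ (β_ A a).hom ≫ ε_ A a := by
        rw [h, evPair]; monoidal
    _ = _ := by rw [← whisker_exchange, evPair, evPair]; monoidal

/-- The right partial trace. -/
def partialTrace {D D' X : C} (Y : C) [ExactPairing X Y] (h : D ⊗ X ⟶ D' ⊗ X) : D ⟶ D' :=
  𝟙 _ ⊗≫ D ◁ η_ X Y ⊗≫ h ▷ Y ⊗≫ D' ◁ evPair X Y ⊗≫ 𝟙 _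

/-- The trace over `D ⊗ X` may be computed with the pairing by `Y ⊗ Dᘁ`, whose cup and cap are
nested: the inner strand closes first. -/
theorem qtr_partialTrace {D X Y : C} [ExactPairing X Y] (h : D ⊗ X ⟶ D ⊗ X) :
    qtr (partialTrace Y h) = qtr h := by
  rw [← tracePair_eq_qtr (Y := Y ⊗ (Dᘁ : C)) h, qtr_eq_tracePair, tracePair, tracePair,
    evPair_tensor, tensor_coevaluation, partialTrace]
  monoidal

/-- The coevaluation of the reversed pairing. -/
def coPair (X Y : C) [ExactPairing X Y] : 𝟙_ C ⟶ Y ⊗ X :=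
  (η_ X Y ≫ (β_ Y X).inv) ≫ Y ◁ (twist X).inv

/-- The reversal of an exact pairing in a ribbon category. -/
@[reducible]
def reversePairing (X Y : C) [ExactPairing X Y] : ExactPairing Y X :=
  letI := exactPairing_swap X Y
  exactPairingCongrRight (X := Y) (twist X)

theorem reversePairing_coevaluation (X Y : C) [ExactPairing X Y] :
    @ExactPairing.coevaluation C _ _ Y X (reversePairing X Y) = coPair X Y := rfl

theorem reversePairing_evaluation (X Y : C) [ExactPairing X Y] :
    @ExactPairing.evaluation C _ _ Y X (reversePairing X Y) = evPair X Y := rfl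

theorem coevR_eq_coPair (X : C) : coevR X = coPair X Xᘁ := by
  have h : η_ X Xᘁ ≫ (β_ X Xᘁ).hom ≫ (twist Xᘁ).hom ▷ X ≫ Xᘁ ◁ (twist X).hom ≫ (β_ Xᘁ X).hom =
      η_ X Xᘁ := by
    -- The twist of the unit is trivial, so the twist of `X ⊗ Xᘁ` fixes the coevaluation. Written
    -- out through `twist_tensor`, this relates the two forms of the reversed coevaluation.
    have h1 := twist_naturality (η_ X (Xᘁ : C))
    rw [twist_unit, Category.id_comp, twist_tensor, ← braiding_naturality,
      MonoidalCategory.tensorHom_def, Category.assoc] at h1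
    exact h1
  rw [coevR, coPair]
  conv_rhs => rw [← h]
  simp

/-- The mate `m` of the identity compares the given pairing with the canonical one, and reduces the
claim to `leftTrace_eq_qtr`. -/
theorem leftTrace_eq_qtr' {X : C} (Y : C) [i : ExactPairing X Y] (h : X ⟶ X) :
    coPair X Y ≫ Y ◁ h ≫ ε_ X Y = qtr h := by
  let m : Y ⟶ Xᘁ := @rightAdjointMate C _ _ X X ⟨Xᘁ⟩ ⟨Y⟩ (𝟙 X)
  have h1 : η_ X Y ≫ X ◁ m = η_ X Xᘁ := by
    have := @coevaluation_comp_rightAdjointMate C _ _ X X ⟨Xᘁ⟩ ⟨Y⟩ (𝟙 X)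
    rw [id_whiskerRight, Category.comp_id] at this
    exact this
  have h2 : m ▷ X ≫ ε_ X Xᘁ = ε_ X Y := by
    have := @rightAdjointMate_comp_evaluation C _ _ X X ⟨Xᘁ⟩ ⟨Y⟩ (𝟙 X)
    rw [whiskerLeft_id, Category.id_comp] at this
    exact this
  have h3 : coPair X Y ≫ m ▷ X = coPair X Xᘁ := by
    simp only [coPair, Category.assoc]
    rw [whisker_exchange, ← braiding_inv_naturality_right_assoc, reassoc_of% h1]
  rw [← h2, whisker_exchange_assoc, reassoc_of% h3, ← coevR_eq_coPair, leftTrace_eq_qtr]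

/-- The left partial trace has the same quantum trace. -/
theorem qtr_leftPartialTrace {U B : C} (Y : C) [ExactPairing U Y] (h : U ⊗ B ⟶ U ⊗ B) :
    qtr (𝟙 _ ⊗≫ coPair U Y ▷ B ⊗≫ Y ◁ h ⊗≫ ε_ U Y ▷ B ⊗≫ 𝟙 B) = qtr h := by
  rw [← qtr_partialTrace (Y := (Bᘁ : C)) h, ← leftTrace_eq_qtr' (X := U) Y, partialTrace,
    qtr_eq_tracePair, tracePair]
  -- Closing `U` on the left and `B` on the right commute by the interchange law.
  calc _ = 𝟙 _ ⊗≫ η_ B (Bᘁ : C) ⊗≫ coPair U Y ▷ (B ⊗ (Bᘁ : C)) ⊗≫ Y ◁ h ▷ (Bᘁ : C) ⊗≫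
        (ε_ U Y ▷ (B ⊗ (Bᘁ : C)) ≫ 𝟙_ C ◁ evPair B (Bᘁ : C)) ⊗≫ 𝟙 _ := by monoidal
    _ = 𝟙 _ ⊗≫ (𝟙_ C ◁ η_ B (Bᘁ : C) ≫ coPair U Y ▷ (B ⊗ (Bᘁ : C))) ⊗≫ Y ◁ h ▷ (Bᘁ : C) ⊗≫
        ((Y ⊗ U) ◁ evPair B (Bᘁ : C) ≫ ε_ U Y ▷ 𝟙_ C) ⊗≫ 𝟙 _ := by
      rw [← whisker_exchange]; monoidal
    _ = _ := by rw [whisker_exchange]; monoidal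

end NestedTrace


/-! ### Bending strands of a coupon -/

section Bend

variable {C : Type u} [Category.{v} C] [MonoidalCategory C]

open ExactPairing

/-- The rotation of a coupon which bends its first input and its last output. -/
def bend (U' X' : C) {U X B D : C} [ExactPairing U' U] [ExactPairing X' X] (P : U ⊗ B ⟶ D ⊗ X) :
    B ⊗ X' ⟶ U' ⊗ D :=
  𝟙 _ ⊗≫ η_ U' U ▷ (B ⊗ X') ⊗≫ U' ◁ P ▷ X' ⊗≫ (U' ⊗ D) ◁ ε_ X' X ⊗≫ 𝟙 _

/-- The inverse of `bend`. -/
def unbend (U X : C) {U' X' B D : C} [ExactPairing U' U] [ExactPairing X' X]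
    (f : B ⊗ X' ⟶ U' ⊗ D) : U ⊗ B ⟶ D ⊗ X :=
  𝟙 _ ⊗≫ (U ⊗ B) ◁ η_ X' X ⊗≫ U ◁ f ▷ X ⊗≫ ε_ U' U ▷ (D ⊗ X) ⊗≫ 𝟙 _

variable {U U' X X' Y Y' B B' D D' : C} [ExactPairing U' U] [ExactPairing X' X]
  [ExactPairing Y' Y]

/-- `bend` as an equivalence. -/
def bendEquiv (U U' X X' B D : C) [ExactPairing U' U] [ExactPairing X' X] :
    (U ⊗ B ⟶ D ⊗ X) ≃ (B ⊗ X' ⟶ U' ⊗ D) :=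
  ((tensorLeftHomEquiv B U' U (D ⊗ X)).trans ((α_ U' D X).symm.homToEquiv (Z := B))).trans
    (tensorRightHomEquiv B X' X (U' ⊗ D)).symm

/-- As a composite of the two duality adjunctions, bending is invertible without a separate snake
computation. -/
theorem bendEquiv_apply (P : U ⊗ B ⟶ D ⊗ X) : bendEquiv U U' X X' B D P = bend U' X' P := by
  simp only [bendEquiv, tensorLeftHomEquiv, tensorRightHomEquiv, bend, Equiv.trans_apply,
    Equiv.coe_fn_mk, Equiv.symm_mk, Iso.homToEquiv, Iso.symm_hom]
  monoidal

theorem bendEquiv_symm_apply (f : B ⊗ X' ⟶ U' ⊗ D) :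
    (bendEquiv U U' X X' B D).symm f = unbend U X f := by
  simp only [bendEquiv, tensorLeftHomEquiv, tensorRightHomEquiv, unbend, Equiv.symm_trans_apply,
    Equiv.coe_fn_mk, Equiv.symm_mk, Iso.homToEquiv, Iso.symm_inv]
  monoidal

theorem unbend_bend (P : U ⊗ B ⟶ D ⊗ X) : unbend U X (bend U' X' P) = P := by
  rw [← bendEquiv_apply, ← bendEquiv_symm_apply, Equiv.symm_apply_apply]

theorem bend_unbend (f : B ⊗ X' ⟶ U' ⊗ D) : bend U' X' (unbend U X f) = f := by
  rw [← bendEquiv_apply, ← bendEquiv_symm_apply, Equiv.apply_symm_apply]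

theorem bend_whiskerLeft_comp (h : B' ⟶ B) (P : U ⊗ B ⟶ D ⊗ X) :
    bend U' X' (U ◁ h ≫ P) = h ▷ X' ≫ bend U' X' P := by
  calc _ = 𝟙 _ ⊗≫ (η_ U' U ▷ (B' ⊗ X') ≫ (U' ⊗ U) ◁ (h ▷ X')) ⊗≫ U' ◁ P ▷ X' ⊗≫
        (U' ⊗ D) ◁ ε_ X' X ⊗≫ 𝟙 _ := by rw [bend]; monoidal
    _ = _ := by rw [← whisker_exchange, bend]; monoidal

theorem bend_comp_whiskerRight (P : U ⊗ B ⟶ D ⊗ X) (h : D ⟶ D') :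
    bend U' X' (P ≫ h ▷ X) = bend U' X' P ≫ U' ◁ h := by
  calc _ = 𝟙 _ ⊗≫ η_ U' U ▷ (B ⊗ X') ⊗≫ U' ◁ P ▷ X' ⊗≫ U' ◁ (h ▷ (X ⊗ X') ≫
        D' ◁ ε_ X' X) ⊗≫ 𝟙 _ := by rw [bend]; monoidal
    _ = _ := by rw [← whisker_exchange, bend]; monoidal

theorem bend_horizontal (P : U ⊗ B ⟶ D ⊗ X) (Q : X ⊗ B' ⟶ D' ⊗ Y) :
    bend U' Y' ((α_ U B B').inv ≫ P ▷ B' ≫ (α_ D X B').hom ≫ D ◁ Q ≫ (α_ D D' Y).inv) =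
      (α_ B B' Y').hom ≫ B ◁ bend X' Y' Q ≫ (α_ B X' D').inv ≫ bend U' X' P ▷ D' ≫
        (α_ U' D D').hom := by
  symm
  let p : B ⟶ (U' ⊗ D) ⊗ X := 𝟙 _ ⊗≫ η_ U' U ▷ B ⊗≫ U' ◁ P ⊗≫ 𝟙 _
  let q : B' ⊗ Y' ⟶ X' ⊗ D' := bend X' Y' Q
  have hp : bend U' X' P = 𝟙 _ ⊗≫ p ▷ X' ⊗≫ (U' ⊗ D) ◁ ε_ X' X ⊗≫ 𝟙 _ := by
    simp only [bend, p]; monoidal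
  calc _ = 𝟙 _ ⊗≫ (B ◁ q ≫ p ▷ (X' ⊗ D')) ⊗≫ (U' ⊗ D) ◁ ε_ X' X ▷ D' ⊗≫ 𝟙 _ := by
        rw [hp]; monoidal
    _ = 𝟙 _ ⊗≫ p ▷ (B' ⊗ Y') ⊗≫ (U' ⊗ D) ◁ (X ◁ η_ X' X ▷ (B' ⊗ Y') ⊗≫
          ((X ⊗ X') ◁ (Q ▷ Y' ⊗≫ D' ◁ ε_ Y' Y ⊗≫ 𝟙 D') ≫ ε_ X' X ▷ D')) ⊗≫ 𝟙 _ := by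
        rw [whisker_exchange]; simp only [q, bend]; monoidal
    _ = 𝟙 _ ⊗≫ p ▷ (B' ⊗ Y') ⊗≫ (U' ⊗ D) ◁ ((X ◁ η_ X' X ⊗≫ ε_ X' X ▷ X) ▷ (B' ⊗ Y') ⊗≫
          Q ▷ Y' ⊗≫ D' ◁ ε_ Y' Y) ⊗≫ 𝟙 _ := by
        rw [whisker_exchange]; monoidal
    _ = _ := by
        rw [coevaluation_evaluation'']; simp only [p]; rw [bend]; monoidal

theorem unbend_comp_whiskerLeft (f : B ⊗ X' ⟶ U' ⊗ D) (h : D ⟶ D') :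
    unbend U X (f ≫ U' ◁ h) = unbend U X f ≫ h ▷ X := by
  rw [← unbend_bend (U' := U') (X' := X') (unbend U X f ≫ h ▷ X), bend_comp_whiskerRight,
    bend_unbend]

theorem unbend_whiskerRight_comp (h : B' ⟶ B) (f : B ⊗ X' ⟶ U' ⊗ D) :
    unbend U X (h ▷ X' ≫ f) = U ◁ h ≫ unbend U X f := by
  rw [← unbend_bend (U' := U') (X' := X') (U ◁ h ≫ unbend U X f), bend_whiskerLeft_comp,
    bend_unbend]

theorem unbend_horizontal (f : B ⊗ X' ⟶ U' ⊗ D) (g : B' ⊗ Y' ⟶ X' ⊗ D') :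
    unbend U Y ((α_ B B' Y').hom ≫ B ◁ g ≫ (α_ B X' D').inv ≫ f ▷ D' ≫ (α_ U' D D').hom) =
      (α_ U B B').inv ≫ unbend U X f ▷ B' ≫ (α_ D X B').hom ≫ D ◁ unbend X Y g ≫
        (α_ D D' Y).inv := by
  rw [← unbend_bend (U' := U') (X' := Y') ((α_ U B B').inv ≫ _), bend_horizontal (X' := X'),
    bend_unbend, bend_unbend]

variable [BraidedCategory C]

theorem braiding_inv_comp_evaluation {A a B : C} (e : A ⊗ a ⟶ 𝟙_ C) :
    A ◁ (β_ a B).inv ⊗≫ e ▷ B ⊗≫ 𝟙 B =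
      𝟙 _ ⊗≫ (β_ A B).hom ▷ a ⊗≫ B ◁ e ⊗≫ 𝟙 B := by
  have h := BraidedCategory.braiding_naturality_left e B
  rw [braiding_tensorUnit_left, BraidedCategory.braiding_tensor_left_hom] at h
  calc _ = 𝟙 _ ⊗≫ A ◁ (β_ a B).inv ⊗≫ (e ▷ B ≫ (λ_ B).hom ≫ (ρ_ B).inv) ⊗≫ 𝟙 B := by
        monoidal
    _ = 𝟙 _ ⊗≫ A ◁ ((β_ a B).inv ≫ (β_ a B).hom) ⊗≫ (β_ A B).hom ▷ a ⊗≫ B ◁ e ⊗≫ 𝟙 B := by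
        rw [h]; monoidal
    _ = _ := by rw [Iso.inv_hom_id]; monoidal

/-- Carrying the crossing with `Z` across the cap of `U'` and `U` turns an inverse braiding with
`U'` into a braiding with `U`; the remaining coupon is then slid past the crossing. -/
theorem unbend_braiding (Z : C) (f : B ⊗ X' ⟶ U' ⊗ D) :
    unbend U X ((α_ Z B X').hom ≫ Z ◁ f ≫ (α_ Z U' D).inv ≫ (β_ U' Z).inv ▷ D ≫
        (α_ U' Z D).hom) =
      (α_ U Z B).inv ≫ (β_ U Z).hom ▷ B ≫ (α_ Z U B).hom ≫ Z ◁ unbend U X f ≫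
        (α_ Z D X).inv := by
  calc _ = 𝟙 _ ⊗≫ (U ⊗ Z) ◁ (𝟙 B ⊗≫ B ◁ η_ X' X ⊗≫ f ▷ X ⊗≫ 𝟙 (U' ⊗ D ⊗ X)) ⊗≫
        (U ◁ (β_ U' Z).inv ⊗≫ ε_ U' U ▷ Z ⊗≫ 𝟙 Z) ▷ (D ⊗ X) ⊗≫ 𝟙 _ := by
        rw [unbend]; monoidal
    _ = 𝟙 _ ⊗≫ ((U ⊗ Z) ◁ (𝟙 B ⊗≫ B ◁ η_ X' X ⊗≫ f ▷ X ⊗≫ 𝟙 (U' ⊗ D ⊗ X)) ≫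
        (β_ U Z).hom ▷ (U' ⊗ D ⊗ X)) ⊗≫ Z ◁ ε_ U' U ▷ (D ⊗ X) ⊗≫ 𝟙 _ := by
        rw [braiding_inv_comp_evaluation]; monoidal
    _ = _ := by rw [whisker_exchange, unbend]; monoidal

theorem bend_braiding (Z : C) (P : U ⊗ B ⟶ D ⊗ X) :
    bend U' X' ((α_ U Z B).inv ≫ (β_ U Z).hom ▷ B ≫ (α_ Z U B).hom ≫ Z ◁ P ≫ (α_ Z D X).inv) =
      (α_ Z B X').hom ≫ Z ◁ bend U' X' P ≫ (α_ Z U' D).inv ≫ (β_ U' Z).inv ▷ D ≫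
        (α_ U' Z D).hom := by
  rw [← bend_unbend (U := U) (X := X) ((α_ Z B X').hom ≫ _), unbend_braiding, unbend_bend]

end Bend


/-! ### Invariance of the trace under bending -/

section BendTrace

variable {C : Type u} [Category.{v} C] [MonoidalCategory C] [BraidedCategory C]
  [RightRigidCategory C] [RibbonCategory C]

open RibbonCategory ExactPairing BraidedCategory

/-- Reversing a pairing twice adds two braidings and two twists, which together form the twist of `Y
⊗ X`. By naturality and triviality on the unit, that twist disappears before the evaluation. -/
theorem evPair_reversePairing (X Y : C) [ExactPairing X Y] :
    @evPair C _ _ _ _ _ Y X (reversePairing X Y) = ε_ X Y := by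
  have h := twist_naturality (ε_ X Y)
  rw [twist_unit, Category.comp_id, twist_tensor, ← braiding_naturality, ← braiding_naturality_assoc,
    MonoidalCategory.tensorHom_def, Category.assoc] at h
  rw [h, evPair, reversePairing_evaluation, evPair]
  simp only [Category.assoc, braiding_naturality_right_assoc]

/-- Both traces reduce to traces of endomorphisms of `B`: one by closing `U` on the left, the other
by closing `X'` on the right. These endomorphisms agree after straightening two snakes on the `X`
strand. -/
theorem qtr_bend_comp_unbend {U U' X X' B D : C} [ExactPairing U U'] [ExactPairing X X']
    (P : U ⊗ B ⟶ D ⊗ X) (f : D ⊗ X ⟶ U ⊗ B) :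
    qtr (@bend C _ _ U' X' U X B D (reversePairing U U') (reversePairing X X') P ≫
      unbend U' X' f) = qtr (P ≫ f) := by
  let _ := reversePairing U U'
  let _ := reversePairing X X'
  rw [← qtr_leftPartialTrace U' (P ≫ f), ← qtr_partialTrace (Y := X)]
  congr 1
  rw [partialTrace, evPair_reversePairing]
  rw [reversePairing_coevaluation, bend, unbend]
  calc _ = 𝟙 _ ⊗≫ (B ◁ η_ X' X ≫ (𝟙 B ⊗≫ η_ U' U ▷ B ⊗≫ U' ◁ P) ▷ (X' ⊗ X)) ⊗≫
        (U' ⊗ D) ◁ (ε_ X' X ▷ X ⊗≫ η_ X X' ▷ X) ⊗≫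
        ((U' ◁ f ⊗≫ ε_ U U' ▷ B ⊗≫ 𝟙 B) ▷ (X' ⊗ X) ≫ B ◁ ε_ X X') ⊗≫ 𝟙 _ := by monoidal
    _ = 𝟙 _ ⊗≫ (η_ U' U ▷ B ⊗≫ U' ◁ P) ⊗≫ (U' ⊗ D) ◁ (X ◁ η_ X' X ⊗≫ ε_ X' X ▷ X) ⊗≫
        (U' ⊗ D) ◁ (η_ X X' ▷ X ⊗≫ X ◁ ε_ X X') ⊗≫ U' ◁ f ⊗≫ ε_ U U' ▷ B ⊗≫ 𝟙 _ := by
        rw [whisker_exchange _ (η_ X' X), ← whisker_exchange _ (ε_ X X')]; monoidal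
    _ = _ := by
        rw [coevaluation_evaluation'', evaluation_coevaluation'', reversePairing_coevaluation]
        monoidal

end BendTrace


/-! ### The closed diagrams of a 4-simplex under the two moves -/

section Diagrams

variable {C : Type u} [Category.{v} C] [MonoidalCategory C] [BraidedCategory C]
  [RightRigidCategory C] [RibbonCategory C]

open RibbonCategory ExactPairing BraidedCategory

variable {V₀₁₂ V₀₁₃ V₀₁₄ V₀₂₃ V₀₂₄ V₀₃₄ V₁₂₃ V₁₂₄ V₁₃₄ V₂₃₄ : C}

/-- `diagramPos` in terms of the rotated coupons. -/
def posDiagram (g₁₂₃₄ : V₁₂₃ ⊗ V₁₃₄ ⟶ V₂₃₄ ⊗ V₁₂₄) (f₀₂₃₄ : V₂₃₄ ⊗ V₀₂₄ ⟶ V₀₂₃ ⊗ V₀₃₄)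
    (g₀₁₃₄ : V₀₁₃ ⊗ V₀₃₄ ⟶ V₁₃₄ ⊗ V₀₁₄) (f₀₁₂₄ : V₁₂₄ ⊗ V₀₁₄ ⟶ V₀₁₂ ⊗ V₀₂₄)
    (g₀₁₂₃ : V₀₁₂ ⊗ V₀₂₃ ⟶ V₁₂₃ ⊗ V₀₁₃) :
    V₂₃₄ ⊗ (V₁₂₄ ⊗ V₀₁₄) ⟶ V₂₃₄ ⊗ (V₁₂₄ ⊗ V₀₁₄) :=
  V₂₃₄ ◁ f₀₁₂₄ ≫ (α_ _ _ _).inv ≫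
    (β_ V₀₁₂ V₂₃₄).inv ▷ V₀₂₄ ≫ (α_ _ _ _).hom ≫
    V₀₁₂ ◁ f₀₂₃₄ ≫ (α_ _ _ _).inv ≫
    g₀₁₂₃ ▷ V₀₃₄ ≫ (α_ _ _ _).hom ≫
    V₁₂₃ ◁ g₀₁₃₄ ≫ (α_ _ _ _).inv ≫
    g₁₂₃₄ ▷ V₀₁₄ ≫ (α_ _ _ _).hom

/-- `diagramNeg` in terms of the rotated coupons. -/
def negDiagram (f₁₂₃₄ : V₂₃₄ ⊗ V₁₂₄ ⟶ V₁₂₃ ⊗ V₁₃₄) (g₀₂₃₄ : V₀₂₃ ⊗ V₀₃₄ ⟶ V₂₃₄ ⊗ V₀₂₄)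
    (f₀₁₃₄ : V₁₃₄ ⊗ V₀₁₄ ⟶ V₀₁₃ ⊗ V₀₃₄) (g₀₁₂₄ : V₀₁₂ ⊗ V₀₂₄ ⟶ V₁₂₄ ⊗ V₀₁₄)
    (f₀₁₂₃ : V₁₂₃ ⊗ V₀₁₃ ⟶ V₀₁₂ ⊗ V₀₂₃) :
    V₂₃₄ ⊗ (V₁₂₄ ⊗ V₀₁₄) ⟶ V₂₃₄ ⊗ (V₁₂₄ ⊗ V₀₁₄) :=
  (α_ _ _ _).inv ≫ f₁₂₃₄ ▷ V₀₁₄ ≫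
    (α_ _ _ _).hom ≫ V₁₂₃ ◁ f₀₁₃₄ ≫
    (α_ _ _ _).inv ≫ f₀₁₂₃ ▷ V₀₃₄ ≫
    (α_ _ _ _).hom ≫ V₀₁₂ ◁ g₀₂₃₄ ≫
    (α_ _ _ _).inv ≫ (β_ V₀₁₂ V₂₃₄).hom ▷ V₀₂₄ ≫
    (α_ _ _ _).hom ≫ V₂₃₄ ◁ g₀₁₂₄

theorem qtr_conj {X Y : C} (i : Y ≅ X) (h : Y ⟶ Y) : qtr (i.inv ≫ h ≫ i.hom) = qtr h := by
  rw [qtr_comp, Category.assoc, Iso.hom_inv_id, Category.comp_id]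

/-- The coupon `g₁₂₃₄` is slid past the strand `V₀₁₄` (`h1`), and `f₀₁₂₄` with its braiding past
`V₂₃₄` (`h2`). The braidings introduced by the rotation cancel in pairs, leaving one crossing of
`V₀₁₂` and `V₂₃₄`; cyclicity restores the starting point. -/
theorem qtr_posDiagram_rotate (g₁₂₃₄ : V₁₂₃ ⊗ V₁₃₄ ⟶ V₂₃₄ ⊗ V₁₂₄)
    (f₀₂₃₄ : V₂₃₄ ⊗ V₀₂₄ ⟶ V₀₂₃ ⊗ V₀₃₄)
    (g₀₁₃₄ : V₀₁₃ ⊗ V₀₃₄ ⟶ V₁₃₄ ⊗ V₀₁₄) (f₀₁₂₄ : V₁₂₄ ⊗ V₀₁₄ ⟶ V₀₁₂ ⊗ V₀₂₄)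
    (g₀₁₂₃ : V₀₁₂ ⊗ V₀₂₃ ⟶ V₁₂₃ ⊗ V₀₁₃) :
    qtr (posDiagram g₀₁₂₃ (g₁₂₃₄ ≫ (β_ V₁₂₄ V₂₃₄).inv) ((β_ V₀₂₄ V₂₃₄).hom ≫ f₀₂₃₄)
      (g₀₁₃₄ ≫ (β_ V₀₁₄ V₁₃₄).inv) ((β_ V₀₁₄ V₁₂₄).hom ≫ f₀₁₂₄)) =
      qtr (posDiagram g₁₂₃₄ f₀₂₃₄ g₀₁₃₄ f₀₁₂₄ g₀₁₂₃) := by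
  have h1 := braiding_inv_naturality_left g₁₂₃₄ V₀₁₄
  have h2 := braiding_inv_naturality_right V₂₃₄ ((β_ V₀₁₄ V₁₂₄).hom ≫ f₀₁₂₄)
  rw [braiding_tensor_right_inv, braiding_tensor_right_inv] at h1
  rw [braiding_tensor_left_inv, braiding_tensor_left_inv] at h2
  calc _ = qtr ((V₁₂₃ ◁ g₀₁₃₄ ≫ (α_ _ _ _).inv ≫ g₁₂₃₄ ▷ V₀₁₄ ≫ (α_ _ _ _).hom) ≫
        (V₂₃₄ ◁ f₀₁₂₄ ≫ (α_ _ _ _).inv ≫ (β_ V₀₁₂ V₂₃₄).inv ▷ V₀₂₄ ≫ (α_ _ _ _).hom ≫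
          V₀₁₂ ◁ f₀₂₃₄ ≫ (α_ _ _ _).inv ≫ g₀₁₂₃ ▷ V₀₃₄ ≫ (α_ _ _ _).hom)) := by
        congr 1
        calc _ = 𝟙 _ ⊗≫ V₁₂₃ ◁ g₀₁₃₄ ⊗≫ (((α_ V₁₂₃ V₁₃₄ V₀₁₄).hom ≫ V₁₂₃ ◁ (β_ V₀₁₄ V₁₃₄).inv ≫
              (α_ V₁₂₃ V₀₁₄ V₁₃₄).inv ≫ (β_ V₀₁₄ V₁₂₃).inv ▷ V₁₃₄ ≫ (α_ V₀₁₄ V₁₂₃ V₁₃₄).hom) ≫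
              V₀₁₄ ◁ g₁₂₃₄) ⊗≫ V₀₁₄ ◁ (β_ V₁₂₄ V₂₃₄).inv ⊗≫
              ((β_ V₀₁₄ V₁₂₄).hom ≫ f₀₁₂₄) ▷ V₂₃₄ ⊗≫
              V₀₁₂ ◁ ((β_ V₀₂₄ V₂₃₄).hom ≫ f₀₂₃₄) ⊗≫ g₀₁₂₃ ▷ V₀₃₄ ⊗≫ 𝟙 _ := by
              rw [posDiagram]; monoidal
          _ = 𝟙 _ ⊗≫ V₁₂₃ ◁ g₀₁₃₄ ⊗≫ g₁₂₃₄ ▷ V₀₁₄ ⊗≫ V₂₃₄ ◁ (β_ V₀₁₄ V₁₂₄).inv ⊗≫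
              (((α_ V₂₃₄ V₀₁₄ V₁₂₄).inv ≫ (β_ V₀₁₄ V₂₃₄).inv ▷ V₁₂₄ ≫ (α_ V₀₁₄ V₂₃₄ V₁₂₄).hom ≫
              V₀₁₄ ◁ (β_ V₁₂₄ V₂₃₄).inv ≫ (α_ V₀₁₄ V₁₂₄ V₂₃₄).inv) ≫
              ((β_ V₀₁₄ V₁₂₄).hom ≫ f₀₁₂₄) ▷ V₂₃₄) ⊗≫
              V₀₁₂ ◁ ((β_ V₀₂₄ V₂₃₄).hom ≫ f₀₂₃₄) ⊗≫ g₀₁₂₃ ▷ V₀₃₄ ⊗≫ 𝟙 _ := by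
              rw [← h1]; monoidal
          _ = 𝟙 _ ⊗≫ V₁₂₃ ◁ g₀₁₃₄ ⊗≫ g₁₂₃₄ ▷ V₀₁₄ ⊗≫
              V₂₃₄ ◁ ((β_ V₀₁₄ V₁₂₄).inv ≫ (β_ V₀₁₄ V₁₂₄).hom) ⊗≫ V₂₃₄ ◁ f₀₁₂₄ ⊗≫
              (β_ V₀₁₂ V₂₃₄).inv ▷ V₀₂₄ ⊗≫ V₀₁₂ ◁ ((β_ V₀₂₄ V₂₃₄).inv ≫ (β_ V₀₂₄ V₂₃₄).hom) ⊗≫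
              V₀₁₂ ◁ f₀₂₃₄ ⊗≫ g₀₁₂₃ ▷ V₀₃₄ ⊗≫ 𝟙 _ := by
              rw [← h2]; monoidal
          _ = _ := by rw [Iso.inv_hom_id, Iso.inv_hom_id]; monoidal
    _ = _ := by rw [qtr_comp, posDiagram]; simp only [Category.assoc]

/-- The mirrored argument: here `f₁₂₃₄` passes `V₀₁₄`, and `g₀₁₂₄` with its inverse braiding passes
`V₂₃₄`. -/
theorem qtr_negDiagram_rotate (f₁₂₃₄ : V₂₃₄ ⊗ V₁₂₄ ⟶ V₁₂₃ ⊗ V₁₃₄)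
    (g₀₂₃₄ : V₀₂₃ ⊗ V₀₃₄ ⟶ V₂₃₄ ⊗ V₀₂₄)
    (f₀₁₃₄ : V₁₃₄ ⊗ V₀₁₄ ⟶ V₀₁₃ ⊗ V₀₃₄) (g₀₁₂₄ : V₀₁₂ ⊗ V₀₂₄ ⟶ V₁₂₄ ⊗ V₀₁₄)
    (f₀₁₂₃ : V₁₂₃ ⊗ V₀₁₃ ⟶ V₀₁₂ ⊗ V₀₂₃) :
    qtr (negDiagram f₀₁₂₃ ((β_ V₁₂₄ V₂₃₄).hom ≫ f₁₂₃₄) (g₀₂₃₄ ≫ (β_ V₀₂₄ V₂₃₄).inv)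
      ((β_ V₀₁₄ V₁₃₄).hom ≫ f₀₁₃₄) (g₀₁₂₄ ≫ (β_ V₀₁₄ V₁₂₄).inv)) =
      qtr (negDiagram f₁₂₃₄ g₀₂₃₄ f₀₁₃₄ g₀₁₂₄ f₀₁₂₃) := by
  have h1 := braiding_naturality_right V₀₁₄ f₁₂₃₄
  have h2 := braiding_naturality_left (g₀₁₂₄ ≫ (β_ V₀₁₄ V₁₂₄).inv) V₂₃₄
  rw [braiding_tensor_right_hom, braiding_tensor_right_hom] at h1
  rw [braiding_tensor_left_hom, braiding_tensor_left_hom] at h2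
  calc _ = qtr (((α_ _ _ _).inv ≫ f₀₁₂₃ ▷ V₀₃₄ ≫ (α_ _ _ _).hom ≫ V₀₁₂ ◁ g₀₂₃₄ ≫
        (α_ _ _ _).inv ≫ (β_ V₀₁₂ V₂₃₄).hom ▷ V₀₂₄ ≫ (α_ _ _ _).hom ≫ V₂₃₄ ◁ g₀₁₂₄) ≫
        ((α_ _ _ _).inv ≫ f₁₂₃₄ ▷ V₀₁₄ ≫ (α_ _ _ _).hom ≫ V₁₂₃ ◁ f₀₁₃₄)) := by
        congr 1
        calc _ = 𝟙 _ ⊗≫ f₀₁₂₃ ▷ V₀₃₄ ⊗≫ V₀₁₂ ◁ (g₀₂₃₄ ≫ (β_ V₀₂₄ V₂₃₄).inv) ⊗≫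
              (g₀₁₂₄ ≫ (β_ V₀₁₄ V₁₂₄).inv) ▷ V₂₃₄ ⊗≫ V₀₁₄ ◁ (β_ V₁₂₄ V₂₃₄).hom ⊗≫
              (V₀₁₄ ◁ f₁₂₃₄ ≫ (α_ _ _ _).inv ≫ (β_ V₀₁₄ V₁₂₃).hom ▷ V₁₃₄ ≫ (α_ _ _ _).hom ≫
                V₁₂₃ ◁ (β_ V₀₁₄ V₁₃₄).hom ≫ (α_ _ _ _).inv) ⊗≫ V₁₂₃ ◁ f₀₁₃₄ := by
              rw [negDiagram]; monoidal
          _ = 𝟙 _ ⊗≫ f₀₁₂₃ ▷ V₀₃₄ ⊗≫ V₀₁₂ ◁ (g₀₂₃₄ ≫ (β_ V₀₂₄ V₂₃₄).inv) ⊗≫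
              ((g₀₁₂₄ ≫ (β_ V₀₁₄ V₁₂₄).inv) ▷ V₂₃₄ ≫ (α_ _ _ _).hom ≫
                V₀₁₄ ◁ (β_ V₁₂₄ V₂₃₄).hom ≫ (α_ _ _ _).inv ≫ (β_ V₀₁₄ V₂₃₄).hom ▷ V₁₂₄ ≫
                (α_ _ _ _).hom) ⊗≫ V₂₃₄ ◁ (β_ V₀₁₄ V₁₂₄).hom ⊗≫ f₁₂₃₄ ▷ V₀₁₄ ⊗≫
              V₁₂₃ ◁ f₀₁₃₄ := by
              rw [h1]; monoidal
          _ = 𝟙 _ ⊗≫ f₀₁₂₃ ▷ V₀₃₄ ⊗≫ V₀₁₂ ◁ g₀₂₃₄ ⊗≫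
              V₀₁₂ ◁ ((β_ V₀₂₄ V₂₃₄).inv ≫ (β_ V₀₂₄ V₂₃₄).hom) ⊗≫ (β_ V₀₁₂ V₂₃₄).hom ▷ V₀₂₄ ⊗≫
              V₂₃₄ ◁ g₀₁₂₄ ⊗≫ V₂₃₄ ◁ ((β_ V₀₁₄ V₁₂₄).inv ≫ (β_ V₀₁₄ V₁₂₄).hom) ⊗≫
              f₁₂₃₄ ▷ V₀₁₄ ⊗≫ V₁₂₃ ◁ f₀₁₃₄ := by
              rw [h2]; monoidal
          _ = _ := by rw [Iso.inv_hom_id, Iso.inv_hom_id]; monoidal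
    _ = _ := by rw [qtr_comp, negDiagram]; simp only [Category.assoc]

/-- `bend` for reversed pairings. -/
def revBend (U' X' : C) {U X B D : C} [ExactPairing U U'] [ExactPairing X X']
    (P : U ⊗ B ⟶ D ⊗ X) : B ⊗ X' ⟶ U' ⊗ D :=
  @bend C _ _ U' X' U X B D (reversePairing U U') (reversePairing X X') P

/-- The closed diagram is cut into `F` and `P` so that `V₀₁₂` and `V₀₁₄` are the outer strands to be
bent. The third dualised strand, `V₀₁₃`, is internal to `P` and is handled by `bend_horizontal`; the
crossing lies in `F` and is handled by `unbend_braiding`. -/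
theorem qtr_negDiagram_bend (W₀₁₂ W₀₁₃ W₀₁₄ : C) [ExactPairing V₀₁₂ W₀₁₂] [ExactPairing V₀₁₃ W₀₁₃]
    [ExactPairing V₀₁₄ W₀₁₄] (g₁₂₃₄ : V₁₂₃ ⊗ V₁₃₄ ⟶ V₂₃₄ ⊗ V₁₂₄)
    (f₀₂₃₄ : V₂₃₄ ⊗ V₀₂₄ ⟶ V₀₂₃ ⊗ V₀₃₄)
    (g₀₁₃₄ : V₀₁₃ ⊗ V₀₃₄ ⟶ V₁₃₄ ⊗ V₀₁₄) (f₀₁₂₄ : V₁₂₄ ⊗ V₀₁₄ ⟶ V₀₁₂ ⊗ V₀₂₄)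
    (g₀₁₂₃ : V₀₁₂ ⊗ V₀₂₃ ⟶ V₁₂₃ ⊗ V₀₁₃) :
    qtr (negDiagram f₀₂₃₄ g₁₂₃₄ (revBend W₀₁₃ W₀₁₄ g₀₁₃₄) (unbend W₀₁₂ W₀₁₄ f₀₁₂₄)
      (revBend W₀₁₂ W₀₁₃ g₀₁₂₃)) = qtr (posDiagram g₁₂₃₄ f₀₂₃₄ g₀₁₃₄ f₀₁₂₄ g₀₁₂₃) := by
  let P : V₀₁₂ ⊗ (V₂₃₄ ⊗ V₀₂₄) ⟶ (V₂₃₄ ⊗ V₁₂₄) ⊗ V₀₁₄ :=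
    (V₀₁₂ ◁ f₀₂₃₄ ≫ (α_ _ _ _).inv ≫ g₀₁₂₃ ▷ V₀₃₄ ≫ (α_ _ _ _).hom ≫ V₁₂₃ ◁ g₀₁₃₄ ≫
      (α_ _ _ _).inv) ≫ g₁₂₃₄ ▷ V₀₁₄
  let F : (V₂₃₄ ⊗ V₁₂₄) ⊗ V₀₁₄ ⟶ V₀₁₂ ⊗ (V₂₃₄ ⊗ V₀₂₄) :=
    (α_ _ _ _).hom ≫ V₂₃₄ ◁ f₀₁₂₄ ≫ (α_ _ _ _).inv ≫ (β_ V₀₁₂ V₂₃₄).inv ▷ V₀₂₄ ≫ (α_ _ _ _).hom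
  have hP : revBend W₀₁₂ W₀₁₄ P = (f₀₂₃₄ ▷ W₀₁₄ ≫ (α_ _ _ _).hom ≫ V₀₂₃ ◁ revBend W₀₁₃ W₀₁₄ g₀₁₃₄ ≫
      (α_ _ _ _).inv ≫ revBend W₀₁₂ W₀₁₃ g₀₁₂₃ ▷ V₁₃₄ ≫ (α_ _ _ _).hom) ≫ W₀₁₂ ◁ g₁₂₃₄ := by
    let _ := reversePairing V₀₁₂ W₀₁₂
    let _ := reversePairing V₀₁₃ W₀₁₃
    let _ := reversePairing V₀₁₄ W₀₁₄
    simp only [revBend, P]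
    rw [bend_comp_whiskerRight, bend_whiskerLeft_comp, bend_horizontal (X' := W₀₁₃)]
  have hF : unbend W₀₁₂ W₀₁₄ F = (α_ _ _ _).inv ≫ (β_ W₀₁₂ V₂₃₄).hom ▷ V₁₂₄ ≫ (α_ _ _ _).hom ≫
      V₂₃₄ ◁ unbend W₀₁₂ W₀₁₄ f₀₁₂₄ ≫ (α_ _ _ _).inv := unbend_braiding _ _
  have h1 : posDiagram g₁₂₃₄ f₀₂₃₄ g₀₁₃₄ f₀₁₂₄ g₀₁₂₃ =
      (α_ _ _ _).inv ≫ (F ≫ P) ≫ (α_ _ _ _).hom := by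
    simp [posDiagram, F, P]
  have h2 : negDiagram f₀₂₃₄ g₁₂₃₄ (revBend W₀₁₃ W₀₁₄ g₀₁₃₄) (unbend W₀₁₂ W₀₁₄ f₀₁₂₄)
      (revBend W₀₁₂ W₀₁₃ g₀₁₂₃) =
      (α_ _ _ _).inv ≫ (revBend W₀₁₂ W₀₁₄ P ≫ unbend W₀₁₂ W₀₁₄ F) ≫ (α_ _ _ _).hom := by
    rw [hP, hF]; simp [negDiagram]
  rw [h1, h2, qtr_conj, qtr_conj, qtr_comp F P]
  exact qtr_bend_comp_unbend P F

theorem qtr_posDiagram_bend (W₀₁₂ W₀₁₃ W₀₁₄ : C) [ExactPairing V₀₁₂ W₀₁₂] [ExactPairing V₀₁₃ W₀₁₃]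
    [ExactPairing V₀₁₄ W₀₁₄] (f₁₂₃₄ : V₂₃₄ ⊗ V₁₂₄ ⟶ V₁₂₃ ⊗ V₁₃₄)
    (g₀₂₃₄ : V₀₂₃ ⊗ V₀₃₄ ⟶ V₂₃₄ ⊗ V₀₂₄)
    (f₀₁₃₄ : V₁₃₄ ⊗ V₀₁₄ ⟶ V₀₁₃ ⊗ V₀₃₄) (g₀₁₂₄ : V₀₁₂ ⊗ V₀₂₄ ⟶ V₁₂₄ ⊗ V₀₁₄)
    (f₀₁₂₃ : V₁₂₃ ⊗ V₀₁₃ ⟶ V₀₁₂ ⊗ V₀₂₃) :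
    qtr (posDiagram g₀₂₃₄ f₁₂₃₄ (unbend W₀₁₃ W₀₁₄ f₀₁₃₄) (revBend W₀₁₂ W₀₁₄ g₀₁₂₄)
      (unbend W₀₁₂ W₀₁₃ f₀₁₂₃)) = qtr (negDiagram f₁₂₃₄ g₀₂₃₄ f₀₁₃₄ g₀₁₂₄ f₀₁₂₃) := by
  -- The cut is along the same strands, but now the crossing belongs to `P` and the internal strand
  -- `V₀₁₃` to `F`.
  let P : V₀₁₂ ⊗ (V₂₃₄ ⊗ V₀₂₄) ⟶ (V₂₃₄ ⊗ V₁₂₄) ⊗ V₀₁₄ :=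
    (α_ _ _ _).inv ≫ (β_ V₀₁₂ V₂₃₄).hom ▷ V₀₂₄ ≫ (α_ _ _ _).hom ≫ V₂₃₄ ◁ g₀₁₂₄ ≫ (α_ _ _ _).inv
  let F : (V₂₃₄ ⊗ V₁₂₄) ⊗ V₀₁₄ ⟶ V₀₁₂ ⊗ (V₂₃₄ ⊗ V₀₂₄) :=
    (f₁₂₃₄ ▷ V₀₁₄ ≫ (α_ _ _ _).hom ≫ V₁₂₃ ◁ f₀₁₃₄ ≫ (α_ _ _ _).inv ≫ f₀₁₂₃ ▷ V₀₃₄ ≫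
      (α_ _ _ _).hom) ≫ V₀₁₂ ◁ g₀₂₃₄
  have hP : revBend W₀₁₂ W₀₁₄ P = (α_ _ _ _).hom ≫ V₂₃₄ ◁ revBend W₀₁₂ W₀₁₄ g₀₁₂₄ ≫
      (α_ _ _ _).inv ≫ (β_ W₀₁₂ V₂₃₄).inv ▷ V₁₂₄ ≫ (α_ _ _ _).hom := by
    let _ := reversePairing V₀₁₂ W₀₁₂
    let _ := reversePairing V₀₁₄ W₀₁₄
    exact bend_braiding _ _
  have hF : unbend W₀₁₂ W₀₁₄ F = (W₀₁₂ ◁ f₁₂₃₄ ≫ (α_ _ _ _).inv ≫ unbend W₀₁₂ W₀₁₃ f₀₁₂₃ ▷ V₁₃₄ ≫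
      (α_ _ _ _).hom ≫ V₀₂₃ ◁ unbend W₀₁₃ W₀₁₄ f₀₁₃₄ ≫ (α_ _ _ _).inv) ≫ g₀₂₃₄ ▷ W₀₁₄ := by
    simp only [F]
    rw [unbend_comp_whiskerLeft, unbend_whiskerRight_comp, unbend_horizontal (X := W₀₁₃)]
  have h1 : negDiagram f₁₂₃₄ g₀₂₃₄ f₀₁₃₄ g₀₁₂₄ f₀₁₂₃ =
      (α_ _ _ _).inv ≫ (F ≫ P) ≫ (α_ _ _ _).hom := by
    simp [negDiagram, F, P]
  have h2 : posDiagram g₀₂₃₄ f₁₂₃₄ (unbend W₀₁₃ W₀₁₄ f₀₁₃₄) (revBend W₀₁₂ W₀₁₄ g₀₁₂₄)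
      (unbend W₀₁₂ W₀₁₃ f₀₁₂₃) =
      (α_ _ _ _).inv ≫ (revBend W₀₁₂ W₀₁₄ P ≫ unbend W₀₁₂ W₀₁₄ F) ≫ (α_ _ _ _).hom := by
    rw [hP, hF]; simp [posDiagram]
  rw [h1, h2, qtr_conj, qtr_conj, qtr_comp F P]
  exact qtr_bend_comp_unbend P F

end Diagrams


/-! ### Products of linear forms on tensor products -/

section ProdForm

variable {S : Type w} [Fintype S] {N : S → Type v} [∀ s, AddCommGroup (N s)]
  [∀ s, Module ℂ (N s)]

/-- The product of linear forms as a linear form on the tensor product. -/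
def prodForm (φ : ∀ s, N s →ₗ[ℂ] ℂ) : (⨂[ℂ] s, N s) →ₗ[ℂ] ℂ :=
  PiTensorProduct.lift ((MultilinearMap.mkPiAlgebra ℂ S ℂ).compLinearMap φ)

theorem prodForm_tprod (φ : ∀ s, N s →ₗ[ℂ] ℂ) (w : ∀ s, N s) :
    prodForm φ (PiTensorProduct.tprod ℂ w) = ∏ s, φ s (w s) := by
  simp [prodForm]

end ProdForm

/-! ### States, costates and dual bases -/

section TraceFormula

variable {C : Type u} [Category.{v} C] [MonoidalCategory C] [BraidedCategory C]
  [RightRigidCategory C] [RibbonCategory C] [Preadditive C] [Linear ℂ C]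
  [MonoidalPreadditive C] [MonoidalLinear ℂ C]
variable {Λ : Type w}

/-- Rotation of coupons as a linear equivalence. -/
def couponEquiv (X Y : C) : (Xᘁ ⟶ Yᘁ) ≃ₗ[ℂ] (Y ⟶ X) :=
  LinearEquiv.ofBijective
    { toFun := coupon
      map_add' := coupon_add
      map_smul' := coupon_smul }
    ⟨coupon_injective, fun g => ⟨_, coupon_rightAdjointMate g⟩⟩

/-- The space `Hom(V₀₁₂ ⊗ V₀₂₃, V₁₂₃ ⊗ V₀₁₃)` opposite to the state space. -/
abbrev CoStateSpace (V : Λ → Λ → Λ → C) (y : Fin 4 → Λ) : Type v :=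
  V (y 0) (y 1) (y 2) ⊗ V (y 0) (y 2) (y 3) ⟶ V (y 1) (y 2) (y 3) ⊗ V (y 0) (y 1) (y 3)

/-- The dual state space is identified with the opposite of the state space. -/
def dualStateEquiv (V : Λ → Λ → Λ → C) (y : Fin 4 → Λ) :
    DualStateSpace V y ≃ₗ[ℂ] CoStateSpace V y :=
  (onDualsEquiv _ _ _ _).trans (couponEquiv _ _)

variable [ScalarUnit C]

theorem statePairing_apply (V : Λ → Λ → Λ → C) (y : Fin 4 → Λ) (b : DualStateSpace V y)
    (f : StateSpace V y) :
    statePairing V y b f = scalar C (qtr (f ≫ dualStateEquiv V y b)) :=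
  congrArg (scalar C) (pairHom_eq_qtr _ _)

/-- A morphism `A ⊗ B ⟶ D ⊗ E` together with a morphism in the opposite direction. -/
abbrev HomPair (A B D E : C) : Type v := (A ⊗ B ⟶ D ⊗ E) × (D ⊗ E ⟶ A ⊗ B)

/-- The closed diagram of a `4`-simplex of relative orientation `e`. -/
def diagramTrace (e : ℤˣ) {V₀₁₂ V₀₁₃ V₀₁₄ V₀₂₃ V₀₂₄ V₀₃₄ V₁₂₃ V₁₂₄ V₁₃₄ V₂₃₄ : C}
    (z₁₂₃₄ : HomPair V₂₃₄ V₁₂₄ V₁₂₃ V₁₃₄) (z₀₂₃₄ : HomPair V₂₃₄ V₀₂₄ V₀₂₃ V₀₃₄)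
    (z₀₁₃₄ : HomPair V₁₃₄ V₀₁₄ V₀₁₃ V₀₃₄) (z₀₁₂₄ : HomPair V₁₂₄ V₀₁₄ V₀₁₂ V₀₂₄)
    (z₀₁₂₃ : HomPair V₁₂₃ V₀₁₃ V₀₁₂ V₀₂₃) : 𝟙_ C ⟶ 𝟙_ C :=
  if e = 1 then qtr (posDiagram z₁₂₃₄.2 z₀₂₃₄.1 z₀₁₃₄.2 z₀₁₂₄.1 z₀₁₂₃.2)
  else qtr (negDiagram z₁₂₃₄.1 z₀₂₃₄.2 z₀₁₃₄.1 z₀₁₂₄.2 z₀₁₂₃.1)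

/-- The amplitude of an ordered `4`-simplex in terms of the rotated coupons. -/
def amplitude (V : Λ → Λ → Λ → C) (x : Fin 5 → Λ) (e : ℤˣ)
    (z : ∀ j : Fin 5, StateSpace V (fun i => x (j.succAbove i)) ×
      CoStateSpace V fun i => x (j.succAbove i)) : ℂ :=
  scalar C (diagramTrace e (V₀₁₂ := V (x 0) (x 1) (x 2)) (V₀₁₃ := V (x 0) (x 1) (x 3))
    (V₀₁₄ := V (x 0) (x 1) (x 4)) (V₀₂₃ := V (x 0) (x 2) (x 3))
    (V₀₂₄ := V (x 0) (x 2) (x 4)) (V₀₃₄ := V (x 0) (x 3) (x 4))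
    (V₁₂₃ := V (x 1) (x 2) (x 3)) (V₁₂₄ := V (x 1) (x 2) (x 4))
    (V₁₃₄ := V (x 1) (x 3) (x 4)) (V₂₃₄ := V (x 2) (x 3) (x 4))
    (z 0) (z 1) (z 2) (z 3) (z 4))

theorem quantumTrace_eq_amplitude (V : Λ → Λ → Λ → C) (x : Fin 5 → Λ) (e : ℤˣ)
    (f : ∀ j : Fin 5, StateSpace V fun i => x (j.succAbove i))
    (b : ∀ j : Fin 5, DualStateSpace V fun i => x (j.succAbove i)) :
    quantumTrace V x e f b = amplitude V x e fun j => (f j, dualStateEquiv V _ (b j)) := rfl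

/-- The default zeros of `extendZero` are harmless: they sit only at positions which the diagram of
sign `e` does not read. -/
theorem quantumTraceForm_apply (V : Λ → Λ → Λ → C) (x : Fin 5 → Λ) (e : ℤˣ)
    (f : ∀ j : Fin 5, StateSpace V fun i => x (j.succAbove i))
    (b : ∀ j : Fin 5, DualStateSpace V fun i => x (j.succAbove i)) :
    quantumTraceForm V x e (fun j => f j.1) (fun j => b j.1) = quantumTrace V x e f b := by
  change quantumTrace V x e _ _ = _
  rcases Int.units_eq_one_or e with rfl | rfl <;> rfl

/-- A basis of a space of morphisms, together with the dual basis of the opposite space. -/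
structure IsDualFamily {X Y : C} {I : Type} [Fintype I] [DecidableEq I]
    (z : I → (X ⟶ Y) × (Y ⟶ X)) : Prop where
  card : Fintype.card I = Module.finrank ℂ (X ⟶ Y)
  dual : ∀ k l, scalar C (qtr ((z l).1 ≫ (z k).2)) = if l = k then 1 else 0

/-- Biorthogonality gives linear independence, and the cardinality makes the family spanning. -/
theorem IsDualFamily.exists_basis {V : Λ → Λ → Λ → C} {y : Fin 4 → Λ} {I : Type} [Fintype I]
    [DecidableEq I] {z : I → StateSpace V y × CoStateSpace V y} (hz : IsDualFamily z)
    [Module.Finite ℂ (StateSpace V y)] :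
    ∃ b : Module.Basis I ℂ (StateSpace V y), ∀ k, b k = (z k).1 := by
  have hp : ∀ k l, statePairing V y ((dualStateEquiv V y).symm (z k).2) (z l).1 =
      if l = k then 1 else 0 := by
    intro k l
    rw [statePairing_apply, LinearEquiv.apply_symm_apply, hz.dual]
  have hli : LinearIndependent ℂ fun k => (z k).1 := by
    rw [Fintype.linearIndependent_iff]
    intro c hc k
    have := congrArg (statePairing V y ((dualStateEquiv V y).symm (z k).2)) hc
    simpa [hp] using this
  exact ⟨Module.Basis.mk hli (hli.span_eq_top_of_card_eq_finrank' hz.card).ge, fun k => by simp⟩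

end TraceFormula

/-! ### The partition function as a sum over dual bases -/

section TraceFormula

variable {C : Type u} [Category.{v} C] [MonoidalCategory C] [BraidedCategory C]
  [RightRigidCategory C] [RibbonCategory C] [Preadditive C] [Linear ℂ C]
  [MonoidalPreadditive C] [MonoidalLinear ℂ C] [AdmissibleRibbonCategory C]
variable {Λ : Type w}

theorem exists_isDualFamily (V : Λ → Λ → Λ → C) (y : Fin 4 → Λ) :
    ∃ z : Fin (Module.finrank ℂ (StateSpace V y)) → StateSpace V y × CoStateSpace V y,
      IsDualFamily z := by
  have := AdmissibleRibbonCategory.finite_hom (C := C)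
  obtain ⟨b', h, -⟩ := exists_dualFamily _ (statePairing_nondegenerate V y)
  refine ⟨fun k => (Module.finBasis ℂ _ k, dualStateEquiv V y (b' k)), by simp, fun k l => ?_⟩
  rw [← statePairing_apply, h]

/-- Non-degeneracy embeds the opposite space into the dual space. The resulting equality of
dimensions is needed because both moves exchange states and costates. -/
theorem finrank_hom_le (X Y : C) : Module.finrank ℂ (Y ⟶ X) ≤ Module.finrank ℂ (X ⟶ Y) := by
  have := AdmissibleRibbonCategory.finite_hom (C := C)
  have h : Function.Injective (pairing X Y) := by
    rw [← LinearMap.ker_eq_bot]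
    exact LinearMap.separatingLeft_iff_ker_eq_bot.mp
      (AdmissibleRibbonCategory.nondegenerate X Y).1
  rw [← (couponEquiv X Y).finrank_eq, ← Subspace.dual_finrank_eq (K := ℂ) (V := X ⟶ Y)]
  exact LinearMap.finrank_le_finrank_of_injective h

theorem finrank_hom_comm (X Y : C) : Module.finrank ℂ (X ⟶ Y) = Module.finrank ℂ (Y ⟶ X) :=
  le_antisymm (finrank_hom_le Y X) (finrank_hom_le X Y)

variable {K : CombinatorialComplex Λ} [Finite Λ] [LinearOrder Λ]

open CombinatorialComplex

/-- The operator whose trace is the partition function for given objects on the triangles. -/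
def stateSumOperator (V : Λ → Λ → Λ → C) (ω : K.Orientation) :
    (⨂[ℂ] t : K.SortedSimplex 3, StateSpace V t.1) →ₗ[ℂ]
      (⨂[ℂ] t : K.SortedSimplex 3, StateSpace V t.1) :=
  (regroup V ω 1).symm.toLinearMap ∘ₗ
    PiTensorProduct.map (fun s : K.SortedSimplex 4 => simplexMap V s.1 (ω.sign s.1)) ∘ₗ
      (regroup V ω (-1)).toLinearMap

/-- A family indexed by tetrahedra, restricted to the faces of a `4`-simplex. -/
def faceFamily {V : Λ → Λ → Λ → C} (m : ∀ t : K.SortedSimplex 3, StateSpace V t.1)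
    (s : K.SortedSimplex 4) (j : Fin 5) : StateSpace V fun i => s.1 (j.succAbove i) :=
  m (face s j)

/-- `faceFamily` for dual states. -/
def dualFaceFamily {V : Λ → Λ → Λ → C} (n : ∀ t : K.SortedSimplex 3, DualStateSpace V t.1)
    (s : K.SortedSimplex 4) (j : Fin 5) : DualStateSpace V fun i => s.1 (j.succAbove i) :=
  n (face s j)

theorem regroup_tprod (V : Λ → Λ → Λ → C) (ω : K.Orientation) (d : ℤˣ)
    (m : ∀ t : K.SortedSimplex 3, StateSpace V t.1) :
    regroup V ω d (PiTensorProduct.tprod ℂ m) =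
      PiTensorProduct.tprod ℂ fun s : K.SortedSimplex 4 =>
        PiTensorProduct.tprod ℂ fun j : FacePos (ω.sign s.1) d => faceFamily m s j.1 := by
  have := AdmissibleRibbonCategory.finite_hom (C := C)
  have h := PiTensorProduct.reindex_tprod (R := ℂ)
    (s := fun t : K.SortedSimplex 3 => StateSpace V t.1) (faceEquiv ω d).symm m
  exact (congrArg (sigmaTensorEquiv (S := K.SortedSimplex 4) (J := fun s => FacePos (ω.sign s.1) d)
      (H := fun s j => StateSpace V fun i => s.1 (j.1.succAbove i))) h).trans
    (PiTensorProduct.lift.tprod _)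

variable [Fintype (K.SortedSimplex 3)] [Fintype (K.SortedSimplex 4)]

/-- On pure tensors this regroups a product over tetrahedra along `faceEquiv`: each one is a
positive face of exactly one `4`-simplex. -/
theorem pairingProd_regroup (V : Λ → Λ → Λ → C) (ω : K.Orientation)
    (n : ∀ t : K.SortedSimplex 3, DualStateSpace V t.1)
    (w : ∀ s : K.SortedSimplex 4, ⨂[ℂ] j : FacePos (ω.sign s.1) 1,
        StateSpace V fun i => s.1 (j.1.succAbove i)) :
    pairingProd (fun t : K.SortedSimplex 3 => statePairing V t.1) n
        ((regroup V ω 1).symm (PiTensorProduct.tprod ℂ w)) =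
      ∏ s, pairingProd (fun j : FacePos (ω.sign s.1) 1 => statePairing V fun i =>
        s.1 (j.1.succAbove i)) (fun j => dualFaceFamily n s j.1) (w s) := by
  let φ := fun s : K.SortedSimplex 4 => pairingProd (fun j : FacePos (ω.sign s.1) 1 =>
    statePairing V fun i => s.1 (j.1.succAbove i)) (fun j => dualFaceFamily n s j.1)
  have h : pairingProd (fun t : K.SortedSimplex 3 => statePairing V t.1) n =
      prodForm φ ∘ₗ (regroup V ω 1).toLinearMap := by
    ext m
    rw [LinearMap.compMultilinearMap_apply, LinearMap.compMultilinearMap_apply,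
      LinearMap.comp_apply, LinearEquiv.coe_coe, regroup_tprod, pairingProd_tprod, prodForm_tprod]
    simp only [φ, pairingProd_tprod]
    rw [← Equiv.prod_comp (faceEquiv ω 1), Fintype.prod_sigma]
    rfl
  rw [h, LinearMap.comp_apply, LinearEquiv.coe_coe, LinearEquiv.apply_symm_apply, prodForm_tprod]

/-- A diagonal matrix entry is extracted by pairing with the tensor of dual basis vectors, and this
pairing factors over the `4`-simplices. Each label `k t` enters twice: as a state where `t` is a
negative face, as a costate where it is a positive one. The freedom in the choice of `z` is what
makes the two orders comparable. -/
theorem trace_stateSumOperator (V : Λ → Λ → Λ → C) (ω : K.Orientation)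
    {I : K.SortedSimplex 3 → Type} [∀ t, Fintype (I t)] [∀ t, DecidableEq (I t)]
    (z : ∀ t, I t → StateSpace V t.1 × CoStateSpace V t.1)
    (hz : ∀ t, IsDualFamily (z t)) [DecidableEq (K.SortedSimplex 3)] :
    LinearMap.trace ℂ _ (stateSumOperator V ω) =
      ∑ k : ∀ t, I t, ∏ s : K.SortedSimplex 4, amplitude V s.1 (ω.sign s.1)
        fun j => z (face s j) (k (face s j)) := by
  have := AdmissibleRibbonCategory.finite_hom (C := C)
  choose b hb using fun t => (hz t).exists_basis
  rw [LinearMap.trace_eq_matrix_trace ℂ (Basis.piTensorProduct b), Matrix.trace]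
  refine Finset.sum_congr rfl fun k _ => ?_
  rw [Matrix.diag_apply, LinearMap.toMatrix_apply]
  let n : ∀ t : K.SortedSimplex 3, DualStateSpace V t.1 :=
    fun t => (dualStateEquiv V t.1).symm (z t (k t)).2
  -- A product of Kronecker deltas is the delta of the whole labelling.
  have hcoord : pairingProd (fun t : K.SortedSimplex 3 => statePairing V t.1) n =
      (Basis.piTensorProduct b).coord k := by
    refine (Basis.piTensorProduct b).ext fun l => ?_
    rw [Module.Basis.coord_apply, Module.Basis.repr_self, Basis.piTensorProduct_apply,
      pairingProd_tprod]
    simp only [n, statePairing_apply, LinearEquiv.apply_symm_apply, hb, (hz _).dual,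
      Finsupp.single_apply]
    rw [Finset.prod_ite_zero]
    by_cases h : l = k
    · simp [h]
    · rw [if_neg h, if_neg fun h' => h (funext fun t => h' t (Finset.mem_univ t))]
  rw [← Module.Basis.coord_apply, ← hcoord, Basis.piTensorProduct_apply, stateSumOperator,
    LinearMap.comp_apply, LinearMap.comp_apply, LinearEquiv.coe_coe, LinearEquiv.coe_coe,
    regroup_tprod, PiTensorProduct.map_tprod, pairingProd_regroup]
  refine Finset.prod_congr rfl fun s _ => ?_
  rw [simplexMap_spec]
  rw [quantumTraceForm_apply V s.1 (ω.sign s.1) (faceFamily (fun t => b t (k t)) s)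
    (dualFaceFamily n s), quantumTrace_eq_amplitude]
  congr 1
  funext j
  exact Prod.ext (hb _ _) (LinearEquiv.apply_symm_apply _ _)

end TraceFormula


/-! ### The two moves on pairs of a state and a costate -/

section HomPair

variable {C : Type u} [Category.{v} C] [MonoidalCategory C] [BraidedCategory C]
  [RightRigidCategory C] [RibbonCategory C]

open ExactPairing

variable {A A' B B' D D' E E' : C}

/-- Transport of a pair of morphisms along equalities of objects. -/
def castPair (hA : A' = A) (hB : B' = B) (hD : D' = D) (hE : E' = E) (z : HomPair A B D E) :
    HomPair A' B' D' E' :=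
  cast (by rw [hA, hB, hD, hE]) z

/-- The effect on states of a cyclic rotation of the vertices of a tetrahedron. -/
def rotatePair (z : HomPair A B D E) : HomPair D E B A :=
  (z.2 ≫ (β_ B A).inv, (β_ B A).hom ≫ z.1)

/-- The effect on states of a transposition of the first two vertices of a tetrahedron. -/
def bendPair (p : ExactPairing D D') (q : ExactPairing B B') (z : HomPair A B D E) :
    HomPair E B' D' A :=
  (revBend D' B' z.2, unbend D' B' z.1)

variable {V₀₁₂ V₀₁₃ V₀₁₄ V₀₂₃ V₀₂₄ V₀₃₄ V₁₂₃ V₁₂₄ V₁₃₄ V₂₃₄ : C}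
  {W₀₁₂ W₀₁₃ W₀₁₄ W₀₂₃ W₀₂₄ W₀₃₄ W₁₂₃ W₁₂₄ W₁₃₄ W₂₃₄ : C}

/-- The objects for two vertex orders agree only propositionally. Stating the diagram identities
with ten independent objects confines all casts to a substitution. -/
theorem diagramTrace_cast (e : ℤˣ) (h₀₁₂ : W₀₁₂ = V₀₁₂) (h₀₁₃ : W₀₁₃ = V₀₁₃) (h₀₁₄ : W₀₁₄ = V₀₁₄)
    (h₀₂₃ : W₀₂₃ = V₀₂₃) (h₀₂₄ : W₀₂₄ = V₀₂₄) (h₀₃₄ : W₀₃₄ = V₀₃₄) (h₁₂₃ : W₁₂₃ = V₁₂₃)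
    (h₁₂₄ : W₁₂₄ = V₁₂₄) (h₁₃₄ : W₁₃₄ = V₁₃₄) (h₂₃₄ : W₂₃₄ = V₂₃₄)
    (z₁₂₃₄ : HomPair V₂₃₄ V₁₂₄ V₁₂₃ V₁₃₄) (z₀₂₃₄ : HomPair V₂₃₄ V₀₂₄ V₀₂₃ V₀₃₄)
    (z₀₁₃₄ : HomPair V₁₃₄ V₀₁₄ V₀₁₃ V₀₃₄) (z₀₁₂₄ : HomPair V₁₂₄ V₀₁₄ V₀₁₂ V₀₂₄)
    (z₀₁₂₃ : HomPair V₁₂₃ V₀₁₃ V₀₁₂ V₀₂₃) :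
    diagramTrace e (castPair h₂₃₄ h₁₂₄ h₁₂₃ h₁₃₄ z₁₂₃₄) (castPair h₂₃₄ h₀₂₄ h₀₂₃ h₀₃₄ z₀₂₃₄)
      (castPair h₁₃₄ h₀₁₄ h₀₁₃ h₀₃₄ z₀₁₃₄) (castPair h₁₂₄ h₀₁₄ h₀₁₂ h₀₂₄ z₀₁₂₄)
      (castPair h₁₂₃ h₀₁₃ h₀₁₂ h₀₂₃ z₀₁₂₃) =
    diagramTrace e z₁₂₃₄ z₀₂₃₄ z₀₁₃₄ z₀₁₂₄ z₀₁₂₃ := by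
  subst h₀₁₂ h₀₁₃ h₀₁₄ h₀₂₃ h₀₂₄ h₀₃₄ h₁₂₃ h₁₂₄ h₁₃₄ h₂₃₄
  rfl

/-- The new vertex `0` is the old vertex `4`, and the new `i + 1` is the old `i`. The new face `0`
lacks the moved vertex, so its pair is not rotated. -/
theorem diagramTrace_rotate (e : ℤˣ) (h₀₁₂ : W₀₁₂ = V₀₁₄) (h₀₁₃ : W₀₁₃ = V₀₂₄) (h₀₁₄ : W₀₁₄ = V₀₃₄)
    (h₀₂₃ : W₀₂₃ = V₁₂₄) (h₀₂₄ : W₀₂₄ = V₁₃₄) (h₀₃₄ : W₀₃₄ = V₂₃₄) (h₁₂₃ : W₁₂₃ = V₀₁₂)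
    (h₁₂₄ : W₁₂₄ = V₀₁₃) (h₁₃₄ : W₁₃₄ = V₀₂₃) (h₂₃₄ : W₂₃₄ = V₁₂₃)
    (z₁₂₃₄ : HomPair V₂₃₄ V₁₂₄ V₁₂₃ V₁₃₄) (z₀₂₃₄ : HomPair V₂₃₄ V₀₂₄ V₀₂₃ V₀₃₄)
    (z₀₁₃₄ : HomPair V₁₃₄ V₀₁₄ V₀₁₃ V₀₃₄) (z₀₁₂₄ : HomPair V₁₂₄ V₀₁₄ V₀₁₂ V₀₂₄)
    (z₀₁₂₃ : HomPair V₁₂₃ V₀₁₃ V₀₁₂ V₀₂₃) :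
    diagramTrace e (castPair h₂₃₄ h₁₂₄ h₁₂₃ h₁₃₄ z₀₁₂₃)
      (castPair h₂₃₄ h₀₂₄ h₀₂₃ h₀₃₄ (rotatePair z₁₂₃₄))
      (castPair h₁₃₄ h₀₁₄ h₀₁₃ h₀₃₄ (rotatePair z₀₂₃₄))
      (castPair h₁₂₄ h₀₁₄ h₀₁₂ h₀₂₄ (rotatePair z₀₁₃₄))
      (castPair h₁₂₃ h₀₁₃ h₀₁₂ h₀₂₃ (rotatePair z₀₁₂₄)) =
    diagramTrace e z₁₂₃₄ z₀₂₃₄ z₀₁₃₄ z₀₁₂₄ z₀₁₂₃ := by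
  subst h₀₁₂ h₀₁₃ h₀₁₄ h₀₂₃ h₀₂₄ h₀₃₄ h₁₂₃ h₁₂₄ h₁₃₄ h₂₃₄
  unfold diagramTrace
  split_ifs
  · exact qtr_posDiagram_rotate _ _ _ _ _
  · exact qtr_negDiagram_rotate _ _ _ _ _

/-- The transposition reverses the sign. Faces `0` and `1` each contain just one of the exchanged
vertices, so they trade places unbent; the other three are bent. -/
theorem diagramTrace_bend (e : ℤˣ) (p₀₁₂ : ExactPairing V₀₁₂ W₀₁₂) (p₀₁₃ : ExactPairing V₀₁₃ W₀₁₃)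
    (p₀₁₄ : ExactPairing V₀₁₄ W₀₁₄)
    (h₀₂₃ : W₀₂₃ = V₁₂₃) (h₀₂₄ : W₀₂₄ = V₁₂₄) (h₀₃₄ : W₀₃₄ = V₁₃₄) (h₁₂₃ : W₁₂₃ = V₀₂₃)
    (h₁₂₄ : W₁₂₄ = V₀₂₄) (h₁₃₄ : W₁₃₄ = V₀₃₄) (h₂₃₄ : W₂₃₄ = V₂₃₄)
    (z₁₂₃₄ : HomPair V₂₃₄ V₁₂₄ V₁₂₃ V₁₃₄) (z₀₂₃₄ : HomPair V₂₃₄ V₀₂₄ V₀₂₃ V₀₃₄)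
    (z₀₁₃₄ : HomPair V₁₃₄ V₀₁₄ V₀₁₃ V₀₃₄) (z₀₁₂₄ : HomPair V₁₂₄ V₀₁₄ V₀₁₂ V₀₂₄)
    (z₀₁₂₃ : HomPair V₁₂₃ V₀₁₃ V₀₁₂ V₀₂₃) :
    diagramTrace (-e) (castPair h₂₃₄ h₁₂₄ h₁₂₃ h₁₃₄ z₀₂₃₄) (castPair h₂₃₄ h₀₂₄ h₀₂₃ h₀₃₄ z₁₂₃₄)
      (castPair h₁₃₄ rfl rfl h₀₃₄ (bendPair p₀₁₃ p₀₁₄ z₀₁₃₄))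
      (castPair h₁₂₄ rfl rfl h₀₂₄ (bendPair p₀₁₂ p₀₁₄ z₀₁₂₄))
      (castPair h₁₂₃ rfl rfl h₀₂₃ (bendPair p₀₁₂ p₀₁₃ z₀₁₂₃)) =
    diagramTrace e z₁₂₃₄ z₀₂₃₄ z₀₁₃₄ z₀₁₂₄ z₀₁₂₃ := by
  subst h₀₂₃ h₀₂₄ h₀₃₄ h₁₂₃ h₁₂₄ h₁₃₄ h₂₃₄
  rcases Int.units_eq_one_or e with rfl | rfl
  · exact qtr_negDiagram_bend W₀₁₂ W₀₁₃ W₀₁₄ _ _ _ _ _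
  · exact qtr_posDiagram_bend W₀₁₂ W₀₁₃ W₀₁₄ _ _ _ _ _

end HomPair

/-! ### The two moves preserve dual bases -/

section DualFamily

variable {C : Type u} [Category.{v} C] [MonoidalCategory C] [BraidedCategory C]
  [RightRigidCategory C] [RibbonCategory C] [Preadditive C] [Linear ℂ C]
  [MonoidalPreadditive C] [MonoidalLinear ℂ C]

variable {A A' B B' D D' E E' : C} {I : Type} [Fintype I] [DecidableEq I]

theorem IsDualFamily.castPair [ScalarUnit C] (hA : A' = A) (hB : B' = B) (hD : D' = D)
    (hE : E' = E) {z : I → HomPair A B D E} (hz : IsDualFamily z) :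
    IsDualFamily fun k => castPair hA hB hD hE (z k) := by
  subst hA hB hD hE
  exact hz

/-- `bend` as a linear equivalence. -/
def bendLinearEquiv (U U' X X' B D : C) [ExactPairing U' U] [ExactPairing X' X] :
    (U ⊗ B ⟶ D ⊗ X) ≃ₗ[ℂ] (B ⊗ X' ⟶ U' ⊗ D) :=
  { bendEquiv U U' X X' B D with
    map_add' := fun f g => by simp [bendEquiv_apply, bend, monoidalComp]
    map_smul' := fun c f => by simp [bendEquiv_apply, bend, monoidalComp] }

variable [AdmissibleRibbonCategory C]

/-- State and costate change roles, so the two indices are exchanged in the biorthogonality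
relation. The braidings cancel in the composite and cyclicity does the rest. -/
theorem IsDualFamily.rotatePair {z : I → HomPair A B D E} (hz : IsDualFamily z) :
    IsDualFamily fun k => rotatePair (z k) where
  card := by
    rw [hz.card, finrank_hom_comm]
    exact (Linear.homCongr ℂ (Iso.refl (D ⊗ E)) (β_ B A).symm).finrank_eq
  dual k l := by
    have h : qtr ((SpinFoam.rotatePair (z l)).1 ≫ (SpinFoam.rotatePair (z k)).2) =
        qtr ((z k).1 ≫ (z l).2) := by
      rw [qtr_comp (z k).1]
      simp [SpinFoam.rotatePair]
    rw [h, hz.dual]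
    simp [eq_comm]

/-- Again the indices are exchanged; biorthogonality is the invariance `qtr_bend_comp_unbend`. -/
theorem IsDualFamily.bendPair (p : ExactPairing D D') (q : ExactPairing B B')
    {z : I → HomPair A B D E} (hz : IsDualFamily z) :
    IsDualFamily fun k => bendPair p q (z k) where
  card := by
    let _ := reversePairing D D'
    let _ := reversePairing B B'
    rw [hz.card, finrank_hom_comm]
    exact (bendLinearEquiv D D' B B' E A).finrank_eq
  dual k l := by
    have h : qtr ((SpinFoam.bendPair p q (z l)).1 ≫ (SpinFoam.bendPair p q (z k)).2) =
        qtr ((z k).1 ≫ (z l).2) := by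
      rw [qtr_comp (z k).1]
      exact qtr_bend_comp_unbend _ _
    rw [h, hz.dual]
    simp [eq_comm]

end DualFamily


open CombinatorialComplex

/-! ### Comparison of the state sums of two orders -/

section Transport

variable {C : Type u} [Category.{v} C] [MonoidalCategory C] [BraidedCategory C]
  [RightRigidCategory C] [RibbonCategory C] [Preadditive C] [Linear ℂ C]
  [MonoidalPreadditive C] [MonoidalLinear ℂ C] [AdmissibleRibbonCategory C]
variable {Λ : Type w} {K : CombinatorialComplex Λ}

/-- The `k`-simplices in the standard order with respect to `o`. -/
abbrev Simplex (K : CombinatorialComplex Λ) (k : ℕ) (o : LinearOrder Λ) : Type w :=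
  @SortedSimplex Λ K k o

/-- The face of a `4`-simplex sorted with respect to `o`. -/
abbrev faceOf {o : LinearOrder Λ} (s : Simplex K 4 o) (j : Fin 5) : Simplex K 3 o :=
  @face Λ K o s j

theorem Simplex.ext_range {k : ℕ} {o : LinearOrder Λ} {s t : Simplex K k o}
    (h : Set.range s.1 = Set.range t.1) : s = t :=
  Subtype.ext ((@StrictMono.range_inj _ _ _ o.toPartialOrder.toPreorder _ _ _ s.2.1 t.2.1).mp h)

/-- The same simplex with its vertices sorted with respect to another order. -/
def resort {k : ℕ} {o₁ o₂ : LinearOrder Λ} (s : Simplex K k o₂) : Simplex K k o₁ :=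
  ⟨s.1 ∘ @Tuple.sort _ _ o₁ s.1,
    @Monotone.strictMono_of_injective _ _ _ o₁.toPartialOrder _ (@Tuple.monotone_sort _ _ o₁ s.1)
      ((@StrictMono.injective _ _ _ o₂.toPartialOrder.toPreorder _ s.2.1).comp
        (Equiv.injective _)),
    by rw [(Equiv.surjective _).range_comp]; exact s.2.2⟩

theorem range_resort {k : ℕ} {o₁ o₂ : LinearOrder Λ} (s : Simplex K k o₂) :
    Set.range (resort (o₁ := o₁) s).1 = Set.range s.1 :=
  (Equiv.surjective _).range_comp _

theorem resort_eq {k : ℕ} {o₁ o₂ : LinearOrder Λ} {s : Simplex K k o₂} {t : Simplex K k o₁}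
    (h : Set.range s.1 = Set.range t.1) : resort s = t :=
  Simplex.ext_range ((range_resort s).trans h)

/-- `resort` as an equivalence. -/
def resortEquiv (K : CombinatorialComplex Λ) (k : ℕ) (o₁ o₂ : LinearOrder Λ) :
    Simplex K k o₂ ≃ Simplex K k o₁ where
  toFun := resort
  invFun := resort
  left_inv s := resort_eq (range_resort s)
  right_inv s := resort_eq (range_resort s)

theorem range_faceOf {o : LinearOrder Λ} (s : Simplex K 4 o) (j : Fin 5) :
    Set.range (faceOf s j).1 = Set.range s.1 \ {s.1 j} := by
  have h : Set.range (faceOf s j).1 = s.1 '' Set.range j.succAbove := by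
    rw [← Set.range_comp]; rfl
  rw [h, Fin.range_succAbove, Set.image_compl_eq_range_sdiff_image
    (@StrictMono.injective _ _ _ o.toPartialOrder.toPreorder _ s.2.1), Set.image_singleton]

theorem resort_faceOf {o₁ o₂ : LinearOrder Λ} (s : Simplex K 4 o₂) (i j : Fin 5)
    (h : (resort (o₁ := o₁) s).1 i = s.1 j) :
    resort (o₁ := o₁) (faceOf s j) = faceOf (resort s) i :=
  resort_eq (by rw [range_faceOf, range_faceOf, h, range_resort])

/-- The trace of the state sum operator for the order `o`. -/
def stateSum [Finite Λ] (o : LinearOrder Λ) (V : Λ → Λ → Λ → C) (ω : K.Orientation) : ℂ :=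
  LinearMap.trace ℂ _ (stateSumOperator V ω)

/-- Dual families chosen for `o₁` and transported by `Θ` compute the state sum for `o₂`. The label
sets are unchanged, so the two expansions match term by term once simplices are identified by
resorting. -/
theorem stateSum_eq_of_transport [Finite Λ] {o₁ o₂ : LinearOrder Λ} (V₁ V₂ : Λ → Λ → Λ → C)
    (ω : K.Orientation)
    (Θ : ∀ t : Simplex K 3 o₂, StateSpace V₁ (resort (o₁ := o₁) t).1 ×
      CoStateSpace V₁ (resort (o₁ := o₁) t).1 → StateSpace V₂ t.1 × CoStateSpace V₂ t.1)
    (hΘ : ∀ t (n : ℕ) (z : Fin n → _), IsDualFamily z → IsDualFamily fun k => Θ t (z k))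
    (hamp : ∀ (Z : ∀ t : Simplex K 3 o₁, StateSpace V₁ t.1 × CoStateSpace V₁ t.1)
      (s : Simplex K 4 o₂),
      amplitude V₂ s.1 (ω.sign s.1) (fun j => Θ (faceOf s j) (Z (resort (faceOf s j)))) =
        amplitude V₁ (resort (o₁ := o₁) s).1 (ω.sign (resort (o₁ := o₁) s).1)
          fun j => Z (faceOf (resort s) j)) :
    stateSum o₂ V₂ ω = stateSum o₁ V₁ ω := by
  classical
  have : ∀ k o, Fintype (Simplex K k o) := fun k o => Fintype.ofFinite _
  choose z hz using fun t : Simplex K 3 o₁ => exists_isDualFamily V₁ t.1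
  rw [stateSum, stateSum, @trace_stateSumOperator C _ _ _ _ _ _ _ _ _ _ Λ K _ o₁ _ _ V₁ ω _ _ _ z hz _,
    @trace_stateSumOperator C _ _ _ _ _ _ _ _ _ _ Λ K _ o₂ _ _ V₂ ω _ _ _
      (fun t k => Θ t (z (resort t) k)) (fun t => hΘ t _ _ (hz _)) _]
  refine (Fintype.sum_equiv (Equiv.piCongrLeft
    (fun t : Simplex K 3 o₁ => Fin (Module.finrank ℂ (StateSpace V₁ t.1)))
    (resortEquiv K 3 o₁ o₂)).symm _ _ fun k => ?_).symm
  exact (Fintype.prod_equiv (resortEquiv K 4 o₁ o₂) _ _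
    fun s => hamp (fun t => z t (k t)) s).symm

end Transport


open CombinatorialComplex

/-! ### First move: the maximal vertex becomes minimal -/

section Rotation

variable {C : Type u} [Category.{v} C] [MonoidalCategory C] [BraidedCategory C]
  [RightRigidCategory C] [RibbonCategory C]

theorem diagramTrace_congr (e : ℤˣ) {V₀₁₂ V₀₁₃ V₀₁₄ V₀₂₃ V₀₂₄ V₀₃₄ V₁₂₃ V₁₂₄ V₁₃₄ V₂₃₄ : C}
    {z₁₂₃₄ z₁₂₃₄' : HomPair V₂₃₄ V₁₂₄ V₁₂₃ V₁₃₄} {z₀₂₃₄ z₀₂₃₄' : HomPair V₂₃₄ V₀₂₄ V₀₂₃ V₀₃₄}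
    {z₀₁₃₄ z₀₁₃₄' : HomPair V₁₃₄ V₀₁₄ V₀₁₃ V₀₃₄} {z₀₁₂₄ z₀₁₂₄' : HomPair V₁₂₄ V₀₁₄ V₀₁₂ V₀₂₄}
    {z₀₁₂₃ z₀₁₂₃' : HomPair V₁₂₃ V₀₁₃ V₀₁₂ V₀₂₃} (h₀ : z₁₂₃₄ = z₁₂₃₄') (h₁ : z₀₂₃₄ = z₀₂₃₄')
    (h₂ : z₀₁₃₄ = z₀₁₃₄') (h₃ : z₀₁₂₄ = z₀₁₂₄') (h₄ : z₀₁₂₃ = z₀₁₂₃') :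
    diagramTrace e z₁₂₃₄ z₀₂₃₄ z₀₁₃₄ z₀₁₂₄ z₀₁₂₃ =
      diagramTrace e z₁₂₃₄' z₀₂₃₄' z₀₁₃₄' z₀₁₂₄' z₀₁₂₃' := by
  rw [h₀, h₁, h₂, h₃, h₄]

variable {Λ : Type w} {K : CombinatorialComplex Λ}

/-- A finite set has only one increasing enumeration, so the sorting permutation may be guessed and
verified. -/
theorem resort_val {k : ℕ} {o₁ o₂ : LinearOrder Λ} (s : Simplex K k o₂)
    (σ : Equiv.Perm (Fin (k + 1))) (h : ∀ i j, i < j → o₁.lt (s.1 (σ i)) (s.1 (σ j))) :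
    (resort (o₁ := o₁) s).1 = s.1 ∘ σ := by
  rw [resort_eq (t := ⟨s.1 ∘ σ, fun i j hij => h i j hij, by
    rw [(Equiv.surjective _).range_comp]; exact s.2.2⟩)]
  rw [(Equiv.surjective σ).range_comp]

theorem Simplex.injective {k : ℕ} {o : LinearOrder Λ} (s : Simplex K k o) :
    Function.Injective s.1 :=
  @StrictMono.injective _ _ _ o.toPartialOrder.toPreorder _ s.2.1

theorem Simplex.lt {k : ℕ} {o : LinearOrder Λ} (s : Simplex K k o) {i j : Fin (k + 1)}
    (h : i < j) : o.lt (s.1 i) (s.1 j) :=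
  s.2.1 h

/-- The order `o₂` is obtained from `o₁` by turning the maximum `m` into the minimum. -/
structure IsRotation (o₁ o₂ : LinearOrder Λ) (m : Λ) : Prop where
  lt_max : ∀ a, a ≠ m → o₁.lt a m
  min_lt : ∀ a, a ≠ m → o₂.lt m a
  lt_of_lt : ∀ a b, a ≠ m → b ≠ m → o₂.lt a b → o₁.lt a b

variable {o₁ o₂ : LinearOrder Λ} {m : Λ}

theorem IsRotation.resort_first (h : IsRotation o₁ o₂ m) {k : ℕ} (s : Simplex K k o₂)
    (hs : s.1 0 = m) : (resort (o₁ := o₁) s).1 = s.1 ∘ finRotate (k + 1) := by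
  have hne : ∀ i : Fin k, s.1 i.succ ≠ m := fun i hi =>
    Fin.succ_ne_zero i (s.injective (hi.trans hs.symm))
  refine resort_val s _ fun i j hij => ?_
  induction j using Fin.lastCases with
  | last =>
    obtain ⟨i, rfl⟩ := Fin.exists_castSucc_eq.mpr hij.ne
    rw [finRotate_last, hs, finRotate_apply, Fin.coeSucc_eq_succ]
    exact h.lt_max _ (hne i)
  | cast j =>
    obtain ⟨i, rfl⟩ := Fin.exists_castSucc_eq.mpr (hij.trans (Fin.castSucc_lt_last j)).ne
    rw [finRotate_apply, finRotate_apply, Fin.coeSucc_eq_succ, Fin.coeSucc_eq_succ]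
    exact h.lt_of_lt _ _ (hne i) (hne j) (s.lt (Fin.succ_lt_succ_iff.mpr (by simpa using hij)))

theorem IsRotation.eq_zero (h : IsRotation o₁ o₂ m) {k : ℕ} (s : Simplex K k o₂)
    {i : Fin (k + 1)} (hi : s.1 i = m) : i = 0 := by
  by_contra h0
  have h1 := s.lt (Fin.pos_iff_ne_zero.mpr h0)
  rw [hi] at h1
  exact @lt_asymm _ o₂.toPartialOrder.toPreorder _ _ h1 (h.min_lt _ (@ne_of_lt _ o₂.toPartialOrder.toPreorder _ _ h1))

theorem IsRotation.resort_other (h : IsRotation o₁ o₂ m) {k : ℕ} (s : Simplex K k o₂)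
    (hs : s.1 0 ≠ m) : (resort (o₁ := o₁) s).1 = s.1 := by
  have hne : ∀ i, s.1 i ≠ m := fun i hi => hs (h.eq_zero s hi ▸ hi)
  exact resort_val s 1 fun i j hij => h.lt_of_lt _ _ (hne _) (hne _) (s.lt hij)

variable [Preadditive C] [Linear ℂ C] [MonoidalPreadditive C] [MonoidalLinear ℂ C]
  [AdmissibleRibbonCategory C]

/-- States and costates at `t`, for the rotated order, in terms of those for the original order. -/
def IsRotation.transport (h : IsRotation o₁ o₂ m) (V : Λ → Λ → Λ → C)
    (hV : ∀ a b c, V a b c = V b c a) (t : Simplex K 3 o₂)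
    (z : StateSpace V (resort (o₁ := o₁) t).1 × CoStateSpace V (resort (o₁ := o₁) t).1) :
    StateSpace V t.1 × CoStateSpace V t.1 :=
  open scoped Classical in
  if ht : t.1 0 = m then
    castPair (by rw [h.resort_first t ht]; rfl) (by rw [h.resort_first t ht]; exact hV _ _ _)
      (by rw [h.resort_first t ht]; exact hV _ _ _) (by rw [h.resort_first t ht]; exact hV _ _ _)
      (rotatePair z)
  else
    castPair (by rw [h.resort_other t ht]) (by rw [h.resort_other t ht])
      (by rw [h.resort_other t ht]) (by rw [h.resort_other t ht]) z

/-- Keeping `u` as a variable and the object equalities as arbitrary proofs allows use at faces,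
where `resort t` is only propositionally a face of the resorted simplex. -/
theorem IsRotation.transport_first (h : IsRotation o₁ o₂ m) (V : Λ → Λ → Λ → C)
    (hV : ∀ a b c, V a b c = V b c a)
    (Z : ∀ t : Simplex K 3 o₁, StateSpace V t.1 × CoStateSpace V t.1)
    (t : Simplex K 3 o₂) (u : Simplex K 3 o₁) (hu : resort t = u) (ht : t.1 0 = m)
    (h₁ : V (t.1 1) (t.1 2) (t.1 3) = V (u.1 0) (u.1 1) (u.1 2))
    (h₂ : V (t.1 0) (t.1 1) (t.1 3) = V (u.1 0) (u.1 2) (u.1 3))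
    (h₃ : V (t.1 0) (t.1 1) (t.1 2) = V (u.1 0) (u.1 1) (u.1 3))
    (h₄ : V (t.1 0) (t.1 2) (t.1 3) = V (u.1 1) (u.1 2) (u.1 3)) :
    h.transport V hV t (Z (resort t)) = castPair h₁ h₂ h₃ h₄ (rotatePair (Z u)) := by
  subst hu
  rw [IsRotation.transport, dif_pos ht]

theorem IsRotation.transport_other (h : IsRotation o₁ o₂ m) (V : Λ → Λ → Λ → C)
    (hV : ∀ a b c, V a b c = V b c a)
    (Z : ∀ t : Simplex K 3 o₁, StateSpace V t.1 × CoStateSpace V t.1)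
    (t : Simplex K 3 o₂) (u : Simplex K 3 o₁) (hu : resort t = u) (ht : t.1 0 ≠ m)
    (h₁ : V (t.1 1) (t.1 2) (t.1 3) = V (u.1 1) (u.1 2) (u.1 3))
    (h₂ : V (t.1 0) (t.1 1) (t.1 3) = V (u.1 0) (u.1 1) (u.1 3))
    (h₃ : V (t.1 0) (t.1 1) (t.1 2) = V (u.1 0) (u.1 1) (u.1 2))
    (h₄ : V (t.1 0) (t.1 2) (t.1 3) = V (u.1 0) (u.1 2) (u.1 3)) :
    h.transport V hV t (Z (resort t)) = castPair h₁ h₂ h₃ h₄ (Z u) := by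
  subst hu
  rw [IsRotation.transport, dif_neg ht]

theorem stateSum_rotate [Finite Λ] (h : IsRotation o₁ o₂ m) (V : Λ → Λ → Λ → C)
    (hV : ∀ a b c, V a b c = V b c a) (ω : K.Orientation) :
    stateSum o₂ V ω = stateSum o₁ V ω := by
  refine stateSum_eq_of_transport V V ω (h.transport V hV) (fun t n z hz => ?_) fun Z s => ?_
  · by_cases ht : t.1 0 = m
    · simp only [IsRotation.transport, dif_pos ht]
      exact (hz.rotatePair).castPair _ _ _ _
    · simp only [IsRotation.transport, dif_neg ht]
      exact hz.castPair _ _ _ _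
  · by_cases hs : s.1 0 = m
    · have hr := h.resort_first s hs
      -- A cycle on five vertices is even.
      have hsign : ω.sign s.1 = ω.sign (resort (o₁ := o₁) s).1 := by
        rw [hr, ω.alternating s.1 ⟨s.injective, s.2.2⟩, sign_finRotate]
        norm_num
      have hi : ∀ i, (resort (o₁ := o₁) s).1 i = s.1 (i + 1) := fun i => by
        rw [hr, Function.comp_apply, finRotate_apply]
      have hne : s.1 1 ≠ m := fun h' => absurd (s.injective (h'.trans hs.symm)) (by decide)
      have hW : ∀ i j k, V (s.1 i) (s.1 j) (s.1 k) = V ((resort (o₁ := o₁) s).1 (i - 1))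
          ((resort (o₁ := o₁) s).1 (j - 1)) ((resort (o₁ := o₁) s).1 (k - 1)) := fun i j k => by
        rw [hi, hi, hi, sub_add_cancel, sub_add_cancel, sub_add_cancel]
      rw [hsign]
      refine congrArg (scalar C) ((diagramTrace_congr _
        (h.transport_other V hV Z (faceOf s 0) (faceOf (resort s) 4) ?_ hne ?_ ?_ ?_ ?_)
        (h.transport_first V hV Z (faceOf s 1) (faceOf (resort s) 0) ?_ hs ?_ ?_ ?_ ?_)
        (h.transport_first V hV Z (faceOf s 2) (faceOf (resort s) 1) ?_ hs ?_ ?_ ?_ ?_)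
        (h.transport_first V hV Z (faceOf s 3) (faceOf (resort s) 2) ?_ hs ?_ ?_ ?_ ?_)
        (h.transport_first V hV Z (faceOf s 4) (faceOf (resort s) 3) ?_ hs ?_ ?_ ?_ ?_)).trans
        (diagramTrace_rotate _ ?_ ?_ ?_ ?_ ?_ ?_ ?_ ?_ ?_ ?_ _ _ _ _ _))
      -- The goals are identifications of faces, and equalities of objects which hold either
      -- directly or after a cyclic shift moving `m` from first to last place.
      all_goals first
        | exact resort_faceOf s _ _ (hi _)
        | exact hW _ _ _
        | exact (hV _ _ _).trans (hW _ _ _)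
    · have hr := h.resort_other s hs
      have hi : ∀ i, (resort (o₁ := o₁) s).1 i = s.1 i := fun i => congrFun hr i
      have hW : ∀ i j k, V (s.1 i) (s.1 j) (s.1 k) = V ((resort (o₁ := o₁) s).1 i)
          ((resort (o₁ := o₁) s).1 j) ((resort (o₁ := o₁) s).1 k) := fun i j k => by
        rw [hi, hi, hi]
      have hne : ∀ i, s.1 i ≠ m := fun i hi' => hs (h.eq_zero s hi' ▸ hi')
      have hsign : ω.sign s.1 = ω.sign (resort (o₁ := o₁) s).1 := by rw [hr]
      rw [hsign]
      refine congrArg (scalar C) ((diagramTrace_congr _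
        (h.transport_other V hV Z (faceOf s 0) (faceOf (resort s) 0) ?_ (hne _) ?_ ?_ ?_ ?_)
        (h.transport_other V hV Z (faceOf s 1) (faceOf (resort s) 1) ?_ (hne _) ?_ ?_ ?_ ?_)
        (h.transport_other V hV Z (faceOf s 2) (faceOf (resort s) 2) ?_ (hne _) ?_ ?_ ?_ ?_)
        (h.transport_other V hV Z (faceOf s 3) (faceOf (resort s) 3) ?_ (hne _) ?_ ?_ ?_ ?_)
        (h.transport_other V hV Z (faceOf s 4) (faceOf (resort s) 4) ?_ (hne _) ?_ ?_ ?_ ?_)).trans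
        (diagramTrace_cast _ ?_ ?_ ?_ ?_ ?_ ?_ ?_ ?_ ?_ ?_ _ _ _ _ _))
      all_goals first
        | exact resort_faceOf s _ _ (hi _)
        | exact hW _ _ _

end Rotation


open CombinatorialComplex

/-! ### Second move: exchange of the two smallest vertices -/

section Swap

variable {C : Type u} [Category.{v} C] [MonoidalCategory C] [BraidedCategory C]
  [RightRigidCategory C] [RibbonCategory C]

variable {Λ : Type w} {K : CombinatorialComplex Λ}

/-- The two smallest elements are `p < q` for the order `o₁` and `q < p` for the order `o₂`, which
agree otherwise. -/
structure IsSwap (o₁ o₂ : LinearOrder Λ) (p q : Λ) : Prop where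
  lt₁ : o₁.lt p q
  lt₂ : o₂.lt q p
  left₁ : ∀ a, a ≠ p → a ≠ q → o₁.lt p a
  right₁ : ∀ a, a ≠ p → a ≠ q → o₁.lt q a
  left₂ : ∀ a, a ≠ p → a ≠ q → o₂.lt p a
  right₂ : ∀ a, a ≠ p → a ≠ q → o₂.lt q a
  lt_of_lt : ∀ a b, a ≠ p → a ≠ q → b ≠ p → b ≠ q → o₂.lt a b → o₁.lt a b

variable {o₁ o₂ : LinearOrder Λ} {p q : Λ}

theorem IsSwap.ne (h : IsSwap o₁ o₂ p q) : p ≠ q :=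
  @ne_of_lt _ o₁.toPartialOrder.toPreorder _ _ h.lt₁

theorem IsSwap.eq_of_lt_right (h : IsSwap o₁ o₂ p q) {a : Λ} (ha : ¬ o₂.lt q a) : a = q := by
  by_contra haq
  by_cases hap : a = p
  · exact ha (hap ▸ h.lt₂)
  · exact ha (h.right₂ a hap haq)

/-- The comparison of `q` with `p` is the only one that differs between the orders. -/
theorem IsSwap.lt_of_lt' (h : IsSwap o₁ o₂ p q) {a b : Λ} (hab : o₂.lt a b)
    (hqp : ¬ (a = q ∧ b = p)) : o₁.lt a b := by
  have hasymm := fun x y => @lt_asymm _ o₂.toPartialOrder.toPreorder x y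
  have hne : a ≠ b := @ne_of_lt _ o₂.toPartialOrder.toPreorder _ _ hab
  have hpq := h.ne
  by_cases hbq : b = q
  · subst hbq
    exact absurd (h.eq_of_lt_right (hasymm _ _ hab)) hne
  by_cases haq : a = q
  · subst haq
    exact h.right₁ b (fun hb => hqp ⟨rfl, hb⟩) hbq
  by_cases hap : a = p
  · subst hap
    exact h.left₁ b hne.symm hbq
  by_cases hbp : b = p
  · subst hbp
    exact absurd hab (hasymm _ _ (h.left₂ a hap haq))
  exact h.lt_of_lt a b hap haq hbp hbq hab

/-- Nothing lies below or between `q` and `p` in `o₂`, so a simplex containing both starts with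
them. -/
theorem IsSwap.first_two (h : IsSwap o₁ o₂ p q) {k : ℕ} (s : Simplex K (k + 1) o₂)
    {i j : Fin (k + 2)} (hi : s.1 i = q) (hj : s.1 j = p) : s.1 0 = q ∧ s.1 1 = p := by
  have hasymm := fun x y => @lt_asymm _ o₂.toPartialOrder.toPreorder x y
  have h0 : s.1 0 = q := by
    refine h.eq_of_lt_right fun hlt => ?_
    by_cases hi0 : i = 0
    · rw [← hi0, hi] at hlt
      exact hasymm _ _ hlt hlt
    · exact hasymm _ _ (hi ▸ s.lt (Fin.pos_iff_ne_zero.mpr hi0)) hlt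
  refine ⟨h0, ?_⟩
  by_contra h1
  have hj0 : j ≠ 0 := by
    rintro rfl
    exact h.ne (hj.symm.trans h0)
  have hj1 : j ≠ 1 := by
    rintro rfl
    exact h1 hj
  have h1j : (1 : Fin (k + 2)) < j := by
    rw [Fin.lt_def, Fin.val_one]
    have := Fin.val_ne_of_ne hj0
    have := Fin.val_ne_of_ne hj1
    rw [Fin.val_zero] at *
    rw [Fin.val_one] at *
    omega
  have h1q : s.1 1 ≠ q := fun h' =>
    absurd (s.injective (h'.trans h0.symm)) (by simp)
  exact hasymm _ _ (hj ▸ s.lt h1j) (h.left₂ _ h1 h1q)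

theorem IsSwap.resort_both (h : IsSwap o₁ o₂ p q) {k : ℕ} (s : Simplex K (k + 1) o₂)
    (hs : s.1 0 = q ∧ s.1 1 = p) :
    (resort (o₁ := o₁) s).1 = s.1 ∘ Equiv.swap 0 1 := by
  have hp : ∀ i : Fin k, s.1 i.succ.succ ≠ p := fun i hi =>
    absurd (s.injective (hi.trans hs.2.symm)) (by simp [Fin.ext_iff])
  have hq : ∀ i : Fin k, s.1 i.succ.succ ≠ q := fun i hi =>
    absurd (s.injective (hi.trans hs.1.symm)) (by simp [Fin.ext_iff])
  have hsw : ∀ i : Fin k, Equiv.swap (0 : Fin (k + 2)) 1 i.succ.succ = i.succ.succ := fun i =>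
    Equiv.swap_apply_of_ne_of_ne (by simp [Fin.ext_iff]) (by simp [Fin.ext_iff])
  refine resort_val s _ fun i j hij => ?_
  induction i using Fin.cases with
  | zero =>
    rw [Equiv.swap_apply_left, hs.2]
    induction j using Fin.cases with
    | zero => exact absurd hij (lt_irrefl _)
    | succ j =>
      induction j using Fin.cases with
      | zero =>
        rw [Fin.succ_zero_eq_one, Equiv.swap_apply_right, hs.1]
        exact h.lt₁
      | succ j =>
        rw [hsw]
        exact h.left₁ _ (hp j) (hq j)
  | succ i =>
    obtain ⟨j, rfl⟩ := Fin.exists_succ_eq.mpr (hij.trans' (Fin.succ_pos i)).ne'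
    obtain ⟨j, rfl⟩ := Fin.exists_succ_eq.mpr
      ((Fin.zero_le i).trans_lt (Fin.succ_lt_succ_iff.mp hij)).ne'
    rw [hsw]
    induction i using Fin.cases with
    | zero =>
      rw [Fin.succ_zero_eq_one, Equiv.swap_apply_right, hs.1]
      exact h.right₁ _ (hp j) (hq j)
    | succ i =>
      rw [hsw]
      exact h.lt_of_lt _ _ (hp i) (hq i) (hp j) (hq j) (s.lt hij)

theorem IsSwap.resort_other (h : IsSwap o₁ o₂ p q) {k : ℕ} (s : Simplex K (k + 1) o₂)
    (hs : ¬ (s.1 0 = q ∧ s.1 1 = p)) : (resort (o₁ := o₁) s).1 = s.1 :=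
  resort_val s 1 fun _ _ hij => h.lt_of_lt' (s.lt hij) fun h' => hs (h.first_two s h'.1 h'.2)

/-- Transport of duality data along equalities of vertices. -/
@[reducible]
def castPairing {V₁ V₂ : Λ → Λ → Λ → C}
    (E : ∀ c, ExactPairing (V₁ p q c) (V₂ q p c)) {a b a' b' c c' : Λ} (ha : a = p) (hb : b = q)
    (ha' : a' = q) (hb' : b' = p) (hc : c' = c) : ExactPairing (V₁ a b c) (V₂ a' b' c') :=
  cast (by rw [ha, hb, ha', hb', hc]) (E c)

variable [Preadditive C] [Linear ℂ C] [MonoidalPreadditive C] [MonoidalLinear ℂ C]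
  [AdmissibleRibbonCategory C] {V₁ V₂ : Λ → Λ → Λ → C}

/-- The index condition says that the triple omits `q`, at position `0`, or `p`, at position `1`;
such triangles keep their objects. -/
theorem IsSwap.obj_eq_of_both (h : IsSwap o₁ o₂ p q)
    (hV : ∀ a b c, ¬ (p ∈ ({a, b, c} : Set Λ) ∧ q ∈ ({a, b, c} : Set Λ)) → V₂ a b c = V₁ a b c)
    {n : ℕ} (s : Simplex K (n + 1) o₂) (hs : s.1 0 = q ∧ s.1 1 = p) (i j k : Fin (n + 2))
    (hijk : (i ≠ 0 ∧ j ≠ 0 ∧ k ≠ 0) ∨ (i ≠ 1 ∧ j ≠ 1 ∧ k ≠ 1)) :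
    V₂ (s.1 i) (s.1 j) (s.1 k) = V₁ ((resort (o₁ := o₁) s).1 (Equiv.swap 0 1 i))
      ((resort (o₁ := o₁) s).1 (Equiv.swap 0 1 j)) ((resort (o₁ := o₁) s).1 (Equiv.swap 0 1 k)) := by
  rw [h.resort_both s hs]
  simp only [Function.comp_apply, Equiv.swap_apply_self]
  refine hV _ _ _ ?_
  rw [← hs.1, ← hs.2]
  simp only [Set.mem_insert_iff, Set.mem_singleton_iff, s.injective.eq_iff]
  grind

theorem IsSwap.obj_eq_of_not_both (h : IsSwap o₁ o₂ p q)
    (hV : ∀ a b c, ¬ (p ∈ ({a, b, c} : Set Λ) ∧ q ∈ ({a, b, c} : Set Λ)) → V₂ a b c = V₁ a b c)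
    {n : ℕ} (s : Simplex K (n + 1) o₂) (hs : ¬ (s.1 0 = q ∧ s.1 1 = p)) (i j k : Fin (n + 2)) :
    V₂ (s.1 i) (s.1 j) (s.1 k) = V₁ ((resort (o₁ := o₁) s).1 i)
      ((resort (o₁ := o₁) s).1 j) ((resort (o₁ := o₁) s).1 k) := by
  rw [h.resort_other s hs]
  refine hV _ _ _ fun h' => hs ?_
  have hmem : ∀ a ∈ ({s.1 i, s.1 j, s.1 k} : Set Λ), ∃ l, s.1 l = a := by
    rintro a (rfl | rfl | rfl) <;> exact ⟨_, rfl⟩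
  obtain ⟨l, hl⟩ := hmem _ h'.1
  obtain ⟨l', hl'⟩ := hmem _ h'.2
  exact h.first_two s hl' hl

theorem IsSwap.resort_apply (h : IsSwap o₁ o₂ p q) {n : ℕ} (s : Simplex K (n + 1) o₂)
    (hs : s.1 0 = q ∧ s.1 1 = p) (i : Fin (n + 2)) :
    (resort (o₁ := o₁) s).1 i = s.1 (Equiv.swap 0 1 i) := by
  rw [h.resort_both s hs, Function.comp_apply]

/-- States and costates at `t`, for the order `o₂`, in terms of those for the order `o₁`. -/
def IsSwap.transport (h : IsSwap o₁ o₂ p q) (E : ∀ c, ExactPairing (V₁ p q c) (V₂ q p c))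
    (hV : ∀ a b c, ¬ (p ∈ ({a, b, c} : Set Λ) ∧ q ∈ ({a, b, c} : Set Λ)) → V₂ a b c = V₁ a b c)
    (t : Simplex K 3 o₂)
    (z : StateSpace V₁ (resort (o₁ := o₁) t).1 × CoStateSpace V₁ (resort (o₁ := o₁) t).1) :
    StateSpace V₂ t.1 × CoStateSpace V₂ t.1 :=
  open scoped Classical in
  if ht : t.1 0 = q ∧ t.1 1 = p then
    castPair (h.obj_eq_of_both hV t ht 1 2 3 (by decide)) rfl rfl
      (h.obj_eq_of_both hV t ht 0 2 3 (by decide)) (bendPair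
        (castPairing E ((h.resort_apply t ht 0).trans ht.2) ((h.resort_apply t ht 1).trans ht.1)
          ht.1 ht.2 (h.resort_apply t ht 2).symm)
        (castPairing E ((h.resort_apply t ht 0).trans ht.2) ((h.resort_apply t ht 1).trans ht.1)
          ht.1 ht.2 (h.resort_apply t ht 3).symm) z)
  else
    castPair (h.obj_eq_of_not_both hV t ht _ _ _) (h.obj_eq_of_not_both hV t ht _ _ _)
      (h.obj_eq_of_not_both hV t ht _ _ _) (h.obj_eq_of_not_both hV t ht _ _ _) z

theorem IsSwap.transport_both (h : IsSwap o₁ o₂ p q) (E : ∀ c, ExactPairing (V₁ p q c) (V₂ q p c))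
    (hV : ∀ a b c, ¬ (p ∈ ({a, b, c} : Set Λ) ∧ q ∈ ({a, b, c} : Set Λ)) → V₂ a b c = V₁ a b c)
    (Z : ∀ t : Simplex K 3 o₁, StateSpace V₁ t.1 × CoStateSpace V₁ t.1)
    (t : Simplex K 3 o₂) (u : Simplex K 3 o₁) (hu : resort t = u) (ht : t.1 0 = q ∧ t.1 1 = p)
    (h₁ : V₂ (t.1 1) (t.1 2) (t.1 3) = V₁ (u.1 0) (u.1 2) (u.1 3))
    (h₄ : V₂ (t.1 0) (t.1 2) (t.1 3) = V₁ (u.1 1) (u.1 2) (u.1 3))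
    (h₅ : u.1 0 = p) (h₆ : u.1 1 = q) (h₇ : t.1 2 = u.1 2) (h₈ : t.1 3 = u.1 3) :
    h.transport E hV t (Z (resort t)) = castPair h₁ rfl rfl h₄ (bendPair
      (castPairing E h₅ h₆ ht.1 ht.2 h₇) (castPairing E h₅ h₆ ht.1 ht.2 h₈) (Z u)) := by
  subst hu
  rw [IsSwap.transport, dif_pos ht]
  rfl

theorem IsSwap.transport_not_both (h : IsSwap o₁ o₂ p q)
    (E : ∀ c, ExactPairing (V₁ p q c) (V₂ q p c))
    (hV : ∀ a b c, ¬ (p ∈ ({a, b, c} : Set Λ) ∧ q ∈ ({a, b, c} : Set Λ)) → V₂ a b c = V₁ a b c)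
    (Z : ∀ t : Simplex K 3 o₁, StateSpace V₁ t.1 × CoStateSpace V₁ t.1)
    (t : Simplex K 3 o₂) (u : Simplex K 3 o₁) (hu : resort t = u)
    (ht : ¬ (t.1 0 = q ∧ t.1 1 = p))
    (h₁ : V₂ (t.1 1) (t.1 2) (t.1 3) = V₁ (u.1 1) (u.1 2) (u.1 3))
    (h₂ : V₂ (t.1 0) (t.1 1) (t.1 3) = V₁ (u.1 0) (u.1 1) (u.1 3))
    (h₃ : V₂ (t.1 0) (t.1 1) (t.1 2) = V₁ (u.1 0) (u.1 1) (u.1 2))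
    (h₄ : V₂ (t.1 0) (t.1 2) (t.1 3) = V₁ (u.1 0) (u.1 2) (u.1 3)) :
    h.transport E hV t (Z (resort t)) = castPair h₁ h₂ h₃ h₄ (Z u) := by
  subst hu
  rw [IsSwap.transport, dif_neg ht]

/-- Only duality data for triangles through both vertices is required, not equality with the chosen
dual. This suits colours, which represent duals only up to isomorphism. -/
theorem stateSum_swap [Finite Λ] (h : IsSwap o₁ o₂ p q)
    (E : ∀ c, ExactPairing (V₁ p q c) (V₂ q p c))
    (hV : ∀ a b c, ¬ (p ∈ ({a, b, c} : Set Λ) ∧ q ∈ ({a, b, c} : Set Λ)) → V₂ a b c = V₁ a b c)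
    (ω : K.Orientation) : stateSum o₂ V₂ ω = stateSum o₁ V₁ ω := by
  refine stateSum_eq_of_transport V₁ V₂ ω (h.transport E hV) (fun t n z hz => ?_) fun Z s => ?_
  · by_cases ht : t.1 0 = q ∧ t.1 1 = p
    · simp only [IsSwap.transport, dif_pos ht]
      exact (hz.bendPair _ _).castPair _ _ _ _
    · simp only [IsSwap.transport, dif_neg ht]
      exact hz.castPair _ _ _ _
  · by_cases hs : s.1 0 = q ∧ s.1 1 = p
    · have hi := h.resort_apply s hs
      have hi' : ∀ i, i ≠ 0 → i ≠ 1 → s.1 i = (resort (o₁ := o₁) s).1 i := fun i h0 h1 => by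
        rw [hi, Equiv.swap_apply_of_ne_of_ne h0 h1]
      have hW := h.obj_eq_of_both hV s hs
      -- This sign makes the positive and negative diagrams correspond through `diagramTrace_bend`.
      have hsign : ω.sign s.1 = -ω.sign (resort (o₁ := o₁) s).1 := by
        rw [h.resort_both s hs, ω.alternating s.1 ⟨s.injective, s.2.2⟩,
          Equiv.Perm.sign_swap (by decide)]
        simp
      -- Face `0` has lost `q` and face `1` has lost `p`, so neither is bent.
      have h0 : ¬ ((faceOf s 0).1 0 = q ∧ (faceOf s 0).1 1 = p) := fun h' =>
        absurd (s.injective (a₁ := 1) (h'.1.trans hs.1.symm)) (by decide)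
      have h1 : ¬ ((faceOf s 1).1 0 = q ∧ (faceOf s 1).1 1 = p) := fun h' =>
        absurd (s.injective (a₁ := 2) (h'.2.trans hs.2.symm)) (by decide)
      rw [hsign]
      refine congrArg (scalar C) ((diagramTrace_congr _
        (h.transport_not_both E hV Z (faceOf s 0) (faceOf (resort s) 1) ?_ h0 ?_ ?_ ?_ ?_)
        (h.transport_not_both E hV Z (faceOf s 1) (faceOf (resort s) 0) ?_ h1 ?_ ?_ ?_ ?_)
        (h.transport_both E hV Z (faceOf s 2) (faceOf (resort s) 2) ?_ hs ?_ ?_ ?_ ?_ ?_ ?_)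
        (h.transport_both E hV Z (faceOf s 3) (faceOf (resort s) 3) ?_ hs ?_ ?_ ?_ ?_ ?_ ?_)
        (h.transport_both E hV Z (faceOf s 4) (faceOf (resort s) 4) ?_ hs ?_ ?_ ?_ ?_ ?_ ?_)).trans
        (diagramTrace_bend _ (castPairing E ?_ ?_ ?_ ?_ ?_) (castPairing E ?_ ?_ ?_ ?_ ?_)
          (castPairing E ?_ ?_ ?_ ?_ ?_) ?_ ?_ ?_ ?_ ?_ ?_ ?_ _ _ _ _ _))
      all_goals first
        | exact resort_faceOf s _ _ (hi _)
        | exact hW _ _ _ (by decide)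
        | exact (hi _).trans hs.1
        | exact (hi _).trans hs.2
        | exact hi' _ (by decide) (by decide)
        | exact hs.1
        | exact hs.2
    · have hr := h.resort_other s hs
      have hi : ∀ i, (resort (o₁ := o₁) s).1 i = s.1 i := fun i => congrFun hr i
      have hW := h.obj_eq_of_not_both hV s hs
      have hn : ∀ j, ¬ ((faceOf s j).1 0 = q ∧ (faceOf s j).1 1 = p) := fun j h' =>
        hs (h.first_two s h'.1 h'.2)
      have hsign : ω.sign s.1 = ω.sign (resort (o₁ := o₁) s).1 := by rw [hr]
      rw [hsign]
      refine congrArg (scalar C) ((diagramTrace_congr _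
        (h.transport_not_both E hV Z (faceOf s 0) (faceOf (resort s) 0) ?_ (hn _) ?_ ?_ ?_ ?_)
        (h.transport_not_both E hV Z (faceOf s 1) (faceOf (resort s) 1) ?_ (hn _) ?_ ?_ ?_ ?_)
        (h.transport_not_both E hV Z (faceOf s 2) (faceOf (resort s) 2) ?_ (hn _) ?_ ?_ ?_ ?_)
        (h.transport_not_both E hV Z (faceOf s 3) (faceOf (resort s) 3) ?_ (hn _) ?_ ?_ ?_ ?_)
        (h.transport_not_both E hV Z (faceOf s 4) (faceOf (resort s) 4) ?_ (hn _) ?_ ?_ ?_ ?_)).trans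
        (diagramTrace_cast _ ?_ ?_ ?_ ?_ ?_ ?_ ?_ ?_ ?_ ?_ _ _ _ _ _))
      all_goals first
        | exact resort_faceOf s _ _ (hi _)
        | exact hW _ _ _

end Swap


open CombinatorialComplex

/-! ### Behaviour of colourings under the two moves -/

section Colourings

variable {C : Type u} [Category.{v} C] [MonoidalCategory C] [BraidedCategory C]
  [RightRigidCategory C] [RibbonCategory C] [Preadditive C] [Linear ℂ C]
  [MonoidalPreadditive C] [MonoidalLinear ℂ C]
variable {Λ : Type w} {K : CombinatorialComplex Λ} {C₀ : ColourSet C}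

/-- The objects attached to ordered triangles with respect to the order `o`. -/
abbrev colourFun (o : LinearOrder Λ) (V : Colouring K C₀) : Λ → Λ → Λ → C :=
  fun a b c => colourObj V a b c

/-- The order of `a, b, c` is an even permutation of the order `o`. -/
abbrev IsEven (o : LinearOrder Λ) (a b c : Λ) : Prop :=
  (a < b ∧ b < c) ∨ (b < c ∧ c < a) ∨ (c < a ∧ a < b)

open scoped Classical in
-- Naming the triangle `t` separately lets different orderings of its vertices refer to the same
-- colour.
theorem colourFun_of_mem (o : LinearOrder Λ) (V : Colouring K C₀) {a b c : Λ}
    (t : K.kSimplices 2) (h : ({a, b, c} : Set Λ) = t) :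
    colourFun o V a b c = if IsEven o a b c then (V t : C) else (V t : C)ᘁ := by
  obtain ⟨t, ht⟩ := t
  subst h
  exact dif_pos ht

theorem colourFun_of_notMem (o : LinearOrder Λ) (V : Colouring K C₀) {a b c : Λ}
    (h : ({a, b, c} : Set Λ) ∉ K.kSimplices 2) : colourFun o V a b c = 𝟙_ C :=
  dif_neg h

theorem colourFun_cyclic (o : LinearOrder Λ) (V : Colouring K C₀) (a b c : Λ) :
    colourFun o V a b c = colourFun o V b c a := by
  have hs : ({b, c, a} : Set Λ) = {a, b, c} := by
    grind
  by_cases h : ({a, b, c} : Set Λ) ∈ K.kSimplices 2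
  · rw [colourFun_of_mem o V ⟨_, h⟩ rfl, colourFun_of_mem o V ⟨_, h⟩ hs]
    have : IsEven o a b c ↔ IsEven o b c a := by unfold IsEven; tauto
    simp only [this]
  · rw [colourFun_of_notMem o V h, colourFun_of_notMem o V (hs ▸ h)]

theorem ne_of_mem_kSimplices_two {a b c : Λ} (h : ({a, b, c} : Set Λ) ∈ K.kSimplices 2) :
    a ≠ b ∧ a ≠ c ∧ b ≠ c := by
  have h3 : ({a, b, c} : Set Λ).encard = 3 := h.2.trans (by norm_num)
  have key : ∀ x y : Λ, ({x, y} : Set Λ).encard ≠ 3 := fun x y h' => by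
    have := Set.encard_insert_le {y} x
    rw [h', Set.encard_singleton] at this
    exact absurd this (by decide)
  refine ⟨?_, ?_, ?_⟩ <;> rintro rfl
  · exact key a c (by rw [← h3]; simp)
  · exact key a b (by rw [← h3]; congr 1; grind)
  · exact key a b (by rw [← h3]; simp)

theorem colourFun_congr {o₁ o₂ : LinearOrder Λ} {V₁ V₂ : Colouring K C₀} {a b c : Λ}
    (hV : ∀ t : K.kSimplices 2, ({a, b, c} : Set Λ) = t → V₁ t = V₂ t)
    (h : a ≠ b → a ≠ c → b ≠ c → (IsEven o₁ a b c ↔ IsEven o₂ a b c)) :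
    colourFun o₁ V₁ a b c = colourFun o₂ V₂ a b c := by
  by_cases ht : ({a, b, c} : Set Λ) ∈ K.kSimplices 2
  · obtain ⟨h₁, h₂, h₃⟩ := ne_of_mem_kSimplices_two ht
    rw [colourFun_of_mem o₁ V₁ ⟨_, ht⟩ rfl, colourFun_of_mem o₂ V₂ ⟨_, ht⟩ rfl, hV _ rfl]
    simp only [h h₁ h₂ h₃]
  · rw [colourFun_of_notMem o₁ V₁ ht, colourFun_of_notMem o₂ V₂ ht]

theorem lt_iff_of_lt_imp {o₁ o₂ : LinearOrder Λ} {a b : Λ} (h : a ≠ b)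
    (h₁ : o₂.lt a b → o₁.lt a b) (h₂ : o₂.lt b a → o₁.lt b a) : o₁.lt a b ↔ o₂.lt a b := by
  refine ⟨fun hab => ?_, h₁⟩
  rcases @lt_or_gt_of_ne _ o₂ _ _ h with h' | h'
  · exact h'
  · exact absurd hab (@lt_asymm _ o₁.toPartialOrder.toPreorder _ _ (h₂ h'))

/-- Parity of a triple depends only on the cyclic order, which moving the maximum to the bottom
preserves. The cases are the possible places of `m` in the triple. -/
theorem IsRotation.isEven_iff {o₁ o₂ : LinearOrder Λ} {m : Λ} (h : IsRotation o₁ o₂ m)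
    {a b c : Λ} (hab : a ≠ b) (hac : a ≠ c) (hbc : b ≠ c) :
    IsEven o₁ a b c ↔ IsEven o₂ a b c := by
  have key : ∀ x y, x ≠ m → y ≠ m → x ≠ y → (o₁.lt x y ↔ o₂.lt x y) := fun x y hx hy hxy =>
    lt_iff_of_lt_imp hxy (h.lt_of_lt x y hx hy) (h.lt_of_lt y x hy hx)
  have hm₁ : ∀ x, x ≠ m → ¬ o₁.lt m x := fun x hx =>
    @lt_asymm _ o₁.toPartialOrder.toPreorder _ _ (h.lt_max x hx)
  have hm₂ : ∀ x, x ≠ m → ¬ o₂.lt x m := fun x hx =>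
    @lt_asymm _ o₂.toPartialOrder.toPreorder _ _ (h.min_lt x hx)
  have hl₁ := h.lt_max
  have hl₂ := h.min_lt
  change ((o₁.lt a b ∧ o₁.lt b c) ∨ (o₁.lt b c ∧ o₁.lt c a) ∨ (o₁.lt c a ∧ o₁.lt a b)) ↔
    ((o₂.lt a b ∧ o₂.lt b c) ∨ (o₂.lt b c ∧ o₂.lt c a) ∨ (o₂.lt c a ∧ o₂.lt a b))
  by_cases ha : a = m
  · subst ha
    simp [hl₁ c hac.symm, hl₂ b hab.symm, hm₁ b hab.symm, hm₂ c hac.symm,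
      key b c hab.symm hac.symm hbc]
  by_cases hb : b = m
  · subst hb
    simp [hl₁ a ha, hl₂ c hbc.symm, hm₁ c hbc.symm, hm₂ a ha, key c a hbc.symm ha hac.symm]
  by_cases hc : c = m
  · subst hc
    simp [hl₁ b hb, hl₂ a ha, hm₁ a ha, hm₂ b hb, key a b ha hb hab]
  rw [key a b ha hb hab, key b c hb hc hbc, key c a hc ha hac.symm]

theorem IsRotation.colourFun_eq {o₁ o₂ : LinearOrder Λ} {m : Λ} (h : IsRotation o₁ o₂ m)
    (V : Colouring K C₀) : colourFun o₁ V = colourFun o₂ V := by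
  funext a b c
  exact colourFun_congr (fun _ _ => rfl) h.isEven_iff

theorem exists_dualColour (X : C₀.carrier) : ∃ Y : C₀.carrier, Nonempty ((Y : C) ≅ (X : C)ᘁ) := by
  obtain ⟨Y, hY, h⟩ := C₀.exists_dual X X.2
  exact ⟨⟨Y, hY⟩, h⟩

/-- The colour isomorphic to the dual of a colour. -/
def dualColour (X : C₀.carrier) : C₀.carrier := (exists_dualColour X).choose

theorem dualColour_iso (X : C₀.carrier) : Nonempty ((dualColour X : C) ≅ (X : C)ᘁ) :=
  (exists_dualColour X).choose_spec

/-- The reversed pairing makes `X` a dual of its dual colour. Uniqueness of duals gives an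
isomorphism, and isomorphic colours are equal. -/
theorem dualColour_dualColour (X : C₀.carrier) : dualColour (dualColour X) = X := by
  obtain ⟨i⟩ := dualColour_iso X
  obtain ⟨j⟩ := dualColour_iso (dualColour X)
  have p : ExactPairing (X : C) (dualColour X : C) := exactPairingCongrRight i
  exact Subtype.ext (C₀.eq_of_iso _ (Subtype.prop _) _ X.2
    ⟨j ≪≫ rightDualIso HasRightDual.exact (reversePairing (X : C) (dualColour X : C))⟩)

open scoped Classical in
/-- The colouring with the colours of all triangles which contain `p` and `q` replaced by their
duals. -/
def dualise (p q : Λ) (V : Colouring K C₀) : Colouring K C₀ :=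
  fun t => if p ∈ t.1 ∧ q ∈ t.1 then dualColour (V t) else V t

theorem dualise_involutive (p q : Λ) :
    Function.Involutive (dualise p q : Colouring K C₀ → Colouring K C₀) := by
  intro V
  funext t
  unfold dualise
  split_ifs
  · exact dualColour_dualColour _
  · rfl

theorem IsSwap.isEven_iff {o₁ o₂ : LinearOrder Λ} {p q : Λ} (h : IsSwap o₁ o₂ p q)
    {a b c : Λ} (hab : a ≠ b) (hac : a ≠ c) (hbc : b ≠ c)
    (hpq : ¬ (p ∈ ({a, b, c} : Set Λ) ∧ q ∈ ({a, b, c} : Set Λ))) :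
    IsEven o₁ a b c ↔ IsEven o₂ a b c := by
  have key : ∀ x y, x ∈ ({a, b, c} : Set Λ) → y ∈ ({a, b, c} : Set Λ) → x ≠ y →
      (o₁.lt x y ↔ o₂.lt x y) := fun x y hx hy hxy =>
    lt_iff_of_lt_imp hxy (fun h' => h.lt_of_lt' h' fun e => hpq ⟨e.2 ▸ hy, e.1 ▸ hx⟩)
      (fun h' => h.lt_of_lt' h' fun e => hpq ⟨e.2 ▸ hx, e.1 ▸ hy⟩)
  change ((o₁.lt a b ∧ o₁.lt b c) ∨ (o₁.lt b c ∧ o₁.lt c a) ∨ (o₁.lt c a ∧ o₁.lt a b)) ↔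
    ((o₂.lt a b ∧ o₂.lt b c) ∨ (o₂.lt b c ∧ o₂.lt c a) ∨ (o₂.lt c a ∧ o₂.lt a b))
  rw [key a b (by simp) (by simp) hab, key b c (by simp) (by simp) hbc,
    key c a (by simp) (by simp) hac.symm]

theorem IsSwap.colourFun_eq {o₁ o₂ : LinearOrder Λ} {p q : Λ} (h : IsSwap o₁ o₂ p q)
    (V : Colouring K C₀) (a b c : Λ)
    (hpq : ¬ (p ∈ ({a, b, c} : Set Λ) ∧ q ∈ ({a, b, c} : Set Λ))) :
    colourFun o₂ (dualise p q V) a b c = colourFun o₁ V a b c :=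
  (colourFun_congr (fun _ ht => (if_neg (ht ▸ hpq)).symm)
    fun hab hac hbc => h.isEven_iff hab hac hbc hpq).symm

/-- Each ordered triple is increasing for its own order, so both objects are colours themselves and
no second dual appears. Off the triangles both are the default unit object, which is self-dual. -/
theorem IsSwap.exactPairing_colourFun {o₁ o₂ : LinearOrder Λ} {p q : Λ} (h : IsSwap o₁ o₂ p q)
    (V : Colouring K C₀) (c : Λ) :
    Nonempty (ExactPairing (colourFun o₁ V p q c) (colourFun o₂ (dualise p q V) q p c)) := by
  have hs : ({q, p, c} : Set Λ) = {p, q, c} := Set.insert_comm _ _ _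
  by_cases ht : ({p, q, c} : Set Λ) ∈ K.kSimplices 2
  · obtain ⟨-, hpc, hqc⟩ := ne_of_mem_kSimplices_two ht
    rw [colourFun_of_mem o₁ V ⟨_, ht⟩ rfl, colourFun_of_mem o₂ _ ⟨_, ht⟩ hs,
      if_pos (Or.inl ⟨h.lt₁, h.right₁ c hpc.symm hqc.symm⟩),
      if_pos (Or.inl ⟨h.lt₂, h.left₂ c hpc.symm hqc.symm⟩), dualise, if_pos (by simp)]
    obtain ⟨i⟩ := dualColour_iso (V ⟨_, ht⟩)
    exact ⟨exactPairingCongrRight i⟩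
  · rw [colourFun_of_notMem o₁ V ht, colourFun_of_notMem o₂ _ (hs ▸ ht)]
    exact ⟨exactPairingUnit⟩

variable [AdmissibleRibbonCategory C] [Finite Λ]

theorem partitionSummand_eq (ω : K.Orientation) (W : TriangleWeights K C) (o : LinearOrder Λ)
    (V : Colouring K C₀) : partitionSummand C₀ ω W o V =
      (∏ᶠ t : K.kSimplices 2, (W.weight t (V t) : ℂ)) * stateSum o (colourFun o V) ω := rfl

theorem weight_dualise (W : TriangleWeights K C) (p q : Λ) (V : Colouring K C₀)
    (t : K.kSimplices 2) : W.weight t (dualise p q V t) = W.weight t (V t) := by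
  unfold dualise
  split_ifs
  · rw [W.weight_iso t _ _ (dualColour_iso _), W.weight_dual]
  · rfl

/-- The summands for `o₁` and `o₂` agree after a permutation of the colourings. -/
def SummandsAgree (C₀ : ColourSet C) (ω : K.Orientation) (W : TriangleWeights K C)
    (o₁ o₂ : LinearOrder Λ) : Prop :=
  ∃ φ : Colouring K C₀ ≃ Colouring K C₀,
    ∀ V, partitionSummand C₀ ω W o₁ V = partitionSummand C₀ ω W o₂ (φ V)

variable {ω : K.Orientation} {W : TriangleWeights K C} {o₁ o₂ o₃ : LinearOrder Λ}

theorem SummandsAgree.refl (o : LinearOrder Λ) : SummandsAgree C₀ ω W o o :=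
  ⟨Equiv.refl _, fun _ => rfl⟩

theorem SummandsAgree.symm (h : SummandsAgree C₀ ω W o₁ o₂) : SummandsAgree C₀ ω W o₂ o₁ := by
  obtain ⟨φ, hφ⟩ := h
  exact ⟨φ.symm, fun V => by rw [hφ, Equiv.apply_symm_apply]⟩

theorem SummandsAgree.trans (h : SummandsAgree C₀ ω W o₁ o₂) (h' : SummandsAgree C₀ ω W o₂ o₃) :
    SummandsAgree C₀ ω W o₁ o₃ := by
  obtain ⟨φ, hφ⟩ := h
  obtain ⟨φ', hφ'⟩ := h'
  exact ⟨φ.trans φ', fun V => (hφ V).trans (hφ' _)⟩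

theorem IsRotation.summandsAgree {m : Λ} (h : IsRotation o₁ o₂ m) :
    SummandsAgree C₀ ω W o₁ o₂ :=
  ⟨Equiv.refl _, fun V => by
    rw [Equiv.refl_apply, partitionSummand_eq, partitionSummand_eq, h.colourFun_eq,
      stateSum_rotate h _ (colourFun_cyclic o₂ V)]⟩

theorem IsSwap.summandsAgree {p q : Λ} (h : IsSwap o₁ o₂ p q) : SummandsAgree C₀ ω W o₁ o₂ :=
  ⟨(dualise_involutive p q).toPerm, fun V => by
    rw [Function.Involutive.coe_toPerm, partitionSummand_eq, partitionSummand_eq,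
      stateSum_swap h (fun c => (h.exactPairing_colourFun V c).some) (h.colourFun_eq V)]
    simp only [weight_dualise]⟩

/-! ### Generation of all orders by the two moves -/

/-- The linear order given by an enumeration. -/
abbrev enumOrder {n : ℕ} (e : Λ ≃ Fin n) : LinearOrder Λ := LinearOrder.lift' e e.injective

theorem enumOrder_lt {n : ℕ} (e : Λ ≃ Fin n) (a b : Λ) : (enumOrder e).lt a b ↔ e a < e b :=
  Iff.rfl

theorem exists_enumOrder_eq (o : LinearOrder Λ) : ∃ e : Λ ≃ Fin (Nat.card Λ), enumOrder e = o := by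
  have := Fintype.ofFinite Λ
  let e := (Fintype.orderIsoFinOfCardEq Λ Nat.card_eq_fintype_card.symm).symm
  exact ⟨e.toEquiv, LinearOrder.ext fun x y => e.le_iff_le⟩

theorem isRotation_enumOrder {n : ℕ} (e : Λ ≃ Fin (n + 2)) :
    IsRotation (enumOrder e) (enumOrder (e.trans (finRotate (n + 2)))) (e.symm (Fin.last _)) where
  lt_max a ha := by
    rw [enumOrder_lt, Equiv.apply_symm_apply]
    exact Fin.lt_last_iff_ne_last.mpr fun h => ha (by rw [← h, Equiv.symm_apply_apply])
  min_lt a ha := by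
    rw [enumOrder_lt, Equiv.trans_apply, Equiv.apply_symm_apply, finRotate_last]
    refine Fin.pos_iff_ne_zero.mpr fun h => ha ?_
    rw [← finRotate_last, Equiv.trans_apply, (finRotate _).injective.eq_iff] at h
    rw [← h, Equiv.symm_apply_apply]
  lt_of_lt a b ha hb h := by
    have hlast : ∀ x : Λ, x ≠ e.symm (Fin.last _) → ∃ i : Fin (n + 1), e x = i.castSucc :=
      fun x hx => (Fin.exists_castSucc_eq.mpr fun h => hx (by
        rw [← h, Equiv.symm_apply_apply])).imp fun _ => Eq.symm
    obtain ⟨i, hi⟩ := hlast a ha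
    obtain ⟨j, hj⟩ := hlast b hb
    rw [enumOrder_lt, Equiv.trans_apply, Equiv.trans_apply, hi, hj, finRotate_apply,
      finRotate_apply, Fin.coeSucc_eq_succ, Fin.coeSucc_eq_succ, Fin.succ_lt_succ_iff] at h
    rw [enumOrder_lt, hi, hj]
    exact Fin.castSucc_lt_castSucc_iff.mpr h

theorem isSwap_enumOrder {n : ℕ} (e : Λ ≃ Fin (n + 2)) :
    IsSwap (enumOrder e) (enumOrder (e.trans (Equiv.swap 0 1))) (e.symm 0) (e.symm 1) := by
  have h2 : ∀ x, x ≠ e.symm 0 → x ≠ e.symm 1 → e x ≠ 0 ∧ e x ≠ 1 := fun x h0 h1 =>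
    ⟨fun h => h0 (by rw [← h, Equiv.symm_apply_apply]),
      fun h => h1 (by rw [← h, Equiv.symm_apply_apply])⟩
  have hlt : ∀ i : Fin (n + 2), i ≠ 0 → i ≠ 1 → 1 < i := fun i h0 h1 => by
    have := Fin.val_ne_of_ne h0
    have := Fin.val_ne_of_ne h1
    rw [Fin.lt_def]
    rw [Fin.val_zero] at *
    rw [Fin.val_one] at *
    omega
  constructor
  · simp [enumOrder_lt]
  · simp [enumOrder_lt]
  case lt_of_lt =>
    intro a b h0 h1 h0' h1' h
    obtain ⟨h0, h1⟩ := h2 a h0 h1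
    obtain ⟨h0', h1'⟩ := h2 b h0' h1'
    simpa [enumOrder_lt, Equiv.swap_apply_of_ne_of_ne h0 h1,
      Equiv.swap_apply_of_ne_of_ne h0' h1'] using h
  all_goals
    intro a h0 h1
    obtain ⟨h0, h1⟩ := h2 a h0 h1
    simp [enumOrder_lt, Equiv.swap_apply_of_ne_of_ne h0 h1, hlt _ h0 h1, Fin.pos_iff_ne_zero, h0]

/-- Quantifying over `e` inside the induction on words is essential: the second factor of a product
acts first, and the other factor is then applied to the changed enumeration. -/
theorem summandsAgree_enumOrder (n : ℕ) (σ : Equiv.Perm (Fin n)) :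
    ∀ e : Λ ≃ Fin n, SummandsAgree C₀ ω W (enumOrder e) (enumOrder (e.trans σ)) := by
  match n with
  | 0 | 1 =>
    intro e
    obtain rfl : σ = Equiv.refl _ := Subsingleton.elim _ _
    exact .refl _
  | n + 2 =>
    have hσ : σ ∈ Subgroup.closure {finRotate (n + 2), Equiv.swap 0 (finRotate (n + 2) 0)} := by
      -- A full cycle and the transposition of two neighbours in it generate the symmetric group.
      rw [Equiv.Perm.closure_cycle_adjacent_swap isCycle_finRotate support_finRotate]
      exact Subgroup.mem_top σ
    induction hσ using Subgroup.closure_induction with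
    | mem σ h =>
      intro e
      rcases h with rfl | rfl
      · exact (isRotation_enumOrder e).summandsAgree
      · rw [finRotate_apply, zero_add]
        exact (isSwap_enumOrder e).summandsAgree
    | one => exact fun e => .refl _
    | mul σ τ _ _ hσ hτ => exact fun e => (hτ e).trans (hσ (e.trans τ))
    | inv σ _ hσ =>
      intro e
      -- Starting from the enumeration already moved by the inverse, `σ` leads back to `e`; symmetry
      -- then gives the claim.
      have := hσ (e.trans σ⁻¹)
      rw [Equiv.trans_assoc] at this
      refine SummandsAgree.symm ?_
      convert this using 2
      ext x
      simp

theorem summandsAgree (C₀ : ColourSet C) (ω : K.Orientation) (W : TriangleWeights K C)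
    (o₁ o₂ : LinearOrder Λ) : SummandsAgree C₀ ω W o₁ o₂ := by
  obtain ⟨e₁, rfl⟩ := exists_enumOrder_eq o₁
  obtain ⟨e₂, rfl⟩ := exists_enumOrder_eq o₂
  have := summandsAgree_enumOrder (C₀ := C₀) (ω := ω) (W := W) _ (e₁.symm.trans e₂) e₁
  rwa [← Equiv.trans_assoc, Equiv.self_trans_symm, Equiv.refl_trans] at this

end Colourings

end SpinFoam

end

open SpinFoam in
theorem mainTheorem1 {C : Type u} [Category.{v} C] [MonoidalCategory C] [BraidedCategory C]
    [RightRigidCategory C] [RibbonCategory C] [Preadditive C] [Linear ℂ C]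
    [MonoidalPreadditive C] [MonoidalLinear ℂ C] [AdmissibleRibbonCategory C]
    (C₀ : ColourSet C) {Λ : Type w} [Fintype Λ] (K : CombinatorialComplex Λ)
    (hK : K.IsComplexOfDim 4) (hM : IsClosedPLManifold 4 K.realization) (ω : K.Orientation)
    (W : TriangleWeights K C) (o₁ o₂ : LinearOrder Λ) :
    (Summable (partitionSummand C₀ ω W o₁) ↔ Summable (partitionSummand C₀ ω W o₂)) ∧
      partitionFunction C₀ ω W o₁ = partitionFunction C₀ ω W o₂ := by
  obtain ⟨φ, hφ⟩ := summandsAgree C₀ ω W o₁ o₂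
  -- The two series are reindexings of each other. The equality of sums needs no convergence, since
  -- `tsum` is invariant under a bijection in any case.
  have h : partitionSummand C₀ ω W o₁ = partitionSummand C₀ ω W o₂ ∘ φ := funext hφ
  exact ⟨by rw [h, φ.summable_iff], by rw [partitionFunction, h]; exact φ.tsum_eq _⟩
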